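/- **Setting.** Let $n\ge 1$ and let $\Omega\subset\mathbb{R}^n$ be nonempty, open, bounded and convex. Let $\mathcal{L}w=-\operatorname{div}(A\nabla w)+cw$ with homogeneous Dirichlet boundary conditions, where $0\le c\in L^\infty(\Omega)$ and $A$ is Lipschitz on $\Omega$, symmetric and uniformly positive definite. Call a sequence $\{(\lambda_k,\varphi_k)\}_{k\in\mathbb{N}}$ with $\varphi_k\in H_0^1(\Omega)\setminus\{0\}$ an *eigensystem* of $\mathcal{L}$ if $\mathcal{L}\varphi_k=\lambda_k\varphi_k$ in the weak sense, i.e. $\int_\Omega (A\nabla\varphi_k\cdot\nabla v+c\varphi_kv)=\lambda_k\int_\Omega\varphi_kv$ for all $v\in H_0^1(\Omega)$, and $\{\varphi_k\}$ is an orthonormal basis of $L^2(\Omega)$; all $\lambda_k$ are then bounded below by a positive constant. Given an eigensystem, write $w_k=(w,\varphi_k)_{L^2(\Omega)}$ and, for $r\ge 0$, let $$\mathbb{H}^r(\Omega)=\Big\{w\in L^2(\Omega):\ \|w\|_{\mathbb{H}^r(\Omega)}^2:=\sum_k\lambda_k^r|w_k|^2<\infty\Big\},$$ let $\mathbb{H}^{-r}(\Omega)$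 be its dual (containing $L^2(\Omega)$ through the $L^2$ inner product), and let $\mathcal{L}^r:\mathbb{H}^r(\Omega)\to\mathbb{H}^{-r}(\Omega)$, $\langle\mathcal{L}^rw,v\rangle=\sum_k\lambda_k^rw_kv_k$. For $\gamma\in(1,2)$ the Caputo derivative is $\partial_t^\gamma u=I^{2-\gamma}[\partial_t^2u]$ with $I^\sigma[v](t)=\frac{1}{\Gamma(\sigma)}\int_0^t(t-r)^{\sigma-1}v(r)\,dr$; when $\partial_t^2u$ is not a function this means $\partial_t^\gamma u=\partial_t\, I^{2-\gamma}[\partial_tu-\partial_tu(0)]$, all time derivatives being weak derivatives on $(0,T)$. A *weak solution* of $$\partial_t^\gamma u+\mathcal{L}^su=f\ \text{ in }\Omega\times(0,T),\qquad u(0)=g,\quad \partial_tu(0)=h\ \text{ in }\Omega,$$ is a function $u\in L^\infty(0,T;\mathbb{H}^s(\Omega))$ with $\partial_tu\in L^\infty(0,T;L^2(\Omega))$ and $\partial_t^\gamma u\in L^2(0,T;\mathbb{H}^{-s}(\Omega))$ such that $u(0)=g$ and $\partial_tu(0)=h$ (for the representatives of $u$ in $C([0,T];L^2(\Omega))$ and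 of $\partial_tu$ in $C([0,T];\mathbb{H}^{-s}(\Omega))$, whose existence is part of the definition) and, for a.e. $t\in(0,T)$, $$\langle\partial_t^\gamma u,v\rangle+\langle\mathcal{L}^su,v\rangle=\langle f,v\rangle\qquad\forall v\in\mathbb{H}^s(\Omega).$$ Let $E_{\gamma,\mu}(z)=\sum_{j\ge0}z^j/\Gamma(\gamma j+\mu)$ be the Mittag-Leffler function and, for $w\in L^2(\Omega)$ and $t\ge0$, $$G_\gamma(t)w=\sum_kE_{\gamma,1}(-\lambda_k^st^\gamma)w_k\varphi_k,\quad H_\gamma(t)w=\sum_ktE_{\gamma,2}(-\lambda_k^st^\gamma)w_k\varphi_k,\quad F_\gamma(t)w=\sum_kt^{\gamma-1}E_{\gamma,\gamma}(-\lambda_k^st^\gamma)w_k\varphi_k.$$ **Theorem.** Let $s\in(0,1)$, $\gamma\in(1,2)$ and $T>0$. Then $\mathcal{L}$ has an eigensystem, and there is a constant $C$, depending only on $\Omega,A,c,s,\gamma,T$, such that for every eigensystem and all $f\in L^\infty(0,T;L^2(\Omega))$, $g\in\mathbb{H}^{2s}(\Omega)$ and $h\in L^2(\Omega)$ the following holds.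 The problem above has a unique weak solution $u$ (unique up to equality a.e. in $(0,T)$). Its continuous representative is given, for every $t\in[0,T]$, by $$u(t)=G_\gamma(t)g+H_\gamma(t)h+\int_0^tF_\gamma(t-r)f(r)\,dr .$$ Moreover $u\in C([0,T];\mathbb{H}^s(\Omega))$ with $u(0)=g$, $\partial_tu\in C([0,T];L^2(\Omega))$ with $\partial_tu(0)=h$, and $$\|u\|_{L^\infty(0,T;\mathbb{H}^s(\Omega))}+\|\partial_tu\|_{L^2(0,T;L^2(\Omega))}\le C\big(\|f\|_{L^2(0,T;L^2(\Omega))}+\|g\|_{\mathbb{H}^s(\Omega)}+\|h\|_{L^2(\Omega)}\big),$$ $$\|\partial_tu\|_{L^\infty(0,T;L^2(\Omega))}\le C\big(\|f\|_{L^\infty(0,T;L^2(\Omega))}+\|g\|_{\mathbb{H}^{2s}(\Omega)}+\|h\|_{L^2(\Omega)}\big).$$ -/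

import Mathlib

open MeasureTheory Set Filter Topology
open scoped NNReal ENNReal ContDiff

noncomputable section

/-! ## The elliptic operator `𝓛 w = - div (A ∇ w) + c w` on a bounded convex domain -/

/-- A nonempty open bounded convex set `Ω ⊆ ℝⁿ`, `n ≥ 1`, with the coefficients of the operator
`𝓛 w = - div (A ∇ w) + c w`: `A` is Lipschitz on `Ω`, symmetric and uniformly positive definite,
and `0 ≤ c ∈ L^∞(Ω)`. -/
structure EllipticOperator (n : ℕ) where
  dim_pos : 1 ≤ n
  Ω : Set (EuclideanSpace ℝ (Fin n))
  isOpen_Ω : IsOpen Ω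
  isBounded_Ω : Bornology.IsBounded Ω
  convex_Ω : Convex ℝ Ω
  nonempty_Ω : Ω.Nonempty
  A : EuclideanSpace ℝ (Fin n) → Matrix (Fin n) (Fin n) ℝ
  lipschitz_A : ∀ i j, ∃ K : ℝ≥0, LipschitzOnWith K (fun x => A x i j) Ω
  symm_A : ∀ x ∈ Ω, (A x).IsSymm
  posDef_A : ∃ α : ℝ, 0 < α ∧ ∀ x ∈ Ω, ∀ ξ : EuclideanSpace ℝ (Fin n),
    α * ‖ξ‖ ^ 2 ≤ ∑ i, ∑ j, A x i j * ξ j * ξ i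
  c : EuclideanSpace ℝ (Fin n) → ℝ
  memLp_c : MemLp c ∞ (volume.restrict Ω)
  nonneg_c : ∀ᵐ x ∂volume.restrict Ω, 0 ≤ c x

namespace EllipticOperator

variable {n : ℕ} (L : EllipticOperator n)

/-- `L²(Ω)`. -/
abbrev L2 : Type := Lp ℝ 2 (volume.restrict L.Ω)

/-- `L²(Ω; ℝⁿ)`. -/
abbrev L2Vec : Type := Lp (EuclideanSpace ℝ (Fin n)) 2 (volume.restrict L.Ω)

/-- The pairs `(φ, ∇ φ)` with `φ ∈ C_c^∞(Ω)`. -/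
def testPairs : Set (L.L2 × L.L2Vec) :=
  {p | ∃ φ : EuclideanSpace ℝ (Fin n) → ℝ, ContDiff ℝ ∞ φ ∧ HasCompactSupport φ ∧
    tsupport φ ⊆ L.Ω ∧ p.1 =ᵐ[volume.restrict L.Ω] φ ∧
    p.2 =ᵐ[volume.restrict L.Ω] fun x => gradient φ x}

/-- The pairs `(v, ∇ v)` with `v ∈ H₀¹(Ω)`, the space `H₀¹(Ω)` being the closure of `C_c^∞(Ω)` in
the norm of `H¹(Ω)`. -/
def H10 : Set (L.L2 × L.L2Vec) := closure L.testPairs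

/-- The bilinear form `∫_Ω (A ∇ v · ∇ w + c v w)` of `𝓛`, on pairs (function, gradient). -/
def form (p q : L.L2 × L.L2Vec) : ℝ :=
  ∫ x in L.Ω, ((∑ i, ∑ j, L.A x i j * (p.2 x) j * (q.2 x) i) + L.c x * p.1 x * q.1 x)

/-- `(lam, φ)` solves `𝓛 φ = lam φ` in `Ω`, `φ = 0` on `∂Ω`, with `φ ∈ H₀¹(Ω) \ {0}`, in the weak
sense. -/
def IsEigenpair (lam : ℝ) (φ : L.L2) : Prop :=
  φ ≠ 0 ∧ ∃ Dφ : L.L2Vec, (φ, Dφ) ∈ L.H10 ∧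
    ∀ q ∈ L.H10, L.form (φ, Dφ) q = lam * ∫ x in L.Ω, φ x * q.1 x

/-- A sequence of eigenpairs `(lam k, φ k)` of `𝓛` whose eigenfunctions form an orthonormal basis of
`L²(Ω)`. -/
structure EigenSystem where
  lam : ℕ → ℝ
  φ : HilbertBasis ℕ ℝ L.L2
  eigen : ∀ k, L.IsEigenpair (lam k) (φ k)

/-! ### The eigenvalues are bounded below by a positive constant -/

lemma poincare_aux {Ω : Set (EuclideanSpace ℝ (Fin n))} {R : ℝ} (hR : ∀ x ∈ Ω, ‖x‖ ≤ R)
    {φ : EuclideanSpace ℝ (Fin n) → ℝ}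
    (h1 : ContDiff ℝ ∞ φ) (h2 : HasCompactSupport φ) (h3 : tsupport φ ⊆ Ω)
    (e : EuclideanSpace ℝ (Fin n)) (he : ‖e‖ = 1)
    (P : EuclideanSpace ℝ (Fin n) →L[ℝ] ℝ) (hP : ∀ x, |P x| ≤ ‖x‖) (hPe : P e = 1) :
    ∫ x, φ x ^ 2 ≤ 4 * R ^ 2 * ∫ x, ‖fderiv ℝ φ x‖ ^ 2 := by
  have hd : Differentiable ℝ φ := h1.differentiable (by simp)
  have hcφ : Continuous φ := h1.continuous
  have hcD : Continuous (fderiv ℝ φ) := h1.continuous_fderiv (by simp)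
  have hcDe : Continuous fun x => fderiv ℝ φ x e := hcD.clm_apply continuous_const
  have hcP : Continuous fun x => P x := P.continuous
  have hsD : HasCompactSupport (fderiv ℝ φ) := h2.fderiv ℝ
  have hs2 : HasCompactSupport fun x => φ x ^ 2 :=
    h2.comp_left (g := fun y : ℝ => y ^ 2) (by simp)
  have hsq : ∀ x, fderiv ℝ (fun x => φ x ^ 2) x e = 2 * φ x * fderiv ℝ φ x e := fun x => by
    rw [((hd x).hasFDerivAt.pow 2).fderiv]
    simp
  have hPe' : ∀ x, fderiv ℝ (fun x => P x) x e = 1 := fun x => by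
    rw [ContinuousLinearMap.fderiv, hPe]
  have c1 : Continuous fun x => φ x ^ 2 := hcφ.pow 2
  have c2 : Continuous fun x => 2 * φ x * fderiv ℝ φ x e * P x :=
    ((continuous_const.mul hcφ).mul hcDe).mul hcP
  have c3 : Continuous fun x => φ x ^ 2 * P x := c1.mul hcP
  have c4 : Continuous fun x => ‖fderiv ℝ φ x‖ ^ 2 := hcD.norm.pow 2
  have s2 : HasCompactSupport fun x => 2 * φ x * fderiv ℝ φ x e * P x :=
    h2.mono fun x hx hx0 => hx (by simp [hx0])
  have s3 : HasCompactSupport fun x => φ x ^ 2 * P x :=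
    h2.mono fun x hx hx0 => hx (by simp [hx0])
  have s4 : HasCompactSupport fun x => ‖fderiv ℝ φ x‖ ^ 2 :=
    hsD.mono fun x hx hx0 => hx (by simp [hx0])
  have I1 := c1.integrable_of_hasCompactSupport (μ := volume) hs2
  have I2 := c2.integrable_of_hasCompactSupport (μ := volume) s2
  have I3 := c3.integrable_of_hasCompactSupport (μ := volume) s3
  have I4 := c4.integrable_of_hasCompactSupport (μ := volume) s4
  have key := integral_mul_fderiv_eq_neg_fderiv_mul_of_integrable (μ := volume)
    (f := fun x => φ x ^ 2) (g := fun x => P x) (v := e) (by simpa only [hsq] using I2)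
    (by simpa only [hPe', mul_one] using I1) I3
    (fun x _ => (hd x).pow 2) (fun x _ => P.differentiableAt)
  simp only [hsq, hPe', mul_one] at key
  have hb : ∀ x, -(2 * φ x * fderiv ℝ φ x e * P x) ≤
      (1 / 2) * φ x ^ 2 + 2 * R ^ 2 * ‖fderiv ℝ φ x‖ ^ 2 := fun x => by
    by_cases hx : φ x = 0
    · have : 0 ≤ 2 * R ^ 2 * ‖fderiv ℝ φ x‖ ^ 2 := by positivity
      rw [hx]
      linarith
    have a1 : |P x| ≤ R := (hP x).trans (hR x (h3 (subset_tsupport _ hx)))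
    have a2 : |fderiv ℝ φ x e| ≤ ‖fderiv ℝ φ x‖ := by
      have := (fderiv ℝ φ x).le_opNorm e
      rwa [he, mul_one] at this
    have a3 : |fderiv ℝ φ x e * P x| ≤ ‖fderiv ℝ φ x‖ * R := by
      rw [abs_mul]
      exact mul_le_mul a2 a1 (abs_nonneg _) (norm_nonneg _)
    generalize fderiv ℝ φ x e = a at *
    generalize P x = b at *
    generalize ‖fderiv ℝ φ x‖ = d at *
    generalize φ x = y at *
    have a4 : (a * b) ^ 2 ≤ (d * R) ^ 2 :=
      sq_le_sq' (by linarith [neg_abs_le (a * b)]) ((le_abs_self _).trans a3)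
    nlinarith [sq_nonneg (y + 2 * (a * b))]
  have hm := integral_mono I2.neg ((I1.const_mul (1 / 2)).add (I4.const_mul (2 * R ^ 2))) hb
  simp only [Pi.neg_apply, Pi.add_apply] at hm
  rw [integral_neg, ← key, integral_add (I1.const_mul _) (I4.const_mul _), integral_const_mul,
    integral_const_mul] at hm
  linarith

lemma norm_sq_eq_setIntegral {E : Type*} [NormedAddCommGroup E] [InnerProductSpace ℝ E]
    (v : Lp E 2 (volume.restrict L.Ω)) : ‖v‖ ^ 2 = ∫ x in L.Ω, ‖v x‖ ^ 2 := by
  have := MeasureTheory.L2.inner_def (𝕜 := ℝ) v v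
  rw [real_inner_self_eq_norm_sq] at this
  simpa [real_inner_self_eq_norm_sq] using this

lemma poincare : ∃ K : ℝ, 0 < K ∧ ∀ p ∈ L.H10, ‖p.1‖ ≤ K * ‖p.2‖ := by
  obtain ⟨R, hR0, hR⟩ := L.isBounded_Ω.exists_pos_norm_le
  refine ⟨2 * R, by positivity, fun p hp => ?_⟩
  have hcl : IsClosed {p : L.L2 × L.L2Vec | ‖p.1‖ ≤ 2 * R * ‖p.2‖} :=
    isClosed_le (by fun_prop) (by fun_prop)
  refine closure_minimal ?_ hcl hp
  rintro q ⟨φ, h1, h2, h3, h4, h5⟩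
  have hp := poincare_aux hR h1 h2 h3 (EuclideanSpace.single ⟨0, L.dim_pos⟩ 1) (by simp)
    (EuclideanSpace.proj ⟨0, L.dim_pos⟩) (fun x => PiLp.norm_apply_le x _) (by simp)
  have e1 : ‖q.1‖ ^ 2 = ∫ x, φ x ^ 2 := by
    rw [← setIntegral_eq_integral_of_forall_compl_eq_zero (s := L.Ω) (f := fun x => φ x ^ 2),
      L.norm_sq_eq_setIntegral]
    · refine integral_congr_ae ?_
      filter_upwards [h4] with x hx
      simp [hx]
    · intro x hx
      rw [image_eq_zero_of_notMem_tsupport fun h => hx (h3 h)]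
      simp
  have e2 : ‖q.2‖ ^ 2 = ∫ x, ‖fderiv ℝ φ x‖ ^ 2 := by
    rw [← setIntegral_eq_integral_of_forall_compl_eq_zero (s := L.Ω)
      (f := fun x => ‖fderiv ℝ φ x‖ ^ 2), L.norm_sq_eq_setIntegral]
    · refine integral_congr_ae ?_
      filter_upwards [h5] with x hx
      simp [hx, gradient]
    · intro x hx
      have : fderiv ℝ φ x = 0 :=
        image_eq_zero_of_notMem_tsupport fun h => hx (h3 (tsupport_fderiv_subset ℝ h))
      simp [this]
  rw [← e1, ← e2] at hp
  change ‖q.1‖ ≤ 2 * R * ‖q.2‖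
  refine le_of_sq_le_sq ?_ (by positivity)
  linarith [mul_pow (2 * R) ‖q.2‖ 2, mul_pow 2 R 2]

lemma integrable_form (p q : L.L2 × L.L2Vec) : IntegrableOn (fun x =>
    (∑ i, ∑ j, L.A x i j * (p.2 x) j * (q.2 x) i) + L.c x * p.1 x * q.1 x) L.Ω := by
  have hcoord : ∀ (v : L.L2Vec) (i : Fin n), MemLp (fun x => (v x) i) 2 (volume.restrict L.Ω) :=
    fun v i => (Lp.memLp v).continuousLinearMap_comp (EuclideanSpace.proj (𝕜 := ℝ) i)
  refine Integrable.add ?_ ?_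
  · refine integrable_finsetSum _ fun i _ => integrable_finsetSum _ fun j _ => ?_
    have hA : MemLp (fun x => L.A x i j) ∞ (volume.restrict L.Ω) := by
      obtain ⟨K, hK⟩ := L.lipschitz_A i j
      obtain ⟨x₀, hx₀⟩ := L.nonempty_Ω
      obtain ⟨D, hD⟩ := Metric.isBounded_iff.1 L.isBounded_Ω
      refine memLp_top_of_bound
        (hK.continuousOn.aestronglyMeasurable L.isOpen_Ω.measurableSet)
        (‖L.A x₀ i j‖ + K * D) ?_
      filter_upwards [ae_restrict_mem L.isOpen_Ω.measurableSet] with x hx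
      have h1 := hK.dist_le_mul x hx x₀ hx₀
      have h2 := mul_le_mul_of_nonneg_left (hD hx hx₀) K.2
      have h3 := norm_le_norm_add_norm_sub' (L.A x i j) (L.A x₀ i j)
      rw [← dist_eq_norm] at h3
      exact h3.trans (by gcongr; exact h1.trans h2)
    have h1 : MemLp (fun x => L.A x i j * (p.2 x) j) 2 (volume.restrict L.Ω) :=
      (hcoord p.2 j).mul hA
    exact h1.integrable_mul (hcoord q.2 i)
  · have h1 : MemLp (fun x => L.c x * p.1 x) 2 (volume.restrict L.Ω) :=
      (Lp.memLp p.1).mul L.memLp_c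
    exact h1.integrable_mul (Lp.memLp q.1)

lemma form_coercive : ∃ m : ℝ, 0 < m ∧ ∀ p ∈ L.H10, m * ‖p.1‖ ^ 2 ≤ L.form p p := by
  obtain ⟨K, hK0, hK⟩ := L.poincare
  obtain ⟨α, hα0, hα⟩ := L.posDef_A
  refine ⟨α / K ^ 2, by positivity, fun p hp => ?_⟩
  have h1 : ‖p.1‖ ^ 2 ≤ K ^ 2 * ‖p.2‖ ^ 2 := by
    rw [← mul_pow]
    exact pow_le_pow_left₀ (norm_nonneg _) (hK p hp) 2
  have h2 : α * ‖p.2‖ ^ 2 ≤ L.form p p := by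
    rw [norm_sq_eq_setIntegral, ← integral_const_mul]
    refine integral_mono_ae ?_ (L.integrable_form p p) ?_
    · exact ((memLp_two_iff_integrable_sq_norm (Lp.memLp p.2).1).1 (Lp.memLp p.2)).const_mul α
    · filter_upwards [ae_restrict_mem L.isOpen_Ω.measurableSet, L.nonneg_c] with x hx hc
      have := hα x hx (p.2 x)
      have h0 : 0 ≤ L.c x * p.1 x * p.1 x := by
        rw [mul_assoc]
        exact mul_nonneg hc (mul_self_nonneg _)
      linarith
  refine le_trans ?_ h2
  rw [div_mul_eq_mul_div, div_le_iff₀ (by positivity)]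
  nlinarith

namespace EigenSystem

variable {L} (S : L.EigenSystem)

lemma exists_le_lam : ∃ m : ℝ, 0 < m ∧ ∀ k, m ≤ S.lam k := by
  obtain ⟨m, hm, h⟩ := L.form_coercive
  refine ⟨m, hm, fun k => ?_⟩
  obtain ⟨-, D, hD, he⟩ := S.eigen k
  have h1 := h _ hD
  rw [he _ hD] at h1
  have h2 : ‖S.φ k‖ = 1 := S.φ.orthonormal.1 k
  have h3 : ∫ x in L.Ω, (S.φ k) x * (S.φ k) x = 1 := by
    have := L2.inner_def (𝕜 := ℝ) (S.φ k) (S.φ k)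
    rw [real_inner_self_eq_norm_sq, h2] at this
    simpa [pow_two] using this.symm
  rw [h3, h2] at h1
  linarith

lemma lam_pos (k : ℕ) : 0 < S.lam k := by
  obtain ⟨m, hm, h⟩ := S.exists_le_lam
  exact hm.trans_le (h k)

/-! ### The spaces `ℍ^r(Ω)` and the fractional powers of `𝓛` -/

/-- The coefficient `w_k = (w, φ_k)` in `L²(Ω)`. -/
def coeff (w : L.L2) (k : ℕ) : ℝ := inner ℝ (S.φ k) w

lemma coeff_add (v w : L.L2) (k : ℕ) : S.coeff (v + w) k = S.coeff v k + S.coeff w k :=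
  inner_add_right _ _ _

lemma coeff_smul (a : ℝ) (w : L.L2) (k : ℕ) : S.coeff (a • w) k = a * S.coeff w k :=
  real_inner_smul_right _ _ _

/-- The weighted coefficients `lam_k ^ (r / 2) * w_k`. -/
def wcoeff (r : ℝ≥0) (w : L.L2) (k : ℕ) : ℝ := S.lam k ^ ((r : ℝ) / 2) * S.coeff w k

lemma wcoeff_mul (r : ℝ≥0) (v w : L.L2) (k : ℕ) :
    S.wcoeff r v k * S.wcoeff r w k = S.lam k ^ (r : ℝ) * (S.coeff v k * S.coeff w k) := by
  have : S.lam k ^ (r : ℝ) = S.lam k ^ ((r : ℝ) / 2) * S.lam k ^ ((r : ℝ) / 2) := by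
    rw [← Real.rpow_add (S.lam_pos k), add_halves]
  rw [this, wcoeff, wcoeff]
  ring

lemma memℓp_wcoeff_iff (r : ℝ≥0) (w : L.L2) :
    Memℓp (S.wcoeff r w) 2 ↔ Summable fun k => S.lam k ^ (r : ℝ) * S.coeff w k ^ 2 := by
  rw [memℓp_gen_iff (by norm_num)]
  refine summable_congr fun k => ?_
  have := S.wcoeff_mul r w w k
  rw [← pow_two, ← pow_two] at this
  simp [this]

/-- The set of `w ∈ L²(Ω)` with `∑_k lam_k ^ r * w_k ^ 2 < ∞`, as a linear subspace. -/
def hSub (r : ℝ≥0) : Submodule ℝ L.L2 where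
  carrier := {w | Summable fun k => S.lam k ^ (r : ℝ) * S.coeff w k ^ 2}
  zero_mem' := by simp [coeff]
  add_mem' {v w} hv hw := by
    rw [Set.mem_ofPred_eq, ← memℓp_wcoeff_iff] at *
    convert hv.add hw using 1
    funext k
    simp [wcoeff, coeff_add, mul_add]
  smul_mem' a w hw := by
    rw [Set.mem_ofPred_eq, ← memℓp_wcoeff_iff] at *
    convert hw.const_smul a using 1
    funext k
    simp [wcoeff, coeff_smul]
    ring

/-- The norm of `ℍ^r(Ω)`: `‖w‖ ^ 2 = ∑_k lam_k ^ r * w_k ^ 2`. -/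
def hNorm (r : ℝ≥0) (w : L.L2) : ℝ := √(∑' k, S.lam k ^ (r : ℝ) * S.coeff w k ^ 2)

/-- The space `ℍ^r(Ω)`, `r ≥ 0`; a copy of `hSub r`, so that it carries its own norm. -/
def HSpace (r : ℝ≥0) : Type := S.hSub r

instance (r : ℝ≥0) : AddCommGroup (S.HSpace r) := inferInstanceAs (AddCommGroup (S.hSub r))

instance (r : ℝ≥0) : Module ℝ (S.HSpace r) := inferInstanceAs (Module ℝ (S.hSub r))

/-- The inclusion `ℍ^r(Ω) ⊆ L²(Ω)`. -/
def inclₗ (r : ℝ≥0) : S.HSpace r →ₗ[ℝ] L.L2 := (S.hSub r).subtype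

/-- The map `w ↦ (lam_k ^ (r / 2) * w_k)_k` from `ℍ^r(Ω)` to `ℓ²`. -/
def toSeq (r : ℝ≥0) : S.HSpace r →ₗ[ℝ] lp (fun _ : ℕ => ℝ) 2 where
  toFun w := ⟨S.wcoeff r (S.inclₗ r w), (S.memℓp_wcoeff_iff r _).2 w.2⟩
  map_add' v w := by
    ext k
    change S.wcoeff r _ k = S.wcoeff r _ k + S.wcoeff r _ k
    simp [wcoeff, coeff_add, mul_add]
  map_smul' a w := by
    ext k
    simp [wcoeff, coeff_smul]
    ring

lemma toSeq_apply (r : ℝ≥0) (w : S.HSpace r) (k : ℕ) :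
    S.toSeq r w k = S.wcoeff r (S.inclₗ r w) k := rfl

lemma toSeq_injective (r : ℝ≥0) : Function.Injective (S.toSeq r) := by
  rw [injective_iff_map_eq_zero]
  intro w hw
  have h : ∀ k, S.coeff (S.inclₗ r w) k = 0 := fun k => by
    have : S.toSeq r w k = 0 := by rw [hw]; rfl
    rw [toSeq_apply, wcoeff] at this
    exact (mul_eq_zero.1 this).resolve_left (Real.rpow_pos_of_pos (S.lam_pos k) _).ne'
  have h0 : S.inclₗ r w = 0 := by
    apply S.φ.repr.injective
    ext k
    simpa [coeff, HilbertBasis.repr_apply_apply] using h k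
  exact Subtype.ext h0

instance (r : ℝ≥0) : NormedAddCommGroup (S.HSpace r) :=
  NormedAddCommGroup.induced _ _ (S.toSeq r) (S.toSeq_injective r)

instance (r : ℝ≥0) : NormedSpace ℝ (S.HSpace r) := NormedSpace.induced ℝ _ _ (S.toSeq r)

lemma inner_toSeq (r : ℝ≥0) (v w : S.HSpace r) :
    inner ℝ (S.toSeq r v) (S.toSeq r w) =
      ∑' k, S.lam k ^ (r : ℝ) * (S.coeff (S.inclₗ r v) k * S.coeff (S.inclₗ r w) k) := by
  rw [lp.inner_eq_tsum]
  refine tsum_congr fun k => ?_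
  rw [← wcoeff_mul, toSeq_apply, toSeq_apply, mul_comm]
  rfl

lemma norm_eq_hNorm (r : ℝ≥0) (w : S.HSpace r) : ‖w‖ = S.hNorm r (S.inclₗ r w) := by
  have h := S.inner_toSeq r w w
  rw [real_inner_self_eq_norm_sq] at h
  rw [hNorm]
  simp_rw [pow_two (S.coeff _ _)]
  rw [← h, Real.sqrt_sq (norm_nonneg _)]
  rfl

lemma exists_norm_incl_le (r : ℝ≥0) :
    ∃ C : ℝ, ∀ w : S.HSpace r, ‖S.inclₗ r w‖ ≤ C * ‖w‖ := by
  obtain ⟨m, hm, hml⟩ := S.exists_le_lam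
  have hm' : 0 < m ^ (r : ℝ) := Real.rpow_pos_of_pos hm _
  refine ⟨√((m ^ (r : ℝ))⁻¹), fun w => ?_⟩
  have h1 : HasSum (fun k => S.coeff (S.inclₗ r w) k ^ 2) (‖S.inclₗ r w‖ ^ 2) := by
    have := S.φ.hasSum_inner_mul_inner (S.inclₗ r w) (S.inclₗ r w)
    rw [real_inner_self_eq_norm_sq] at this
    simpa only [coeff, pow_two, real_inner_comm] using this
  have h2 : m ^ (r : ℝ) * ‖S.inclₗ r w‖ ^ 2 ≤ ‖w‖ ^ 2 := by
    rw [norm_eq_hNorm, hNorm, Real.sq_sqrt, ← h1.tsum_eq, ← tsum_mul_left]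
    · refine Summable.tsum_le_tsum (fun k => ?_) (h1.summable.mul_left _) w.2
      exact mul_le_mul_of_nonneg_right
        (Real.rpow_le_rpow hm.le (hml k) r.2) (sq_nonneg _)
    · exact tsum_nonneg fun k =>
        mul_nonneg (Real.rpow_nonneg (S.lam_pos k).le _) (sq_nonneg _)
  refine le_of_sq_le_sq ?_ (by positivity)
  rw [mul_pow, Real.sq_sqrt (by positivity), inv_mul_eq_div, le_div_iff₀ hm']
  linarith

/-- The continuous embedding `ℍ^r(Ω) ↪ L²(Ω)`. -/
def incl (r : ℝ≥0) : S.HSpace r →L[ℝ] L.L2 :=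
  (S.inclₗ r).mkContinuousOfExistsBound (S.exists_norm_incl_le r)

/-- The space `ℍ^{-r}(Ω)`, the dual of `ℍ^r(Ω)`. -/
abbrev HDual (r : ℝ≥0) : Type := StrongDual ℝ (S.HSpace r)

/-- The embedding `L²(Ω) ↪ ℍ^{-r}(Ω)`, `w ↦ (v ↦ (w, v)_{L²(Ω)})`. -/
def toDual (r : ℝ≥0) : L.L2 →L[ℝ] S.HDual r :=
  ((ContinuousLinearMap.compL ℝ (S.HSpace r) L.L2 ℝ).flip (S.incl r)).comp (innerSL ℝ)

lemma toDual_apply (r : ℝ≥0) (w : L.L2) (v : S.HSpace r) :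
    S.toDual r w v = inner ℝ w (S.incl r v) := rfl

/-- `𝓛^r : ℍ^r(Ω) → ℍ^{-r}(Ω)`, `𝓛^r w = ∑_k lam_k ^ r * w_k φ_k`, that is
`⟨𝓛^r w, v⟩ = ∑_k lam_k ^ r * w_k * v_k`. -/
def fracPow (r : ℝ≥0) (w : S.HSpace r) : S.HDual r :=
  LinearMap.mkContinuousOfExistsBound
    { toFun := fun v => ∑' k, S.lam k ^ (r : ℝ) * (S.coeff (S.incl r w) k * S.coeff (S.incl r v) k)
      map_add' := fun v v' => by
        have := inner_add_right (𝕜 := ℝ) (S.toSeq r w) (S.toSeq r v) (S.toSeq r v')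
        rw [← map_add, inner_toSeq, inner_toSeq, inner_toSeq] at this
        exact this
      map_smul' := fun a v => by
        have := real_inner_smul_right (S.toSeq r w) (S.toSeq r v) a
        rw [← map_smul, inner_toSeq, inner_toSeq] at this
        exact this }
    ⟨‖S.toSeq r w‖, fun v => by
      have := norm_inner_le_norm (𝕜 := ℝ) (S.toSeq r w) (S.toSeq r v)
      rw [inner_toSeq] at this
      exact this⟩

end EigenSystem

end EllipticOperator

/-! ## Functions of time with values in a Banach space -/

section Time

variable {X : Type*} [NormedAddCommGroup X] [NormedSpace ℝ X]

/-- Lebesgue measure on `(0,T)`. -/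
abbrev timeMeasure (T : ℝ) : Measure ℝ := volume.restrict (Ioo 0 T)

/-- `du ∈ L¹(0,T;X)` is the weak derivative of `u ∈ L¹(0,T;X)` on `(0,T)`. -/
def HasWeakTimeDeriv (T : ℝ) (u du : ℝ → X) : Prop :=
  Integrable u (timeMeasure T) ∧ Integrable du (timeMeasure T) ∧
    ∀ ψ : ℝ → ℝ, ContDiff ℝ ∞ ψ → HasCompactSupport ψ → tsupport ψ ⊆ Ioo 0 T →
      ∫ t, deriv ψ t • u t ∂timeMeasure T = - ∫ t, ψ t • du t ∂timeMeasure T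

/-- `u` has a representative in `C([0,T];X)` whose value at `0` is `x`. -/
def HasInitialValue (T : ℝ) (u : ℝ → X) (x : X) : Prop :=
  ∃ v : ℝ → X, ContinuousOn v (Icc 0 T) ∧ u =ᵐ[timeMeasure T] v ∧ v 0 = x

/-- The left Riemann–Liouville fractional integral
`I^σ[u](t) = Γ(σ)⁻¹ ∫₀ᵗ (t - r)^(σ - 1) u(r) dr`. -/
def fracIntegral (σ : ℝ) (u : ℝ → X) (t : ℝ) : X :=
  (Real.Gamma σ)⁻¹ • ∫ r in (0 : ℝ)..t, (t - r) ^ (σ - 1) • u r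

/-- `w` is the left-sided Caputo derivative of order `γ ∈ (1,2)` of `u` on `(0,T)`, that is
`w = I^(2-γ)[∂ₜ² u]`. Since `∂ₜ² u` need not be a function, `I^(2-γ)[∂ₜ² u]` is understood as the weak
derivative of `I^(2-γ)[∂ₜ u - ∂ₜ u(0)]`, which is the same thing when `∂ₜ² u ∈ L¹(0,T;X)`. -/
def HasCaputoDeriv (γ T : ℝ) (u w : ℝ → X) : Prop :=
  ∃ (du : ℝ → X) (x : X), HasWeakTimeDeriv T u du ∧ HasInitialValue T du x ∧
    HasWeakTimeDeriv T (fracIntegral (2 - γ) fun t => du t - x) w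

end Time

/-- The two-parameter Mittag-Leffler function `E_{γ,μ}`, at real arguments. -/
def mittagLeffler (γ μ z : ℝ) : ℝ := ∑' k : ℕ, z ^ k / Real.Gamma (γ * k + μ)

/-! ## The space-time fractional wave equation -/

namespace EllipticOperator.EigenSystem

variable {n : ℕ} {L : EllipticOperator n} (S : L.EigenSystem)

/-- `G_γ(t) w = ∑_k E_{γ,1}(-lam_k^s t^γ) w_k φ_k`. -/
def opG (s : ℝ≥0) (γ t : ℝ) (w : L.L2) : L.L2 :=
  ∑' k, (mittagLeffler γ 1 (-(S.lam k ^ (s : ℝ) * t ^ γ)) * S.coeff w k) • S.φ k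

/-- `H_γ(t) w = ∑_k t E_{γ,2}(-lam_k^s t^γ) w_k φ_k`. -/
def opH (s : ℝ≥0) (γ t : ℝ) (w : L.L2) : L.L2 :=
  ∑' k, (t * mittagLeffler γ 2 (-(S.lam k ^ (s : ℝ) * t ^ γ)) * S.coeff w k) • S.φ k

/-- `F_γ(t) w = ∑_k t^(γ-1) E_{γ,γ}(-lam_k^s t^γ) w_k φ_k`. -/
def opF (s : ℝ≥0) (γ t : ℝ) (w : L.L2) : L.L2 :=
  ∑' k, (t ^ (γ - 1) * mittagLeffler γ γ (-(S.lam k ^ (s : ℝ) * t ^ γ)) * S.coeff w k) • S.φ k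

/-- `u` is a weak solution of `∂ₜ^γ u + 𝓛^s u = f` in `Ω × (0,T)`, `u(0) = g`, `∂ₜ u(0) = h`:
`u ∈ L^∞(0,T;ℍ^s(Ω))`, `∂ₜ u ∈ L^∞(0,T;L²(Ω))`, `∂ₜ^γ u ∈ L²(0,T;ℍ^{-s}(Ω))`, and the equation
holds in `ℍ^{-s}(Ω)` for almost every `t`. The initial conditions are understood through continuous
representatives, of `u` with values in `L²(Ω)` and of `∂ₜ u` with values in `ℍ^{-s}(Ω)`. -/
def IsWeakSolution (s : ℝ≥0) (γ T : ℝ) (f : ℝ → L.L2) (g h : L.L2) (u : ℝ → S.HSpace s) : Prop :=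
  MemLp u ∞ (timeMeasure T) ∧
  ∃ (du : ℝ → L.L2) (w : ℝ → S.HDual s),
    MemLp du ∞ (timeMeasure T) ∧ HasWeakTimeDeriv T (fun t => S.incl s (u t)) du ∧
    MemLp w 2 (timeMeasure T) ∧ HasCaputoDeriv γ T (fun t => S.toDual s (S.incl s (u t))) w ∧
    HasInitialValue T (fun t => S.incl s (u t)) g ∧
    HasInitialValue T (fun t => S.toDual s (du t)) (S.toDual s h) ∧
    ∀ᵐ t ∂timeMeasure T, ∀ v : S.HSpace s,
      w t v + S.fracPow s (u t) v = S.toDual s (f t) v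

end EllipticOperator.EigenSystem

end

/-! Expanding in eigenfunctions turns the problem into one scalar equation per mode, `∂ₜ^γ c + κ c =
F` with `κ = lam_k ^ s`. Its solution is `K_1 g + K_2 h + K_γ * F`, where `K_μ(t) = t^(μ-1)
E_{γ,μ}(-κ t^γ)` is `mlKernel`. The work lies in the algebra of these kernels and in bounds for them
that are uniform in `κ`.

The algebra has two rules. The fractional integral of order `σ` sends `K_μ` to `K_{μ+σ}`
(`integral_mlKernel_mul_mlKernel`), and `K_μ` equals `t^(μ-1)/Γ(μ) - κ K_{μ+γ}` (`mlKernel_eq_sub`).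
Together they give the derivative of the candidate solution (`solution_eq_integral`) and its Caputo
equation (`solution_caputo`).

The bounds rest on `|E_{γ,μ}(-x)| ≤ C / (1 + x)` for `0 < μ < γ + 1`
(`exists_abs_mittagLeffler_neg_le`). Hankel's contour integral for `1/Γ` turns the series into a
geometric one, which is summed under the integral far to the right, where it converges; the contour
is then pushed to the left. With `w = log ζ` the integrand has poles only at heights that are odd
multiples of `π/γ`, while its exponential decay needs a contour at a height above `π/2`. Such a
contour exists because `γ < 2`. The consequence is `κ^θ |K_μ(t)| ≤ C t^(μ-θγ-1)` for `0 ≤ θ ≤ 1`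
(`exists_rpow_mul_mlKernel_le`), with `C` independent of `κ` and hence of the eigensystem.

The diagonal operators with these kernels therefore have norm at most `M t^(β-1)`, and convolution
with them obeys Cauchy–Schwarz (`enorm_conv_le_two`), Young (`eLpNorm_conv_le_two`) and a continuity
statement (`continuousOn_conv`). For `θ = 1/2`, `μ = γ` the exponent is `β = γ/2 > 1/2`, so the
kernel is square integrable: this is why an `L²` norm of `f` controls the sup norm of `u` in `ℍ^s`,
and why only the `ℍ^s` norm of `g` enters the `L²` bound of `∂ₜ u`. The spaces `ℍ^s` and `ℍ^{-s}`
are reached from `L²(Ω)` through `lift` and `dualLift`, so the analysis takes place in `L²(Ω)`.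

For uniqueness, testing with `φ_k` and integrating in time gives a Volterra equation for each
coefficient (`IsWeakSolution.ae_coeff_eq`). The difference of two solutions solves the homogeneous
equation, and `K_γ` is its resolvent kernel, which forces it to vanish (`ae_eq_zero_of_volterra`).

The eigensystem comes from the spectral theorem for the inverse of `𝓛`, built by Lax–Milgram. It is
compact because the embedding of `H₀¹` in `L²` is a norm limit of averages over finitely many grid
cells (`norm_sub_cellAverage_le`). -/

/-! ## Hankel's integral for the reciprocal Gamma function -/

noncomputable section Hankel

open Complex (I)

/-- The integral of `h` over the contour that consists of the half-lines
`{w | u₀ < re w, im w = ± θ}` and of the segment joining their end points. The map `exp` takes it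
to a Hankel contour. -/
def hankelIntegral (h : ℂ → ℂ) (u₀ θ : ℝ) : ℂ :=
  (∫ u in Ioi u₀, h (u + θ * I)) - (∫ u in Ioi u₀, h (u + (-θ : ℝ) * I)) +
    I * ∫ y in (-θ)..θ, h (u₀ + y * I)

/-- Cauchy's theorem on the rectangle between the two vertical segments. Its horizontal sides are
the pieces by which the half-lines differ. -/
lemma hankelIntegral_eq_of_le {h : ℂ → ℂ} {θ u₀ u₁ : ℝ} (hθ : 0 ≤ θ)
    (hd : DifferentiableOn ℂ h {w | |w.im| ≤ θ}) (hu : u₀ ≤ u₁)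
    (h1 : IntegrableOn (fun u : ℝ => h (u + θ * I)) (Ioi u₀))
    (h2 : IntegrableOn (fun u : ℝ => h (u + (-θ : ℝ) * I)) (Ioi u₀)) :
    hankelIntegral h u₀ θ = hankelIntegral h u₁ θ := by
  have key := Complex.integral_boundary_rect_eq_zero_of_differentiableOn h
    (u₀ + (-θ : ℝ) * I) (u₁ + θ * I) (hd.mono ?_)
  · simp only [Complex.add_re, Complex.ofReal_re, Complex.mul_re, Complex.I_re, Complex.I_im,
      Complex.ofReal_im, Complex.add_im, Complex.mul_im, mul_zero, mul_one, sub_zero,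
      add_zero, zero_add, smul_eq_mul] at key
    have e1 := intervalIntegral.integral_interval_add_Ioi h1 (h1.mono_set (Ioi_subset_Ioi hu))
    have e2 := intervalIntegral.integral_interval_add_Ioi h2 (h2.mono_set (Ioi_subset_Ioi hu))
    rw [hankelIntegral, hankelIntegral, ← e1, ← e2]
    linear_combination -key
  · rintro w ⟨-, hw⟩
    simp only [Complex.add_im, Complex.ofReal_im, Complex.mul_im, Complex.ofReal_re, Complex.I_im,
      Complex.I_re, mem_preimage, mul_one, mul_zero, add_zero, zero_add] at hw
    rw [uIcc_of_le (by linarith)] at hw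
    exact abs_le.2 hw

/-- Cauchy's theorem on a rectangle whose right side moves to infinity, where `B` makes its
contribution vanish. This changes the opening of a Hankel contour. -/
lemma integral_Ioi_add_mul_I_sub {h : ℂ → ℂ} {a b u₀ : ℝ} (hd : Differentiable ℂ h)
    (h1 : IntegrableOn (fun u : ℝ => h (u + a * I)) (Ioi u₀))
    (h2 : IntegrableOn (fun u : ℝ => h (u + b * I)) (Ioi u₀)) {B : ℝ → ℝ}
    (hB : Tendsto B atTop (𝓝 0)) (hhB : ∀ u : ℝ, ∀ y ∈ uIcc a b, ‖h (u + y * I)‖ ≤ B u) :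
    (∫ u in Ioi u₀, h (u + a * I)) - (∫ u in Ioi u₀, h (u + b * I)) =
      I * ∫ y in a..b, h (u₀ + y * I) := by
  have key : ∀ N : ℝ, (∫ u in u₀..N, h (u + a * I)) - (∫ u in u₀..N, h (u + b * I)) +
      I * (∫ y in a..b, h (N + y * I)) = I * ∫ y in a..b, h (u₀ + y * I) := fun N => by
    have := Complex.integral_boundary_rect_eq_zero_of_differentiableOn h
      (u₀ + a * I) (N + b * I) hd.differentiableOn
    simp only [Complex.add_re, Complex.ofReal_re, Complex.mul_re, Complex.I_re, Complex.I_im,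
      Complex.ofReal_im, Complex.add_im, Complex.mul_im, mul_zero, mul_one, sub_zero,
      add_zero, zero_add, smul_eq_mul] at this
    linear_combination this
  have t1 := intervalIntegral_tendsto_integral_Ioi u₀ h1 tendsto_id
  have t2 := intervalIntegral_tendsto_integral_Ioi u₀ h2 tendsto_id
  have t3 : Tendsto (fun N : ℝ => ∫ y in a..b, h (N + y * I)) atTop (𝓝 0) := by
    refine squeeze_zero_norm (a := fun N => B N * |b - a|) (fun N => ?_)
      (by simpa using hB.mul_const |b - a|)
    exact intervalIntegral.norm_integral_le_of_norm_le_const fun y hy =>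
      hhB N y (uIoc_subset_uIcc hy)
  have t4 := (t1.sub t2).add (t3.const_mul I)
  simp only [id_eq, key, mul_zero, add_zero] at t4
  exact (tendsto_nhds_unique t4 tendsto_const_nhds)

lemma tendsto_hankelIntegral_atBot {h : ℂ → ℂ} {θ : ℝ} {V : ℂ}
    (h1 : Integrable (fun u : ℝ => h (u + θ * I)))
    (h2 : Integrable (fun u : ℝ => h (u + (-θ : ℝ) * I)))
    (hV : Tendsto (fun u₀ : ℝ => ∫ y in (-θ)..θ, h (u₀ + y * I)) atBot (𝓝 V)) :
    Tendsto (fun u₀ => hankelIntegral h u₀ θ) atBot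
      (𝓝 ((∫ u : ℝ, h (u + θ * I)) - (∫ u : ℝ, h (u + (-θ : ℝ) * I)) + I * V)) := by
  refine Tendsto.add (Tendsto.sub ?_ ?_) (hV.const_mul I)
  · exact (aecover_Ioi tendsto_id).integral_tendsto_of_countably_generated h1
  · exact (aecover_Ioi tendsto_id).integral_tendsto_of_countably_generated h2

/-! ### Gamma integrals in the exponential variable. -/

/-- The substitution `r = exp u` produces the Gamma-type integrand `exp (c r) * r ^ (a - 1)` on the
positive half-line. -/
lemma integrable_exp_mul_exp_mul {c a : ℝ} (hc : c < 0) (ha : 0 < a) :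
    Integrable fun u : ℝ => Real.exp (Real.exp u * c) * Real.exp (a * u) := by
  have h' : IntegrableOn (fun r : ℝ => Real.exp (r * c) * r ^ (a - 1)) (Ioi 0) := by
    have := integrableOn_rpow_mul_exp_neg_mul_rpow (s := a - 1) (p := 1) (b := -c) (by linarith)
      one_pos (by linarith)
    refine this.congr_fun (fun r _ => ?_) measurableSet_Ioi
    simp only [Real.rpow_one, neg_neg]
    rw [mul_comm, mul_comm c]
  rw [← Real.range_exp, ← image_univ, integrableOn_image_iff_integrableOn_abs_deriv_smul
    MeasurableSet.univ (fun x _ => (Real.hasDerivAt_exp x).hasDerivWithinAt)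
    Real.exp_injective.injOn, integrableOn_univ] at h'
  refine h'.congr (.of_forall fun u => ?_)
  simp only [abs_of_pos (Real.exp_pos u), smul_eq_mul, ← Real.exp_mul, mul_comm a u]
  rw [mul_left_comm, ← Real.exp_add]
  ring_nf

lemma integral_exp_neg_exp_mul_exp_mul {a : ℝ} (ha : 0 < a) :
    ∫ u : ℝ, Real.exp (-Real.exp u) * Real.exp (a * u) = Real.Gamma a := by
  rw [Real.Gamma_eq_integral ha, ← Real.range_exp, ← image_univ,
    integral_image_eq_integral_abs_deriv_smul
    MeasurableSet.univ (fun x _ => (Real.hasDerivAt_exp x).hasDerivWithinAt)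
    Real.exp_injective.injOn, Measure.restrict_univ]
  refine integral_congr_ae (.of_forall fun u => ?_)
  simp only [abs_of_pos (Real.exp_pos u), smul_eq_mul, ← Real.exp_mul, mul_comm a u]
  rw [mul_left_comm, ← Real.exp_add, ← Real.exp_add, ← Real.exp_add]
  ring_nf

lemma integrableOn_exp_mul_exp_mul {c : ℝ} (hc : c < 0) (a u₀ : ℝ) :
    IntegrableOn (fun u : ℝ => Real.exp (Real.exp u * c) * Real.exp (a * u)) (Ioi u₀) := by
  rcases lt_or_ge 0 a with ha | ha
  · exact (integrable_exp_mul_exp_mul hc ha).integrableOn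
  -- For `a ≤ 0` and `u > u₀` one has `a u ≤ (a - 1) u₀ + u`, which reduces to the exponent `1`.
  refine ((integrable_exp_mul_exp_mul hc one_pos).integrableOn.const_mul
    (Real.exp ((a - 1) * u₀))).mono' (by fun_prop) ?_
  refine (ae_restrict_mem measurableSet_Ioi).mono fun u hu => ?_
  rw [Real.norm_of_nonneg (by positivity), mul_left_comm]
  gcongr
  rw [← Real.exp_add]
  gcongr
  nlinarith [mem_Ioi.1 hu]

/-! ### The Hankel kernel and Hankel's formula. -/

/-- The integrand of Hankel's integral for `2πi / Γ(z)`, in the variable `w = log ζ`. -/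
def hankelKernel (z : ℝ) (w : ℂ) : ℂ := Complex.exp (Complex.exp w) * Complex.exp ((1 - z) * w)

lemma differentiable_hankelKernel (z : ℝ) : Differentiable ℂ (hankelKernel z) := by
  unfold hankelKernel
  fun_prop

lemma continuous_hankelKernel_line (z y : ℝ) :
    Continuous fun u : ℝ => hankelKernel z (u + y * I) := by
  unfold hankelKernel
  fun_prop

lemma norm_hankelKernel (z u y : ℝ) : ‖hankelKernel z (u + y * I)‖ =
    Real.exp (Real.exp u * Real.cos y) * Real.exp ((1 - z) * u) := by
  rw [hankelKernel, norm_mul, Complex.norm_exp, Complex.norm_exp, Complex.exp_re]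
  simp

lemma integrableOn_hankelKernel (z u₀ : ℝ) {y : ℝ} (hy : Real.cos y < 0) :
    IntegrableOn (fun u : ℝ => hankelKernel z (u + y * I)) (Ioi u₀) := by
  refine (integrableOn_exp_mul_exp_mul hy (1 - z) u₀).mono'
    (continuous_hankelKernel_line z y).aestronglyMeasurable (.of_forall fun u => ?_)
  rw [norm_hankelKernel]

lemma integrable_hankelKernel {z : ℝ} (hz : z < 1) {y : ℝ} (hy : Real.cos y < 0) :
    Integrable (fun u : ℝ => hankelKernel z (u + y * I)) := by
  refine (integrable_exp_mul_exp_mul hy (a := 1 - z) (by linarith)).mono'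
    (continuous_hankelKernel_line z y).aestronglyMeasurable (.of_forall fun u => ?_)
  rw [norm_hankelKernel]

lemma tendsto_exp_mul_exp_mul {c : ℝ} (hc : c < 0) (a : ℝ) :
    Tendsto (fun u : ℝ => Real.exp (Real.exp u * c) * Real.exp (a * u)) atTop (𝓝 0) := by
  have := (tendsto_rpow_mul_exp_neg_mul_atTop_nhds_zero a (-c) (by linarith)).comp
    Real.tendsto_exp_atTop
  refine this.congr fun u => ?_
  simp only [Function.comp_apply, neg_neg, ← Real.exp_mul]
  rw [mul_comm, mul_comm c, mul_comm a]

/-- The combination on the right is an exact derivative. Integrated over the contour it becomes the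
counterpart of `Γ(z + 1) = z Γ(z)`. -/
lemma hankelKernel_recurrence (z : ℝ) (w : ℂ) :
    HasDerivAt (fun w : ℂ => hankelKernel (z + 1) w) (hankelKernel z w - z * hankelKernel (z + 1) w)
      w := by
  have h1 : HasDerivAt (fun w : ℂ => Complex.exp ((1 - ((z + 1 : ℝ) : ℂ)) * w))
      (Complex.exp ((1 - ((z + 1 : ℝ) : ℂ)) * w) * (1 - ((z + 1 : ℝ) : ℂ))) w := by
    simpa using ((hasDerivAt_id w).const_mul (1 - ((z + 1 : ℝ) : ℂ))).cexp
  have h2 := (Complex.hasDerivAt_exp w).cexp.mul h1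
  refine h2.congr_deriv ?_
  unfold hankelKernel
  have : Complex.exp ((1 - (z : ℂ)) * w) =
      Complex.exp w * Complex.exp ((1 - ((z + 1 : ℝ) : ℂ)) * w) := by
    rw [← Complex.exp_add]
    push_cast
    ring_nf
  rw [this]
  push_cast
  ring

lemma integral_Ioi_hankelKernel_recurrence (z u₀ : ℝ) {y : ℝ} (hy : Real.cos y < 0) :
    (∫ u in Ioi u₀, hankelKernel z (u + y * I)) =
      z * (∫ u in Ioi u₀, hankelKernel (z + 1) (u + y * I)) - hankelKernel (z + 1) (u₀ + y * I) := by
  have i1 := integrableOn_hankelKernel z u₀ hy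
  have i2 := (integrableOn_hankelKernel (z + 1) u₀ hy).const_mul (z : ℂ)
  have hder : ∀ u ∈ Ici u₀, HasDerivAt (fun u : ℝ => hankelKernel (z + 1) (u + y * I))
      (hankelKernel z (u + y * I) - z * hankelKernel (z + 1) (u + y * I)) u := fun u _ => by
    have h1 : HasDerivAt (fun u : ℝ => (u + y * I : ℂ)) 1 u :=
      (Complex.ofRealCLM.hasDerivAt).add_const _
    have h2 := (hankelKernel_recurrence z (u + y * I)).comp u h1
    rw [mul_one] at h2
    exact h2
  have ht : Tendsto (fun u : ℝ => hankelKernel (z + 1) (u + y * I)) atTop (𝓝 0) := by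
    rw [tendsto_zero_iff_norm_tendsto_zero]
    simp only [norm_hankelKernel]
    exact tendsto_exp_mul_exp_mul hy _
  have := integral_Ioi_of_hasDerivAt_of_tendsto' hder (i1.sub i2) ht
  rw [integral_sub i1 i2, integral_const_mul] at this
  linear_combination this

/-- The integral of the exact derivative over the whole contour is zero: the end-point terms of the
half-lines cancel those of the segment, and the kernel decays at infinity since `cos θ < 0`. -/
lemma hankelIntegral_recurrence (z u₀ : ℝ) {θ : ℝ} (hθ : Real.cos θ < 0) :
    hankelIntegral (hankelKernel z) u₀ θ = z * hankelIntegral (hankelKernel (z + 1)) u₀ θ := by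
  have hv : I * (∫ y in (-θ)..θ, hankelKernel z (u₀ + y * I)) =
      z * (I * ∫ y in (-θ)..θ, hankelKernel (z + 1) (u₀ + y * I)) +
        (hankelKernel (z + 1) (u₀ + θ * I) - hankelKernel (z + 1) (u₀ + (-θ : ℝ) * I)) := by
    have hder : ∀ y ∈ uIcc (-θ) θ, HasDerivAt (fun y : ℝ => hankelKernel (z + 1) (u₀ + y * I))
        ((hankelKernel z (u₀ + y * I) - z * hankelKernel (z + 1) (u₀ + y * I)) * I) y :=
        fun y _ => by
      have h1 : HasDerivAt (fun y : ℝ => (u₀ + y * I : ℂ)) I y := by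
        simpa using ((Complex.ofRealCLM.hasDerivAt (x := y)).mul_const I).const_add (u₀ : ℂ)
      exact (hankelKernel_recurrence z (u₀ + y * I)).comp y h1
    have c : ∀ z : ℝ, Continuous fun y : ℝ => hankelKernel z (u₀ + y * I) := fun z => by
      unfold hankelKernel; fun_prop
    have := intervalIntegral.integral_eq_sub_of_hasDerivAt hder
      ((((c z).sub ((c (z + 1)).const_mul _)).mul continuous_const).intervalIntegrable _ _)
    rw [intervalIntegral.integral_mul_const, intervalIntegral.integral_sub
      ((c z).intervalIntegrable _ _) (((c (z + 1)).const_mul _).intervalIntegrable _ _),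
      intervalIntegral.integral_const_mul] at this
    rw [← this]
    ring
  rw [hankelIntegral, hankelIntegral, hv, integral_Ioi_hankelKernel_recurrence z u₀ hθ,
    integral_Ioi_hankelKernel_recurrence z u₀ (y := -θ) (by simpa using hθ)]
  ring

lemma hankelIntegral_hankelKernel_const (z u₀ u₁ : ℝ) {θ : ℝ} (h0 : 0 ≤ θ)
    (hθ : Real.cos θ < 0) :
    hankelIntegral (hankelKernel z) u₀ θ = hankelIntegral (hankelKernel z) u₁ θ := by
  have : ∀ a b : ℝ, a ≤ b →
      hankelIntegral (hankelKernel z) a θ = hankelIntegral (hankelKernel z) b θ := fun a b hab =>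
    hankelIntegral_eq_of_le h0 (differentiable_hankelKernel z).differentiableOn hab
      (integrableOn_hankelKernel z a hθ) (integrableOn_hankelKernel z a (by simpa using hθ))
  rcases le_total u₀ u₁ with h | h
  · exact this _ _ h
  · exact (this _ _ h).symm

lemma hankelKernel_pi (z u : ℝ) (ε : ℝ) (hε : ε = Real.pi ∨ ε = -Real.pi) :
    hankelKernel z (u + ε * I) =
      ((Real.exp (-Real.exp u) * Real.exp ((1 - z) * u) : ℝ) : ℂ) *
        Complex.exp ((1 - z) * ε * I) := by
  have h1 : Complex.exp (u + ε * I) = -Complex.exp u := by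
    rcases hε with rfl | rfl
    · rw [Complex.exp_add_pi_mul_I]
    · rw [Complex.ofReal_neg, neg_mul, ← sub_eq_add_neg, Complex.exp_sub_pi_mul_I]
  rw [hankelKernel, h1]
  push_cast
  simp only [← Complex.exp_add]
  ring_nf

/-- As the segment moves to `-∞`, only the two full lines at heights `±π` remain. They carry the
same real integral `Γ(1 - z)` with conjugate phases, so their difference is `2i sin(πz) Γ(1 - z)`,
and the reflection formula applies. -/
lemma hankelIntegral_pi_of_lt_one {z : ℝ} (hz0 : 0 < z) (hz1 : z < 1) (u₀ : ℝ) :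
    hankelIntegral (hankelKernel z) u₀ Real.pi = 2 * Real.pi * I / Real.Gamma z := by
  have hc : Real.cos Real.pi < 0 := by simp
  have hc' : Real.cos (-Real.pi) < 0 := by simp
  -- Here `z < 1` is essential: the factor `exp ((1 - z) u)` tends to zero at `-∞`.
  have hV : Tendsto (fun u₀ : ℝ => ∫ y in (-Real.pi)..Real.pi, hankelKernel z (u₀ + y * I)) atBot
      (𝓝 0) := by
    have hb : Tendsto (fun u : ℝ => Real.exp (Real.exp u) * Real.exp ((1 - z) * u) *
        |Real.pi - -Real.pi|) atBot (𝓝 (Real.exp 0 * 0 * |Real.pi - -Real.pi|)) := by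
      refine Tendsto.mul_const _ (Tendsto.mul ?_ ?_)
      · exact (Real.continuous_exp.tendsto _).comp Real.tendsto_exp_atBot
      · exact Real.tendsto_exp_atBot.comp (tendsto_id.const_mul_atBot (by linarith))
    rw [mul_zero, zero_mul] at hb
    refine squeeze_zero_norm (fun u => ?_) hb
    refine intervalIntegral.norm_integral_le_of_norm_le_const fun y _ => ?_
    rw [norm_hankelKernel]
    gcongr
    exact mul_le_of_le_one_right (Real.exp_pos u).le (Real.cos_le_one y)
  have h := tendsto_hankelIntegral_atBot (integrable_hankelKernel hz1 hc)
    (integrable_hankelKernel hz1 hc') hV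
  have h' : Tendsto (fun u => hankelIntegral (hankelKernel z) u Real.pi) atBot
      (𝓝 (hankelIntegral (hankelKernel z) u₀ Real.pi)) :=
    tendsto_const_nhds.congr fun u =>
      hankelIntegral_hankelKernel_const z u₀ u Real.pi_pos.le hc
  rw [tendsto_nhds_unique h' h]
  simp only [hankelKernel_pi z _ _ (Or.inl rfl), hankelKernel_pi z _ _ (Or.inr rfl)]
  rw [integral_mul_const, integral_mul_const, integral_complex_ofReal,
    integral_exp_neg_exp_mul_exp_mul (a := 1 - z) (by linarith), ← mul_sub]
  have hs : Complex.exp ((1 - z) * Real.pi * I) - Complex.exp ((1 - z) * (-Real.pi : ℝ) * I) =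
      2 * I * (Real.sin (Real.pi * z) : ℝ) := by
    have : Real.sin (Real.pi * z) = Real.sin ((1 - z) * Real.pi) := by
      rw [← Real.sin_pi_sub]
      ring_nf
    rw [this]
    push_cast
    rw [Complex.sin]
    ring_nf
    rw [Complex.I_sq]
    ring_nf
  rw [hs, mul_zero, add_zero]
  have hG := Real.Gamma_mul_Gamma_one_sub z
  have hG0 := (Real.Gamma_pos_of_pos hz0).ne'
  have hs0 : Real.sin (Real.pi * z) ≠ 0 := (Real.sin_pos_of_pos_of_lt_pi
    (by positivity) (by nlinarith [Real.pi_pos])).ne'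
  have hR : Real.Gamma (1 - z) * Real.sin (Real.pi * z) = Real.pi / Real.Gamma z := by
    rw [eq_div_iff hs0] at hG
    rw [eq_div_iff hG0]
    linarith
  have hC : (Real.Gamma (1 - z) : ℂ) * (Real.sin (Real.pi * z) : ℝ) = Real.pi / Real.Gamma z := by
    exact_mod_cast congrArg (Complex.ofReal) hR
  linear_combination (2 * I) * hC

/-- At `z = 1` the phases on the two half-lines coincide, so these cancel and only the segment
counts. Its integrand tends to `1` as the segment moves to `-∞`. -/
lemma hankelIntegral_pi_one (u₀ : ℝ) :
    hankelIntegral (hankelKernel 1) u₀ Real.pi = 2 * Real.pi * I := by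
  have he : ∀ u : ℝ, hankelIntegral (hankelKernel 1) u Real.pi =
      I * ∫ y in (-Real.pi)..Real.pi, hankelKernel 1 (u + y * I) := fun u => by
    rw [hankelIntegral]
    simp only [hankelKernel_pi 1 _ _ (Or.inl rfl), hankelKernel_pi 1 _ _ (Or.inr rfl)]
    simp
  have hlim : Tendsto (fun u : ℝ => ∫ y in (-Real.pi)..Real.pi, hankelKernel 1 (u + y * I)) atBot
      (𝓝 (∫ y in (-Real.pi)..Real.pi, (1 : ℂ))) := by
    refine intervalIntegral.tendsto_integral_filter_of_dominated_convergence
      (fun _ => Real.exp 1) ?_ ?_ ?_ ?_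
    · refine .of_forall fun u => Continuous.aestronglyMeasurable ?_
      unfold hankelKernel
      fun_prop
    · filter_upwards [eventually_le_atBot 0] with u hu
      refine .of_forall fun y _ => ?_
      rw [norm_hankelKernel]
      simp only [sub_self, zero_mul, Real.exp_zero, mul_one]
      gcongr
      nlinarith [Real.exp_le_one_iff.2 hu, Real.exp_pos u, Real.cos_le_one y]
    · simp
    · refine .of_forall fun y _ => ?_
      have h1 : Tendsto (fun u : ℝ => Complex.exp (u + y * I)) atBot (𝓝 0) := by
        rw [tendsto_zero_iff_norm_tendsto_zero]
        simpa [Complex.norm_exp] using Real.tendsto_exp_atBot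
      have h2 := (Complex.continuous_exp.tendsto 0).comp h1
      simpa [hankelKernel, Function.comp_def] using h2
  have h' : Tendsto (fun u => hankelIntegral (hankelKernel 1) u Real.pi) atBot
      (𝓝 (hankelIntegral (hankelKernel 1) u₀ Real.pi)) :=
    tendsto_const_nhds.congr fun u =>
      hankelIntegral_hankelKernel_const 1 u₀ u Real.pi_pos.le (by simp)
  have := tendsto_nhds_unique h' ((hlim.const_mul I).congr fun u => (he u).symm)
  rw [this]
  simp
  ring

/-- The two base cases cover `(0, 1]`; the recurrence extends the formula by one unit at a time. -/
lemma hankelIntegral_pi {z : ℝ} (hz : 0 < z) (u₀ : ℝ) :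
    hankelIntegral (hankelKernel z) u₀ Real.pi = 2 * Real.pi * I / Real.Gamma z := by
  have key : ∀ m : ℕ, ∀ z : ℝ, 0 < z → z ≤ m + 1 →
      hankelIntegral (hankelKernel z) u₀ Real.pi = 2 * Real.pi * I / Real.Gamma z := by
    intro m
    induction m with
    | zero =>
      intro z h0 h1
      rcases (by simpa using h1 : z ≤ 1).lt_or_eq with h | rfl
      · exact hankelIntegral_pi_of_lt_one h0 h u₀
      · simp [hankelIntegral_pi_one]
    | succ m ih =>
      intro z h0 h1
      rcases le_or_gt z (m + 1) with h | h
      · exact ih z h0 h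
      have hz1 : 0 < z - 1 := by
        have : (0 : ℝ) ≤ m := m.cast_nonneg
        linarith
      have e := ih (z - 1) hz1 (by push_cast at h1; linarith)
      rw [hankelIntegral_recurrence _ _ (by simp), sub_add_cancel] at e
      have hG := Real.Gamma_add_one hz1.ne'
      rw [sub_add_cancel] at hG
      rw [hG]
      have h2 : ((z - 1 : ℝ) : ℂ) ≠ 0 := by exact_mod_cast hz1.ne'
      have h3 : (Real.Gamma (z - 1) : ℂ) ≠ 0 := by exact_mod_cast (Real.Gamma_pos_of_pos hz1).ne'
      rw [Complex.ofReal_mul]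
      field_simp at e ⊢
      linear_combination e
  obtain ⟨m, hm⟩ := exists_nat_ge z
  exact key m z hz (by linarith)

/-- Hankel's formula. -/
lemma hankelIntegral_hankelKernel {z : ℝ} (hz : 0 < z) (u₀ : ℝ) {θ : ℝ} (h1 : Real.pi / 2 < θ)
    (h2 : θ ≤ Real.pi) :
    hankelIntegral (hankelKernel z) u₀ θ = 2 * Real.pi * I / Real.Gamma z := by
  have hπ := Real.pi_pos
  have hθ : Real.cos θ < 0 := Real.cos_neg_of_pi_div_two_lt_of_lt h1 (by linarith)
  have hB := tendsto_exp_mul_exp_mul hθ (1 - z)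
  have c : Continuous fun y : ℝ => hankelKernel z (u₀ + y * I) := by
    unfold hankelKernel; fun_prop
  -- The half-lines are moved from heights `±π` to `±θ`. Between these heights the cosine is largest
  -- at `±θ`, where it is still negative, so the bound there serves throughout.
  have r1 := integral_Ioi_add_mul_I_sub (a := θ) (b := Real.pi) (u₀ := u₀)
    (differentiable_hankelKernel z)
    (integrableOn_hankelKernel z u₀ hθ) (integrableOn_hankelKernel z u₀ (by simp)) hB
    fun u y hy => by
      rw [uIcc_of_le h2] at hy
      rw [norm_hankelKernel]
      gcongr
      exact Real.cos_le_cos_of_nonneg_of_le_pi (by linarith) hy.2 hy.1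
  have r2 := integral_Ioi_add_mul_I_sub (a := -Real.pi) (b := -θ) (u₀ := u₀)
    (differentiable_hankelKernel z)
    (integrableOn_hankelKernel z u₀ (by simp)) (integrableOn_hankelKernel z u₀ (by simpa)) hB
    fun u y hy => by
      rw [uIcc_of_le (by linarith)] at hy
      rw [norm_hankelKernel, ← Real.cos_neg y]
      gcongr
      exact Real.cos_le_cos_of_nonneg_of_le_pi (by linarith) (by linarith [hy.1])
        (by linarith [hy.2])
  have e1 := intervalIntegral.integral_add_adjacent_intervals
    (c.intervalIntegrable (μ := volume) (-Real.pi) (-θ)) (c.intervalIntegrable (-θ) θ)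
  have e2 := intervalIntegral.integral_add_adjacent_intervals
    (c.intervalIntegrable (μ := volume) (-Real.pi) θ) (c.intervalIntegrable θ Real.pi)
  rw [← hankelIntegral_pi hz u₀, hankelIntegral, hankelIntegral, ← e2, ← e1]
  linear_combination r1 + r2

end Hankel

/-! ## Bounds for the Mittag-Leffler function on the negative half-line -/

noncomputable section MittagLeffler

open Complex (I)

lemma Gamma_mul_add_pos {γ μ : ℝ} (hγ : 0 ≤ γ) (hμ : 0 < μ) (k : ℕ) :
    0 < Real.Gamma (γ * k + μ) :=
  Real.Gamma_pos_of_pos (by positivity)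

lemma summable_mittagLeffler {γ μ : ℝ} (hγ : 1 ≤ γ) (hμ : 0 < μ) (x : ℝ) :
    Summable fun k : ℕ => x ^ k / Real.Gamma (γ * k + μ) := by
  -- Dropping two terms puts the arguments in `[2, ∞)`, where `Γ` is increasing. Then `γ ≥ 1` gives
  -- `Γ(γ (k + 2) + μ) ≥ Γ(k + 2) = (k + 1)!`.
  rw [← summable_nat_add_iff 2]
  have h := ((Real.summable_pow_div_factorial |x|).comp_injective
    (add_left_injective 1)).mul_left |x|
  refine h.of_norm_bounded fun k => ?_
  have hk : ((k + 1).factorial : ℝ) ≤ Real.Gamma (γ * ((k + 2 : ℕ) : ℝ) + μ) := by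
    have h1 := Real.Gamma_nat_eq_factorial (k + 1)
    rw [← h1]
    have h2 : ((k + 1 : ℕ) : ℝ) + 1 ≤ γ * ((k + 2 : ℕ) : ℝ) + μ := by
      push_cast
      nlinarith [(k.cast_nonneg : (0 : ℝ) ≤ k)]
    have h3 : (2 : ℝ) ≤ ((k + 1 : ℕ) : ℝ) + 1 := by
      push_cast
      linarith [(k.cast_nonneg : (0 : ℝ) ≤ k)]
    exact Real.Gamma_strictMonoOn_Ici.monotoneOn h3 (h3.trans h2) h2
  have hpos : (0 : ℝ) < (k + 1).factorial := by positivity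
  rw [norm_div, norm_pow, Real.norm_eq_abs, Real.norm_of_nonneg (hpos.le.trans hk)]
  simp only [Function.comp_apply]
  rw [← mul_div_assoc, ← pow_succ']
  gcongr

/-- The integrand of the representation of `2πi E_{γ,μ}(-x)` as an integral over a Hankel contour,
in the variable `w = log ζ`. -/
def mittagLefflerKernel (γ μ x : ℝ) (w : ℂ) : ℂ :=
  hankelKernel (μ - γ) w / (Complex.exp (γ * w) + x)

lemma hankelKernel_add_mul (γ μ : ℝ) (j : ℕ) (w : ℂ) :
    hankelKernel (γ * j + μ) w = hankelKernel μ w * Complex.exp (-(γ * w)) ^ j := by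
  simp only [hankelKernel, ← Complex.exp_nat_mul, ← Complex.exp_add]
  push_cast
  ring_nf

/-- A geometric series of ratio `-x exp (-γ w)`; multiplying numerator and denominator by `exp (γ
w)` yields the kernel. -/
lemma hasSum_mittagLefflerKernel {γ μ x : ℝ} {w : ℂ}
    (h : ‖(x : ℂ) * Complex.exp (-(γ * w))‖ < 1) :
    HasSum (fun j : ℕ => (-x : ℂ) ^ j * hankelKernel (γ * j + μ) w)
      (mittagLefflerKernel γ μ x w) := by
  have h1 := (hasSum_geometric_of_norm_lt_one
    (ξ := -((x : ℂ) * Complex.exp (-(γ * w)))) (by rwa [norm_neg])).mul_left (hankelKernel μ w)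
  have e0 : mittagLefflerKernel γ μ x w =
      hankelKernel μ w * (1 - -((x : ℂ) * Complex.exp (-(γ * w))))⁻¹ := by
    have e1 : hankelKernel (μ - γ) w = hankelKernel μ w * Complex.exp (γ * w) := by
      simp only [hankelKernel, ← Complex.exp_add]
      push_cast
      ring_nf
    have e2 : Complex.exp (γ * w) + x =
        Complex.exp (γ * w) * (1 - -((x : ℂ) * Complex.exp (-(γ * w)))) := by
      rw [Complex.exp_neg]
      field_simp
      ring
    rw [mittagLefflerKernel, e1, e2, mul_comm (hankelKernel μ w),
      mul_div_mul_left _ _ (Complex.exp_ne_zero _), div_eq_mul_inv]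
  rw [e0]
  refine h1.congr_fun fun j => ?_
  rw [hankelKernel_add_mul, ← neg_mul (x : ℂ), mul_pow]
  ring

lemma norm_mul_exp_neg_le {γ x u₀ : ℝ} (hγ : 0 ≤ γ) (hx : 0 ≤ x) {w : ℂ} (hw : u₀ ≤ w.re) :
    ‖(x : ℂ) * Complex.exp (-(γ * w))‖ ≤ x * Real.exp (-(γ * u₀)) := by
  rw [norm_mul, Complex.norm_exp, Complex.norm_of_nonneg hx]
  simp only [Complex.neg_re, Complex.mul_re, Complex.ofReal_re, Complex.ofReal_im, zero_mul,
    sub_zero]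
  gcongr

/-- To the right of `u₀` the geometric ratio is at most `q < 1`, so sum and integral commute. The
path and the measure are left general to serve the half-lines and the segment alike. -/
lemma hasSum_integral_mittagLefflerKernel {γ μ x u₀ : ℝ} (hγ : 0 ≤ γ) (hx : 0 ≤ x)
    (hq : x * Real.exp (-(γ * u₀)) < 1) {ν : Measure ℝ} {p : ℝ → ℂ} (hp : Continuous p)
    (hpu : ∀ᵐ t ∂ν, u₀ ≤ (p t).re) (hi : Integrable (fun t => hankelKernel μ (p t)) ν) :
    HasSum (fun j : ℕ => (-x : ℂ) ^ j * ∫ t, hankelKernel (γ * j + μ) (p t) ∂ν)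
      (∫ t, mittagLefflerKernel γ μ x (p t) ∂ν) := by
  set q := x * Real.exp (-(γ * u₀)) with hqdef
  have hq0 : 0 ≤ q := by positivity
  have hb : ∀ j : ℕ, ∀ᵐ t ∂ν, ‖(-x : ℂ) ^ j * hankelKernel (γ * j + μ) (p t)‖ ≤
      q ^ j * ‖hankelKernel μ (p t)‖ := fun j => by
    filter_upwards [hpu] with t ht
    rw [hankelKernel_add_mul, norm_mul, norm_mul, mul_left_comm, ← norm_mul, ← mul_pow, norm_pow,
      mul_comm, neg_mul, norm_neg]
    gcongr
    exact norm_mul_exp_neg_le hγ hx ht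
  have hmeas : ∀ j : ℕ, AEStronglyMeasurable
      (fun t => (-x : ℂ) ^ j * hankelKernel (γ * j + μ) (p t)) ν := fun j =>
    (((differentiable_hankelKernel _).continuous.comp hp).const_mul _).aestronglyMeasurable
  have hint : ∀ j : ℕ, Integrable
      (fun t => (-x : ℂ) ^ j * hankelKernel (γ * j + μ) (p t)) ν := fun j =>
    (hi.norm.const_mul (q ^ j)).mono' (hmeas j) (hb j)
  have hsum : Summable fun j : ℕ =>
      ∫ t, ‖(-x : ℂ) ^ j * hankelKernel (γ * j + μ) (p t)‖ ∂ν := by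
    refine Summable.of_nonneg_of_le (fun j => integral_nonneg fun t => norm_nonneg _) (fun j => ?_)
      ((summable_geometric_of_lt_one hq0 hq).mul_right (∫ t, ‖hankelKernel μ (p t)‖ ∂ν))
    rw [← integral_const_mul]
    exact integral_mono_ae (hint j).norm (hi.norm.const_mul _) (hb j)
  have hs := hasSum_integral_of_summable_integral_norm hint hsum
  have he : ∫ t, mittagLefflerKernel γ μ x (p t) ∂ν =
      ∫ t, ∑' j : ℕ, (-x : ℂ) ^ j * hankelKernel (γ * j + μ) (p t) ∂ν := by
    refine integral_congr_ae ?_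
    filter_upwards [hpu] with t ht
    exact (hasSum_mittagLefflerKernel ((norm_mul_exp_neg_le hγ hx ht).trans_lt hq)).tsum_eq.symm
  simp only [integral_const_mul] at hs
  rwa [he]

/-- Term by term this is Hankel's formula. It needs a contour far enough to the right for the
geometric series to converge on all of it. -/
lemma hankelIntegral_mittagLefflerKernel {γ μ x u₀ θ : ℝ} (hγ : 1 ≤ γ) (hμ : 0 < μ) (hx : 0 ≤ x)
    (hq : x * Real.exp (-(γ * u₀)) < 1) (h1 : Real.pi / 2 < θ) (h2 : θ ≤ Real.pi) :
    hankelIntegral (mittagLefflerKernel γ μ x) u₀ θ =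
      2 * Real.pi * I * mittagLeffler γ μ (-x) := by
  have hπ := Real.pi_pos
  have hθ : Real.cos θ < 0 := Real.cos_neg_of_pi_div_two_lt_of_lt h1 (by linarith)
  have hγ0 : 0 ≤ γ := by linarith
  have hray : ∀ᵐ u : ℝ ∂volume.restrict (Ioi u₀), ∀ y : ℝ, u₀ ≤ ((u : ℂ) + y * I).re := by
    filter_upwards [ae_restrict_mem measurableSet_Ioi] with u hu y
    simpa using (mem_Ioi.1 hu).le
  have s1 := hasSum_integral_mittagLefflerKernel (μ := μ) hγ0 hx hq
    (p := fun u : ℝ => (u : ℂ) + θ * I) (by fun_prop) (hray.mono fun u hu => hu θ)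
    (integrableOn_hankelKernel μ u₀ hθ)
  have s2 := hasSum_integral_mittagLefflerKernel (μ := μ) hγ0 hx hq
    (p := fun u : ℝ => (u : ℂ) + (-θ : ℝ) * I) (by fun_prop) (hray.mono fun u hu => hu (-θ))
    (integrableOn_hankelKernel μ u₀ (by simpa using hθ))
  have s3 := hasSum_integral_mittagLefflerKernel (μ := μ) hγ0 hx hq
    (ν := volume.restrict (Ioc (-θ) θ)) (p := fun y : ℝ => (u₀ : ℂ) + y * I) (by fun_prop)
    (.of_forall fun y => by simp) (Continuous.integrableOn_Ioc (by unfold hankelKernel; fun_prop))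
  simp only [← intervalIntegral.integral_of_le (by linarith : -θ ≤ θ)] at s3
  have s := (s1.sub s2).add (s3.mul_left I)
  have e : ∀ j : ℕ, (-x : ℂ) ^ j * hankelIntegral (hankelKernel (γ * j + μ)) u₀ θ =
      2 * Real.pi * I * (((-x) ^ j / Real.Gamma (γ * j + μ) : ℝ) : ℂ) := fun j => by
    rw [hankelIntegral_hankelKernel (by positivity) u₀ h1 h2]
    push_cast
    ring
  have s' := (Complex.hasSum_ofReal.2 (summable_mittagLeffler hγ hμ (-x)).hasSum).mul_left
    (2 * Real.pi * I)
  refine HasSum.unique (s.congr_fun ?_) s'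
  intro j
  rw [← e j, hankelIntegral]
  ring

/-- After a rotation by `exp (-iγy)` the first summand is real, and the imaginary part of the second
bounds the norm from below. This bound supplies the factor `1 / x` in the decay estimate. -/
lemma mul_abs_sin_le_norm_exp_add {γ x : ℝ} (hx : 0 ≤ x) (u y : ℝ) :
    x * |Real.sin (γ * y)| ≤ ‖Complex.exp (γ * (u + y * I)) + x‖ := by
  have h1 : ‖Complex.exp (γ * (u + y * I)) + x‖ =
      ‖(Real.exp (γ * u) : ℂ) + x * Complex.exp (((-(γ * y) : ℝ) : ℂ) * I)‖ := by
    have : Complex.exp (γ * (u + y * I)) + x = Complex.exp (((γ * y : ℝ) : ℂ) * I) *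
        ((Real.exp (γ * u) : ℂ) + x * Complex.exp (((-(γ * y) : ℝ) : ℂ) * I)) := by
      have e1 : Complex.exp (((γ * y : ℝ) : ℂ) * I) * Complex.exp (((-(γ * y) : ℝ) : ℂ) * I) = 1 := by
        rw [← Complex.exp_add]
        simp
      have e2 : Complex.exp (γ * (u + y * I)) =
          Complex.exp (((γ * y : ℝ) : ℂ) * I) * (Real.exp (γ * u) : ℂ) := by
        push_cast
        rw [← Complex.exp_add]
        ring_nf
      rw [e2]
      linear_combination (-x : ℂ) * e1
    rw [this, norm_mul, Complex.norm_exp_ofReal_mul_I, one_mul]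
  rw [h1]
  refine le_trans (le_of_eq ?_) (Complex.abs_im_le_norm _)
  rw [Complex.add_im, Complex.ofReal_im, Complex.im_ofReal_mul, Complex.exp_ofReal_mul_I_im,
    zero_add, abs_mul, abs_of_nonneg hx, Real.sin_neg, abs_neg]

/-- A zero would have `sin (γ im w) = 0`; as `|γ im w| < π`, it would lie on the real axis, where
the expression is positive. -/
lemma exp_mul_add_ne_zero {γ x θ : ℝ} (hγ : 0 < γ) (hx : 0 < x) (hθ : γ * θ < Real.pi) {w : ℂ}
    (hw : |w.im| ≤ θ) : Complex.exp (γ * w) + x ≠ 0 := by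
  intro h
  have h1 := mul_abs_sin_le_norm_exp_add (γ := γ) hx.le w.re w.im
  rw [Complex.re_add_im, h, norm_zero] at h1
  have h2 : Real.sin (γ * w.im) = 0 :=
    abs_eq_zero.1 (le_antisymm (by nlinarith [abs_nonneg (Real.sin (γ * w.im))]) (abs_nonneg _))
  have hb := abs_le.1 hw
  have h3 : γ * w.im = 0 := by
    rw [Real.sin_eq_zero_iff_of_lt_of_lt] at h2
    · exact h2
    · nlinarith
    · nlinarith
  have h4 : w.im = 0 := (mul_eq_zero.1 h3).resolve_left hγ.ne'
  have h5 := congrArg Complex.re h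
  rw [Complex.add_re, Complex.exp_re] at h5
  simp [h4] at h5
  linarith [Real.exp_pos (γ * w.re)]

lemma norm_mittagLefflerKernel_le {γ x : ℝ} (hx : 0 < x) (μ u : ℝ) {y : ℝ}
    (hy : Real.sin (γ * y) ≠ 0) :
    ‖mittagLefflerKernel γ μ x (u + y * I)‖ ≤ (x * |Real.sin (γ * y)|)⁻¹ *
      (Real.exp (Real.exp u * Real.cos y) * Real.exp ((1 - (μ - γ)) * u)) := by
  rw [mittagLefflerKernel, norm_div, norm_hankelKernel, div_eq_mul_inv, mul_comm]
  refine mul_le_mul_of_nonneg_right (inv_anti₀ ?_ (mul_abs_sin_le_norm_exp_add hx.le u y))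
    (by positivity)
  exact mul_pos hx (abs_pos.2 hy)

/-- The strip contains no pole, so the contour may be moved from the region where the series
converges all the way to `-∞`. The segment then disappears because `1 + γ - μ > 0`. -/
lemma mittagLeffler_neg_eq_integral {γ μ x θ : ℝ} (hγ : 1 ≤ γ) (hμ : 0 < μ) (hμγ : μ < γ + 1)
    (hx : 0 < x) (h1 : Real.pi / 2 < θ) (h2 : γ * θ < Real.pi) :
    (∫ u : ℝ, mittagLefflerKernel γ μ x (u + θ * I)) -
      (∫ u : ℝ, mittagLefflerKernel γ μ x (u + (-θ : ℝ) * I)) =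
      2 * Real.pi * I * mittagLeffler γ μ (-x) ∧
    Integrable (fun u : ℝ => mittagLefflerKernel γ μ x (u + θ * I)) ∧
    Integrable (fun u : ℝ => mittagLefflerKernel γ μ x (u + (-θ : ℝ) * I)) := by
  have hπ := Real.pi_pos
  have hθπ : θ < Real.pi := by nlinarith
  have hθ : Real.cos θ < 0 := Real.cos_neg_of_pi_div_two_lt_of_lt h1 (by linarith)
  have hθ' : Real.cos (-θ) < 0 := by simpa using hθ
  have hs : Real.sin (γ * θ) ≠ 0 := (Real.sin_pos_of_pos_of_lt_pi (by nlinarith) h2).ne'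
  have hs' : Real.sin (γ * -θ) ≠ 0 := by simpa using hs
  have hd : DifferentiableOn ℂ (mittagLefflerKernel γ μ x) {w | |w.im| ≤ θ} := by
    refine DifferentiableOn.div (differentiable_hankelKernel _).differentiableOn
      (by fun_prop) fun w hw => exp_mul_add_ne_zero (by linarith) hx h2 hw
  have hm : ∀ y : ℝ, |y| ≤ θ → Continuous fun u : ℝ => mittagLefflerKernel γ μ x (u + y * I) :=
      fun y hy => by
    refine Continuous.div (continuous_hankelKernel_line _ y) (by fun_prop) fun u => ?_
    exact exp_mul_add_ne_zero (by linarith) hx h2 (by simpa using hy)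
  have ha : |θ| ≤ θ := by rw [abs_of_pos (by linarith)]
  have ha' : |-θ| ≤ θ := by rwa [abs_neg]
  have i1 : Integrable (fun u : ℝ => mittagLefflerKernel γ μ x (u + θ * I)) :=
    ((integrable_exp_mul_exp_mul hθ (by linarith)).const_mul _).mono'
      (hm θ ha).aestronglyMeasurable
      (.of_forall fun u => norm_mittagLefflerKernel_le hx μ u hs)
  have i2 : Integrable (fun u : ℝ => mittagLefflerKernel γ μ x (u + (-θ : ℝ) * I)) :=
    ((integrable_exp_mul_exp_mul hθ' (by linarith)).const_mul _).mono'
      (hm (-θ) ha').aestronglyMeasurable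
      (.of_forall fun u => norm_mittagLefflerKernel_le hx μ u hs')
  refine ⟨?_, i1, i2⟩
  have hV : Tendsto (fun u₀ : ℝ => ∫ y in (-θ)..θ, mittagLefflerKernel γ μ x (u₀ + y * I)) atBot
      (𝓝 0) := by
    have hb : Tendsto (fun u : ℝ => Real.exp (Real.exp u) * Real.exp ((1 - (μ - γ)) * u) * (2 / x) *
        |θ - -θ|) atBot (𝓝 (Real.exp 0 * 0 * (2 / x) * |θ - -θ|)) := by
      refine Tendsto.mul_const _ (Tendsto.mul_const _ (Tendsto.mul ?_ ?_))
      · exact (Real.continuous_exp.tendsto _).comp Real.tendsto_exp_atBot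
      · exact Real.tendsto_exp_atBot.comp (tendsto_id.const_mul_atBot (by linarith))
    rw [mul_zero, zero_mul, zero_mul] at hb
    -- Far to the left `exp (γ w)` is negligible against `x`, so the denominator is at least `x / 2`
    -- on the entire segment.
    have hsmall : ∀ᶠ u : ℝ in atBot, Real.exp (γ * u) < x / 2 :=
      (Real.tendsto_exp_atBot.comp (tendsto_id.const_mul_atBot
        (by linarith : 0 < γ))).eventually_lt_const (by positivity)
    refine squeeze_zero_norm' ?_ hb
    filter_upwards [hsmall] with u hu
    refine intervalIntegral.norm_integral_le_of_norm_le_const fun y _ => ?_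
    rw [mittagLefflerKernel, norm_div, norm_hankelKernel, div_eq_mul_inv]
    have hlow : x / 2 ≤ ‖Complex.exp (γ * (u + y * I)) + x‖ := by
      have h3 := norm_sub_le_norm_add (x : ℂ) (Complex.exp (γ * (u + y * I)))
      rw [Complex.norm_of_nonneg hx.le, Complex.norm_exp, add_comm (x : ℂ)] at h3
      simp at h3
      linarith
    have hinv : ‖Complex.exp (γ * (u + y * I)) + x‖⁻¹ ≤ 2 / x := by
      rw [← inv_div]
      exact inv_anti₀ (by positivity) hlow
    gcongr
    exact mul_le_of_le_one_right (Real.exp_pos u).le (Real.cos_le_one y)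
  have hlim := tendsto_hankelIntegral_atBot i1 i2 hV
  have hq : ∀ᶠ u : ℝ in atTop, x * Real.exp (-(γ * u)) < 1 := by
    have : Tendsto (fun u : ℝ => x * Real.exp (-(γ * u))) atTop (𝓝 (x * 0)) := by
      refine Tendsto.const_mul _ (Real.tendsto_exp_neg_atTop_nhds_zero.comp
        (tendsto_id.const_mul_atTop (by linarith : 0 < γ)))
    rw [mul_zero] at this
    exact this.eventually_lt_const one_pos
  obtain ⟨u₁, hu₁⟩ := hq.exists
  have hconst : Tendsto (fun u => hankelIntegral (mittagLefflerKernel γ μ x) u θ) atBot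
      (𝓝 (2 * Real.pi * I * mittagLeffler γ μ (-x))) := by
    refine tendsto_const_nhds.congr' ?_
    filter_upwards [eventually_le_atBot u₁] with u hu
    rw [hankelIntegral_eq_of_le (by linarith) hd hu i1.integrableOn i2.integrableOn,
      hankelIntegral_mittagLefflerKernel hγ hμ hx.le hu₁ h1 hθπ.le]
  have := tendsto_nhds_unique hlim hconst
  rwa [mul_zero, add_zero] at this

/-- The decay of the Mittag-Leffler function on the negative half-line. -/
theorem exists_abs_mittagLeffler_neg_le {γ μ : ℝ} (hγ1 : 1 < γ) (hγ2 : γ < 2) (hμ : 0 < μ)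
    (hμγ : μ < γ + 1) :
    ∃ C : ℝ, 0 < C ∧ ∀ x : ℝ, 0 ≤ x → |mittagLeffler γ μ (-x)| ≤ C / (1 + x) := by
  have hπ := Real.pi_pos
  -- The lower bound makes `cos θ` negative, the upper bound keeps the poles outside the strip.
  obtain ⟨θ, h1, h2⟩ : ∃ θ, Real.pi / 2 < θ ∧ θ < Real.pi / γ :=
    exists_between (div_lt_div_of_pos_left hπ (by linarith) hγ2)
  have h2' : γ * θ < Real.pi := by rwa [lt_div_iff₀' (by linarith)] at h2
  have hθ : Real.cos θ < 0 := Real.cos_neg_of_pi_div_two_lt_of_lt h1 (by nlinarith)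
  have hs : 0 < Real.sin (γ * θ) := Real.sin_pos_of_pos_of_lt_pi (by nlinarith) h2'
  set J := ∫ u : ℝ, Real.exp (Real.exp u * Real.cos θ) * Real.exp ((1 - (μ - γ)) * u) with hJ
  have hJ0 : 0 ≤ J := integral_nonneg fun u => by positivity
  set K := ∑' k : ℕ, (1 : ℝ) ^ k / Real.Gamma (γ * k + μ) with hK
  have hγ0 : 0 ≤ γ := by linarith
  have hK0 : 0 ≤ K := tsum_nonneg fun k => by
    have := Gamma_mul_add_pos hγ0 hμ k
    positivity
  refine ⟨2 * (J / (Real.pi * Real.sin (γ * θ)) + K) + 1, by positivity, fun x hx => ?_⟩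
  rw [le_div_iff₀ (by linarith)]
  -- For `x ≤ 1` the power series at `1` dominates. For `x > 1` the integral representation, with
  -- denominator at least `x sin (γθ)`, gives the decay.
  rcases le_or_gt x 1 with hx1 | hx1
  · have hE : |mittagLeffler γ μ (-x)| ≤ K := by
      rw [mittagLeffler, ← Real.norm_eq_abs]
      refine tsum_of_norm_bounded (summable_mittagLeffler hγ1.le hμ 1).hasSum fun k => ?_
      have := Gamma_mul_add_pos hγ0 hμ k
      rw [norm_div, norm_pow, norm_neg, Real.norm_of_nonneg hx, Real.norm_of_nonneg this.le]
      gcongr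
    have : 0 ≤ J / (Real.pi * Real.sin (γ * θ)) := by positivity
    nlinarith [abs_nonneg (mittagLeffler γ μ (-x))]
  · have hx0 : 0 < x := by linarith
    obtain ⟨e, i1, i2⟩ := mittagLeffler_neg_eq_integral hγ1.le hμ hμγ hx0 h1 h2'
    have hb : ∀ y : ℝ, y = θ ∨ y = -θ →
        ‖∫ u : ℝ, mittagLefflerKernel γ μ x (u + y * I)‖ ≤ (x * Real.sin (γ * θ))⁻¹ * J := by
      intro y hy
      have hc : Real.cos y = Real.cos θ := by rcases hy with rfl | rfl <;> simp
      have hsy : |Real.sin (γ * y)| = Real.sin (γ * θ) := by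
        rcases hy with rfl | rfl
        · exact abs_of_pos hs
        · rw [mul_neg, Real.sin_neg, abs_neg, abs_of_pos hs]
      rw [hJ, ← integral_const_mul]
      refine norm_integral_le_of_norm_le
        ((integrable_exp_mul_exp_mul hθ (by linarith)).const_mul _) (.of_forall fun u => ?_)
      have := norm_mittagLefflerKernel_le (γ := γ) hx0 μ u (y := y)
        (by rw [← abs_pos, hsy]; exact hs)
      rwa [hsy, hc] at this
    have hn := congrArg norm e
    have hle := norm_sub_le (∫ u : ℝ, mittagLefflerKernel γ μ x (u + θ * I))
      (∫ u : ℝ, mittagLefflerKernel γ μ x (u + (-θ : ℝ) * I))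
    rw [hn] at hle
    have hle2 := hle.trans (add_le_add (hb θ (Or.inl rfl)) (hb (-θ) (Or.inr rfl)))
    rw [norm_mul, norm_mul, norm_mul, Complex.norm_I, Complex.norm_real, Complex.norm_real,
      Real.norm_of_nonneg hπ.le] at hle2
    norm_num at hle2
    set E := |mittagLeffler γ μ (-x)|
    have hE : E * x ≤ J / (Real.pi * Real.sin (γ * θ)) := by
      rw [le_div_iff₀ (by positivity)]
      have h4 : (Real.sin (γ * θ))⁻¹ * x⁻¹ * J * (x * Real.sin (γ * θ)) = J := by
        field_simp
      have h5 := mul_le_mul_of_nonneg_right hle2 (by positivity : 0 ≤ x * Real.sin (γ * θ))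
      nlinarith
    have hE0 : 0 ≤ E := abs_nonneg _
    nlinarith

end MittagLeffler

/-! ## Fractional integrals of the Mittag-Leffler kernels -/

noncomputable section FractionalCalculus

lemma integral_sub_rpow_mul_rpow {σ a t : ℝ} (hσ : 0 < σ) (ha : 0 < a) (ht : 0 < t) :
    ∫ r in (0 : ℝ)..t, (t - r) ^ (σ - 1) * r ^ (a - 1) =
      t ^ (a + σ - 1) * (Real.Gamma a * Real.Gamma σ / Real.Gamma (a + σ)) := by
  have h := Complex.betaIntegral_scaled a σ ht
  rw [Complex.betaIntegral_eq_Gamma_mul_div _ _ (by simpa) (by simpa)] at h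
  have e : ∫ r in (0 : ℝ)..t, (r : ℂ) ^ ((a : ℂ) - 1) * ((t : ℂ) - r) ^ ((σ : ℂ) - 1) =
      ((∫ r in (0 : ℝ)..t, (t - r) ^ (σ - 1) * r ^ (a - 1) : ℝ) : ℂ) := by
    rw [← intervalIntegral.integral_ofReal]
    refine intervalIntegral.integral_congr fun r hr => ?_
    rw [uIcc_of_le ht.le] at hr
    rw [Complex.ofReal_mul, Complex.ofReal_cpow (by linarith [hr.2]), Complex.ofReal_cpow hr.1]
    push_cast
    ring
  rw [e] at h
  apply Complex.ofReal_injective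
  rw [h]
  push_cast [Complex.ofReal_cpow ht.le, ← Complex.Gamma_ofReal]
  rfl

/-- The integral of a non-integrable function is zero by convention, whereas the Beta integral is
positive. -/
lemma intervalIntegrable_sub_rpow_mul_rpow {σ a t : ℝ} (hσ : 0 < σ) (ha : 0 < a) (ht : 0 < t) :
    IntervalIntegrable (fun r => (t - r) ^ (σ - 1) * r ^ (a - 1)) volume 0 t := by
  refine intervalIntegral.intervalIntegrable_of_integral_ne_zero ?_
  rw [integral_sub_rpow_mul_rpow hσ ha ht]
  have h1 := Real.Gamma_pos_of_pos hσ
  have h2 := Real.Gamma_pos_of_pos ha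
  have h3 := Real.Gamma_pos_of_pos (add_pos ha hσ)
  positivity

/-! ### The kernels of the solution formula and their algebra. -/

lemma continuous_mittagLeffler {γ μ : ℝ} (hγ : 1 ≤ γ) (hμ : 0 < μ) :
    Continuous (mittagLeffler γ μ) := by
  rw [continuous_iff_continuousAt]
  intro z
  have hc : ContinuousOn (mittagLeffler γ μ) (Metric.ball 0 (|z| + 1)) := by
    refine continuousOn_tsum (u := fun k : ℕ => (|z| + 1) ^ k / Real.Gamma (γ * k + μ))
      (fun k => by fun_prop) (summable_mittagLeffler hγ hμ _) fun k x hx => ?_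
    have := Gamma_mul_add_pos (by linarith : 0 ≤ γ) hμ k
    rw [norm_div, norm_pow, Real.norm_of_nonneg this.le]
    gcongr
    exact (by simpa using hx : |x| < |z| + 1).le
  exact hc.continuousAt (Metric.isOpen_ball.mem_nhds (by simp))

/-- The kernel `t ^ (μ - 1) * E_{γ,μ}(-lam * t ^ γ)`. For `lam = 0` this is the kernel
`t ^ (μ - 1) / Γ(μ)` of the fractional integral of order `μ`. -/
def mlKernel (γ lam μ t : ℝ) : ℝ := t ^ (μ - 1) * mittagLeffler γ μ (-(lam * t ^ γ))

lemma mittagLeffler_zero (γ μ : ℝ) : mittagLeffler γ μ 0 = (Real.Gamma μ)⁻¹ := by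
  rw [mittagLeffler, tsum_eq_single 0]
  · simp
  · intro k hk
    simp [hk]

lemma mlKernel_lam_zero (γ μ t : ℝ) : mlKernel γ 0 μ t = t ^ (μ - 1) * (Real.Gamma μ)⁻¹ := by
  rw [mlKernel, zero_mul, neg_zero, mittagLeffler_zero]

lemma continuous_mittagLeffler_comp {γ μ : ℝ} (hγ : 1 ≤ γ) (hμ : 0 < μ) (lam : ℝ) :
    Continuous fun t : ℝ => mittagLeffler γ μ (-(lam * t ^ γ)) :=
  (continuous_mittagLeffler hγ hμ).comp
    ((continuous_const.mul (Real.continuous_rpow_const (by linarith))).neg)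

lemma continuousOn_mlKernel {γ μ : ℝ} (hγ : 1 ≤ γ) (hμ : 0 < μ) (lam : ℝ) :
    ContinuousOn (mlKernel γ lam μ) (Ioi 0) :=
  (continuousOn_id.rpow_const fun _ hx => Or.inl (ne_of_gt hx)).mul
    (continuous_mittagLeffler_comp hγ hμ lam).continuousOn

lemma continuous_mlKernel {γ μ : ℝ} (hγ : 1 ≤ γ) (hμ : 1 ≤ μ) (lam : ℝ) :
    Continuous (mlKernel γ lam μ) :=
  (Real.continuous_rpow_const (by linarith)).mul
    (continuous_mittagLeffler_comp hγ (by linarith) lam)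

lemma integrableOn_rpow_Ioo {a : ℝ} (ha : 0 < a) (T : ℝ) :
    IntegrableOn (fun t : ℝ => t ^ (a - 1)) (Ioo 0 T) := by
  rcases le_total T 0 with h | h
  · simp [Ioo_eq_empty (not_lt.2 h)]
  exact ((intervalIntegrable_iff_integrableOn_Ioo_of_le h).1
    (intervalIntegral.intervalIntegrable_rpow' (by linarith)))

lemma integrableOn_mlKernel {γ μ : ℝ} (hγ : 1 ≤ γ) (hμ : 0 < μ) (lam T : ℝ) :
    IntegrableOn (mlKernel γ lam μ) (Ioo 0 T) := by
  obtain ⟨C, hC⟩ := isCompact_Icc.exists_bound_of_continuousOn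
    (continuous_mittagLeffler_comp hγ hμ lam).continuousOn (s := Icc 0 T)
  refine (integrableOn_rpow_Ioo hμ T).mul_bdd (c := C)
    (continuous_mittagLeffler_comp hγ hμ lam).aestronglyMeasurable ?_
  filter_upwards [ae_restrict_mem measurableSet_Ioo] with t ht
  exact hC t (Ioo_subset_Icc_self ht)

lemma mlKernel_eq_tsum {γ : ℝ} (lam μ : ℝ) {t : ℝ} (ht : 0 < t) :
    mlKernel γ lam μ t = ∑' k : ℕ, (-lam) ^ k / Real.Gamma (γ * k + μ) * t ^ (γ * k + μ - 1) := by
  rw [mlKernel, mittagLeffler, ← tsum_mul_left]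
  refine tsum_congr fun k => ?_
  rw [show γ * k + μ - 1 = (μ - 1) + γ * k by ring, Real.rpow_add ht, Real.rpow_mul ht.le,
    Real.rpow_natCast, ← neg_mul, mul_pow]
  ring

/-- The zeroth term of the series is split off; in the rest, shifting the summation index raises `μ`
by `γ`. -/
lemma mlKernel_eq_sub {γ μ : ℝ} (hγ : 1 ≤ γ) (hμ : 0 < μ) (lam : ℝ) {t : ℝ} (ht : 0 < t) :
    mlKernel γ lam μ t = mlKernel γ 0 μ t - lam * mlKernel γ lam (μ + γ) t := by
  have hs := summable_mittagLeffler hγ hμ (-(lam * t ^ γ))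
  have e : t ^ (μ + γ - 1) = t ^ (μ - 1) * t ^ γ := by
    rw [← Real.rpow_add ht]
    ring_nf
  rw [mlKernel_lam_zero, mlKernel, mlKernel, mittagLeffler, mittagLeffler, hs.tsum_eq_zero_add, e]
  have : ∑' k : ℕ, (-(lam * t ^ γ)) ^ (k + 1) / Real.Gamma (γ * ((k + 1 : ℕ) : ℝ) + μ) =
      -(lam * t ^ γ) * ∑' k : ℕ, (-(lam * t ^ γ)) ^ k / Real.Gamma (γ * k + (μ + γ)) := by
    rw [← tsum_mul_left]
    refine tsum_congr fun k => ?_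
    rw [show γ * ((k + 1 : ℕ) : ℝ) + μ = γ * k + (μ + γ) by push_cast; ring, pow_succ']
    ring
  rw [this]
  simp only [pow_zero, Nat.cast_zero, mul_zero, zero_add, one_div]
  ring

/-- The fractional integral of order `σ` takes the kernel of index `μ` to that of index `μ + σ`. -/
lemma integral_mlKernel_mul_mlKernel {γ σ μ : ℝ} (hγ : 1 ≤ γ) (hσ : 0 < σ) (hμ : 0 < μ) (lam : ℝ)
    {t : ℝ} (ht : 0 < t) :
    ∫ r in (0 : ℝ)..t, mlKernel γ 0 σ (t - r) * mlKernel γ lam μ r = mlKernel γ lam (μ + σ) t := by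
  have hγ0 : 0 ≤ γ := by linarith
  have hGσ := Real.Gamma_pos_of_pos hσ
  set F : ℕ → ℝ → ℝ := fun k r => (-lam) ^ k / Real.Gamma (γ * k + μ) * (Real.Gamma σ)⁻¹ *
    ((t - r) ^ (σ - 1) * r ^ (γ * k + μ - 1)) with hF
  have hpos : ∀ k : ℕ, 0 < γ * k + μ := fun k => by positivity
  have hint : ∀ k, Integrable (F k) (volume.restrict (Ioc 0 t)) := fun k =>
    ((intervalIntegrable_iff_integrableOn_Ioc_of_le ht.le).1
      (intervalIntegrable_sub_rpow_mul_rpow hσ (hpos k) ht)).const_mul _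
  have hval : ∀ (c : ℝ) (k : ℕ), ∫ r in Ioc 0 t, c * ((t - r) ^ (σ - 1) * r ^ (γ * k + μ - 1)) =
      c * (t ^ (γ * k + μ + σ - 1) *
        (Real.Gamma (γ * k + μ) * Real.Gamma σ / Real.Gamma (γ * k + μ + σ))) := fun c k => by
    rw [integral_const_mul, ← intervalIntegral.integral_of_le ht.le,
      integral_sub_rpow_mul_rpow hσ (hpos k) ht]
  -- With absolute values, `-lam` becomes `|lam|`, and the Beta integrals sum to a Mittag-Leffler
  -- series again.
  have hsum : Summable fun k => ∫ r in Ioc 0 t, ‖F k r‖ := by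
    have h1 := (summable_mittagLeffler hγ (add_pos hμ hσ) (|lam| * t ^ γ)).mul_left
      (t ^ (μ + σ - 1))
    refine h1.congr fun k => ?_
    have e : ∫ r in Ioc 0 t, ‖F k r‖ = ∫ r in Ioc 0 t,
        (|lam| ^ k / Real.Gamma (γ * k + μ) * (Real.Gamma σ)⁻¹) *
          ((t - r) ^ (σ - 1) * r ^ (γ * k + μ - 1)) := by
      refine setIntegral_congr_fun measurableSet_Ioc fun r hr => ?_
      have := Gamma_mul_add_pos hγ0 hμ k
      have h2 : 0 ≤ (t - r) ^ (σ - 1) := Real.rpow_nonneg (by linarith [hr.2]) _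
      have h3 : 0 ≤ r ^ (γ * k + μ - 1) := Real.rpow_nonneg hr.1.le _
      simp only [hF]
      rw [norm_mul, norm_mul, norm_div, norm_pow, norm_neg, Real.norm_eq_abs lam,
        Real.norm_of_nonneg this.le, Real.norm_of_nonneg (inv_nonneg.2 hGσ.le),
        Real.norm_of_nonneg (mul_nonneg h2 h3)]
    rw [e, hval, show γ * k + μ + σ = γ * k + (μ + σ) by ring,
      show γ * k + (μ + σ) - 1 = (μ + σ - 1) + γ * k by ring, Real.rpow_add ht, Real.rpow_mul ht.le,
      Real.rpow_natCast, mul_pow]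
    have h2 := (Gamma_mul_add_pos hγ0 hμ k).ne'
    have h3 := (Gamma_mul_add_pos hγ0 (add_pos hμ hσ) k).ne'
    field_simp
  have hs := hasSum_integral_of_summable_integral_norm hint hsum
  have hint_eq : ∫ r in (0 : ℝ)..t, mlKernel γ 0 σ (t - r) * mlKernel γ lam μ r =
      ∫ r in Ioc 0 t, ∑' k, F k r := by
    rw [intervalIntegral.integral_of_le ht.le]
    refine setIntegral_congr_fun measurableSet_Ioc fun r hr => ?_
    simp only [hF]
    rw [mlKernel_lam_zero, mlKernel_eq_tsum _ _ hr.1, ← tsum_mul_left]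
    refine tsum_congr fun k => ?_
    ring
  rw [hint_eq, ← hs.tsum_eq, mlKernel_eq_tsum _ _ ht]
  refine tsum_congr fun k => ?_
  simp only [hF]
  rw [hval, show γ * k + μ + σ = γ * k + (μ + σ) by ring]
  have h2 := (Gamma_mul_add_pos hγ0 hμ k).ne'
  have h3 := (Gamma_mul_add_pos hγ0 (add_pos hμ hσ) k).ne'
  field_simp

/-! ### Convolutions on `(0,T)` -/

/-- Fubini. The double integrand is a convolution integrand of two integrable functions times a
bounded factor. -/
lemma integral_convolution_assoc {A B F : ℝ → ℝ} {M : ℝ} (hA : Integrable A) (hB : Integrable B)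
    (hF : AEStronglyMeasurable F) (hFM : ∀ᵐ r, ‖F r‖ ≤ M) (t : ℝ) :
    ∫ r, A (t - r) * ∫ q, B (r - q) * F q = ∫ q, (∫ p, A (t - q - p) * B p) * F q := by
  have hi : Integrable (fun p : ℝ × ℝ => A (t - p.2) * B (p.2 - p.1) * F p.1)
      (volume.prod volume) := by
    have h1 := Integrable.convolution_integrand (ContinuousLinearMap.mul ℝ ℝ)
      (hA.comp_sub_left t) (hB.comp_neg)
    simp only [ContinuousLinearMap.mul_apply', neg_sub] at h1
    refine h1.mul_bdd (c := M) hF.comp_fst ?_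
    exact Measure.quasiMeasurePreserving_fst.ae hFM
  calc ∫ r, A (t - r) * ∫ q, B (r - q) * F q
      = ∫ r, ∫ q, A (t - r) * B (r - q) * F q := by
        refine integral_congr_ae (.of_forall fun r => ?_)
        simp only [← integral_const_mul, mul_assoc]
    _ = ∫ q, ∫ r, A (t - r) * B (r - q) * F q := by
        rw [integral_integral_swap]
        exact hi.swap
    _ = _ := by
        refine integral_congr_ae (.of_forall fun q => ?_)
        simp only [integral_mul_const]
        congr 1
        rw [← integral_sub_right_eq_self (fun p => A (t - q - p) * B p) q]
        simp

/-- Extension by zero turns a Volterra convolution into one on the real line, where translation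
invariance is available. -/
lemma intervalIntegral_eq_integral_indicator {a f : ℝ → ℝ} {T t : ℝ} (h0 : 0 ≤ t) (hT : t ≤ T) :
    ∫ r in (0 : ℝ)..t, a (t - r) * f r =
      ∫ r, (Ioo 0 T).indicator a (t - r) * (Ioo 0 T).indicator f r := by
  rw [intervalIntegral.integral_of_le h0, integral_Ioc_eq_integral_Ioo,
    ← integral_indicator measurableSet_Ioo]
  refine integral_congr_ae (.of_forall fun r => ?_)
  by_cases hr : r ∈ Ioo 0 t
  · simp only
    rw [indicator_of_mem hr, indicator_of_mem, indicator_of_mem]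
    · exact ⟨hr.1, hr.2.trans_le hT⟩
    · exact ⟨by linarith [hr.2], by linarith [hr.1]⟩
  · simp only
    rw [indicator_of_notMem hr]
    by_cases hr0 : 0 < r
    · rw [indicator_of_notMem (a := t - r), zero_mul]
      exact fun h => hr ⟨hr0, by linarith [h.1]⟩
    · rw [indicator_of_notMem (a := r), mul_zero]
      exact fun h => hr0 h.1

/-- Associativity of convolution on `(0,T)`. -/
lemma intervalIntegral_convolution_assoc {a b f : ℝ → ℝ} {T t M : ℝ}
    (ha : IntegrableOn a (Ioo 0 T)) (hb : IntegrableOn b (Ioo 0 T))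
    (hf : AEStronglyMeasurable f (timeMeasure T)) (hfM : ∀ᵐ r ∂timeMeasure T, ‖f r‖ ≤ M)
    (h0 : 0 ≤ t) (hT : t ≤ T) :
    ∫ r in (0 : ℝ)..t, a (t - r) * ∫ q in (0 : ℝ)..r, b (r - q) * f q =
      ∫ q in (0 : ℝ)..t, (∫ p in (0 : ℝ)..(t - q), a (t - q - p) * b p) * f q := by
  have key := integral_convolution_assoc ((integrable_indicator_iff measurableSet_Ioo).2 ha)
    ((integrable_indicator_iff measurableSet_Ioo).2 hb)
    ((aestronglyMeasurable_indicator_iff measurableSet_Ioo).2 hf) (M := max M 0) (F :=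
      (Ioo 0 T).indicator f) ?_ t
  · rw [intervalIntegral_eq_integral_indicator (a := a) h0 hT,
      intervalIntegral_eq_integral_indicator
      (a := fun s => ∫ p in (0 : ℝ)..s, a (s - p) * b p) h0 hT]
    refine Eq.trans (integral_congr_ae (.of_forall fun r => ?_)) (key.trans
      (integral_congr_ae (.of_forall fun q => ?_)))
    · by_cases hr : r ∈ Ioo 0 T
      · simp only
        rw [indicator_of_mem hr, intervalIntegral_eq_integral_indicator hr.1.le hr.2.le]
      · simp only
        rw [indicator_of_notMem hr, mul_zero]
        by_cases hr0 : 0 < r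
        · have : T ≤ r := not_lt.1 fun h => hr ⟨hr0, h⟩
          rw [indicator_of_notMem fun h => (by linarith [h.1] : ¬ (t ≤ r)) (hT.trans this), zero_mul]
        · rw [integral_eq_zero_of_ae, mul_zero]
          refine .of_forall fun q => ?_
          by_cases hq : q ∈ Ioo 0 T
          · simp only [Pi.zero_apply]
            rw [indicator_of_notMem fun h => hr0 (by linarith [h.1, hq.1]), zero_mul]
          · simp only [Pi.zero_apply]
            rw [indicator_of_notMem hq, mul_zero]
    · by_cases hq : q ∈ Ioo 0 T
      · simp only
        congr 1
        by_cases hq' : q < t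
        · have hmem : t - q ∈ Ioo 0 T := ⟨by linarith, by linarith [hq.1]⟩
          rw [indicator_of_mem hmem, intervalIntegral_eq_integral_indicator hmem.1.le hmem.2.le]
        · rw [indicator_of_notMem fun h => hq' (by linarith [h.1]), integral_eq_zero_of_ae]
          refine .of_forall fun p => ?_
          by_cases hp : p ∈ Ioo 0 T
          · simp only [Pi.zero_apply]
            rw [indicator_of_notMem fun h => hq' (by linarith [h.1, hp.1]), zero_mul]
          · simp only [Pi.zero_apply]
            rw [indicator_of_notMem hp, mul_zero]
      · simp only
        rw [indicator_of_notMem hq, mul_zero, mul_zero]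
  · have := (ae_restrict_iff' measurableSet_Ioo).1 hfM
    filter_upwards [this] with r hr
    by_cases h : r ∈ Ioo 0 T
    · rw [indicator_of_mem h]
      exact (hr h).trans (le_max_left _ _)
    · rw [indicator_of_notMem h, norm_zero]
      exact le_max_right _ _

lemma mlKernel_convolution_assoc {γ σ μ : ℝ} (hγ : 1 ≤ γ) (hσ : 0 < σ) (hμ : 0 < μ) (lam : ℝ)
    {f : ℝ → ℝ} {T t M : ℝ} (hf : AEStronglyMeasurable f (timeMeasure T))
    (hfM : ∀ᵐ r ∂timeMeasure T, ‖f r‖ ≤ M) (h0 : 0 ≤ t) (hT : t ≤ T) :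
    ∫ r in (0 : ℝ)..t, mlKernel γ 0 σ (t - r) * ∫ q in (0 : ℝ)..r, mlKernel γ lam μ (r - q) * f q =
      ∫ q in (0 : ℝ)..t, mlKernel γ lam (μ + σ) (t - q) * f q := by
  rw [intervalIntegral_convolution_assoc (integrableOn_mlKernel hγ hσ 0 T)
    (integrableOn_mlKernel hγ hμ lam T) hf hfM h0 hT, intervalIntegral.integral_of_le h0,
    intervalIntegral.integral_of_le h0, integral_Ioc_eq_integral_Ioo, integral_Ioc_eq_integral_Ioo]
  refine setIntegral_congr_fun measurableSet_Ioo fun q hq => ?_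
  rw [integral_mlKernel_mul_mlKernel hγ hσ hμ lam (by linarith [hq.2])]

lemma fracIntegral_eq_mlKernel (γ σ : ℝ) (u : ℝ → ℝ) (t : ℝ) :
    fracIntegral σ u t = ∫ r in (0 : ℝ)..t, mlKernel γ 0 σ (t - r) * u r := by
  rw [fracIntegral, smul_eq_mul, ← intervalIntegral.integral_const_mul]
  refine intervalIntegral.integral_congr fun r _ => ?_
  simp only [mlKernel_lam_zero, smul_eq_mul]
  ring

end FractionalCalculus

/-! ## Approximation of `H₀¹` functions by averages over the cells of a grid -/

/-- Cauchy–Schwarz applied to `√m` and `√m f`. The weight `m` is `1` in the grid estimates and a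
singular kernel in Young's inequality. -/
lemma lintegral_mul_sq_le {α : Type*} [MeasurableSpace α] (μ : Measure α) {m f : α → ℝ≥0∞}
    (hm : AEMeasurable m μ) (hf : AEMeasurable f μ) :
    (∫⁻ a, m a * f a ∂μ) ^ 2 ≤ (∫⁻ a, m a ∂μ) * ∫⁻ a, m a * f a ^ 2 ∂μ := by
  have h := ENNReal.lintegral_mul_le_Lp_mul_Lq μ Real.HolderConjugate.two_two
    (f := fun a => m a ^ (1 / 2 : ℝ)) (g := fun a => m a ^ (1 / 2 : ℝ) * f a)
    (hm.pow_const _) ((hm.pow_const _).mul hf)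
  have e0 : ∀ x : ℝ≥0∞, x ^ (1 / 2 : ℝ) * x ^ (1 / 2 : ℝ) = x := fun x => by
    rw [← ENNReal.rpow_add_of_nonneg _ _ (by norm_num) (by norm_num)]
    norm_num
  have e1 : ∀ a, ((fun a => m a ^ (1 / 2 : ℝ)) * fun a => m a ^ (1 / 2 : ℝ) * f a) a =
      m a * f a := fun a => by
    rw [Pi.mul_apply, ← mul_assoc, e0]
  have e2 : ∀ a, (m a ^ (1 / 2 : ℝ)) ^ (2 : ℝ) = m a := fun a => by
    rw [← ENNReal.rpow_mul]
    norm_num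
  have e3 : ∀ a, (m a ^ (1 / 2 : ℝ) * f a) ^ (2 : ℝ) = m a * f a ^ 2 := fun a => by
    rw [ENNReal.mul_rpow_of_nonneg _ _ (by norm_num), e2, ENNReal.rpow_two]
  simp only [e1, e2, e3] at h
  refine (pow_le_pow_left' h 2).trans_eq ?_
  rw [mul_pow, sq, sq, e0, e0]

section Grid

variable {n : ℕ}

/-- The fundamental theorem of calculus along the segment from `x` to `x + z`, followed by
Cauchy–Schwarz. -/
lemma enorm_sub_sq_le_lintegral {φ : EuclideanSpace ℝ (Fin n) → ℝ} (hφ : ContDiff ℝ 1 φ)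
    (x z : EuclideanSpace ℝ (Fin n)) :
    ‖φ (x + z) - φ x‖ₑ ^ 2 ≤
      ∫⁻ t in Ioc (0 : ℝ) 1, ‖z‖ₑ ^ 2 * ‖fderiv ℝ φ (x + t • z)‖ₑ ^ 2 := by
  have hc : Continuous fun t : ℝ => fderiv ℝ φ (x + t • z) :=
    (hφ.continuous_fderiv (by simp)).comp (by fun_prop)
  have hd : ∀ t ∈ uIcc (0 : ℝ) 1, HasDerivAt (fun t : ℝ => φ (x + t • z))
      (fderiv ℝ φ (x + t • z) z) t := fun t _ => by
    have h1 : HasDerivAt (fun t : ℝ => x + t • z) z t := by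
      simpa using ((hasDerivAt_id t).smul_const z).const_add x
    exact ((hφ.differentiable (by simp) _).hasFDerivAt).comp_hasDerivAt t h1
  have e := intervalIntegral.integral_eq_sub_of_hasDerivAt hd
    ((hc.clm_apply continuous_const).intervalIntegrable _ _)
  simp only [one_smul, zero_smul, add_zero] at e
  rw [← e, intervalIntegral.integral_of_le zero_le_one]
  have h1 : ‖∫ t in Ioc (0 : ℝ) 1, fderiv ℝ φ (x + t • z) z‖ₑ ≤
      ∫⁻ t in Ioc (0 : ℝ) 1, 1 * (‖z‖ₑ * ‖fderiv ℝ φ (x + t • z)‖ₑ) := by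
    refine (enorm_integral_le_lintegral_enorm _).trans (lintegral_mono fun t => ?_)
    rw [one_mul, mul_comm]
    exact ContinuousLinearMap.le_opENorm _ _
  refine (pow_le_pow_left' h1 2).trans ((lintegral_mul_sq_le _ aemeasurable_const
    (hc.enorm.measurable.const_mul _).aemeasurable).trans_eq ?_)
  simp [mul_pow]

lemma lintegral_enorm_translate_sub_sq_le {φ : EuclideanSpace ℝ (Fin n) → ℝ}
    (hφ : ContDiff ℝ 1 φ) (z : EuclideanSpace ℝ (Fin n)) :
    ∫⁻ x, ‖φ (x + z) - φ x‖ₑ ^ 2 ≤ ‖z‖ₑ ^ 2 * ∫⁻ x, ‖fderiv ℝ φ x‖ₑ ^ 2 := by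
  have hc : Continuous (fderiv ℝ φ) := hφ.continuous_fderiv (by simp)
  calc ∫⁻ x, ‖φ (x + z) - φ x‖ₑ ^ 2
      ≤ ∫⁻ x, ∫⁻ t in Ioc (0 : ℝ) 1, ‖z‖ₑ ^ 2 * ‖fderiv ℝ φ (x + t • z)‖ₑ ^ 2 :=
        lintegral_mono fun x => enorm_sub_sq_le_lintegral hφ x z
    _ = ∫⁻ t in Ioc (0 : ℝ) 1, ∫⁻ x, ‖z‖ₑ ^ 2 * ‖fderiv ℝ φ (x + t • z)‖ₑ ^ 2 := by
        refine lintegral_lintegral_swap ?_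
        refine Measurable.aemeasurable (Measurable.const_mul (Measurable.pow_const ?_ 2) _)
        refine Continuous.measurable (Continuous.enorm (hc.comp ?_))
        fun_prop
    _ = _ := by
        have h1 : ∀ t : ℝ, ∫⁻ x, ‖z‖ₑ ^ 2 * ‖fderiv ℝ φ (x + t • z)‖ₑ ^ 2 =
            ‖z‖ₑ ^ 2 * ∫⁻ x, ‖fderiv ℝ φ x‖ₑ ^ 2 := fun t => by
          rw [lintegral_const_mul' _ _ (by simp),
            lintegral_add_right_eq_self (fun x => ‖fderiv ℝ φ x‖ₑ ^ 2) (t • z)]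
        simp [h1]

/-! ### Grid cells and averages over them. -/

/-- The index of the cell of the grid of mesh size `δ` that contains `x`. -/
noncomputable def gridIndex (δ : ℝ) (x : EuclideanSpace ℝ (Fin n)) : Fin n → ℤ :=
  fun i => ⌊x i / δ⌋

/-- The cells of the grid of mesh size `δ`. -/
def gridCell (δ : ℝ) (k : Fin n → ℤ) : Set (EuclideanSpace ℝ (Fin n)) := {x | gridIndex δ x = k}

lemma measurable_gridIndex (δ : ℝ) : Measurable (gridIndex (n := n) δ) := by
  refine measurable_pi_lambda _ fun i => ?_
  exact Int.measurable_floor.comp (by fun_prop)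

lemma measurableSet_gridCell (δ : ℝ) (k : Fin n → ℤ) : MeasurableSet (gridCell δ k) :=
  measurable_gridIndex δ (measurableSet_singleton k)

lemma volume_gridCell {δ : ℝ} (hδ : 0 < δ) (k : Fin n → ℤ) :
    volume (gridCell δ k) = ENNReal.ofReal δ ^ n := by
  have e : gridCell δ k = WithLp.ofLp ⁻¹' (univ.pi fun i => Ico (δ * k i) (δ * k i + δ)) := by
    ext x
    simp only [gridCell, gridIndex, Set.mem_ofPred_eq, funext_iff, Set.mem_preimage, Set.mem_pi,
      Set.mem_univ, true_imp_iff, Int.floor_eq_iff, Set.mem_Ico]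
    refine forall_congr' fun i => and_congr ?_ ?_
    · rw [le_div_iff₀ hδ, mul_comm]
    · rw [div_lt_iff₀ hδ]
      ring_nf
  rw [e, (PiLp.volume_preserving_ofLp (Fin n)).measure_preimage, Real.volume_pi_Ico]
  · simp
  · exact (MeasurableSet.univ_pi fun i => measurableSet_Ico).nullMeasurableSet

lemma norm_sub_of_gridIndex_eq {δ : ℝ} (hδ : 0 < δ) {x y : EuclideanSpace ℝ (Fin n)}
    (h : gridIndex δ x = gridIndex δ y) (i : Fin n) : |y i - x i| ≤ δ := by
  have h1 := Int.abs_sub_lt_one_of_floor_eq_floor (congrFun h.symm i)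
  rw [← sub_div, abs_div, abs_of_pos hδ, div_lt_one hδ] at h1
  exact h1.le

/-- The cube `{z | ∀ i, |z i| ≤ δ}`. -/
def cube (n : ℕ) (δ : ℝ) : Set (EuclideanSpace ℝ (Fin n)) := {z | ∀ i, |z i| ≤ δ}

lemma cube_eq (δ : ℝ) : cube n δ = WithLp.ofLp ⁻¹' (Icc (fun _ => -δ) (fun _ => δ)) := by
  ext z
  simp [cube, abs_le, Pi.le_def, forall_and]

lemma measurableSet_cube (δ : ℝ) : MeasurableSet (cube n δ) := by
  rw [cube_eq]
  exact (PiLp.volume_preserving_ofLp (Fin n)).measurable measurableSet_Icc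

lemma volume_cube (δ : ℝ) : volume (cube n δ) = ENNReal.ofReal (2 * δ) ^ n := by
  rw [cube_eq, (PiLp.volume_preserving_ofLp (Fin n)).measure_preimage, Real.volume_Icc_pi]
  · simp [two_mul]
  · exact measurableSet_Icc.nullMeasurableSet

lemma enorm_sq_le_of_mem_cube {δ : ℝ} {z : EuclideanSpace ℝ (Fin n)}
    (hz : z ∈ cube n δ) : ‖z‖ₑ ^ 2 ≤ ENNReal.ofReal (n * δ ^ 2) := by
  rw [← ofReal_norm, ← ENNReal.ofReal_pow (norm_nonneg _), EuclideanSpace.norm_sq_eq]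
  refine ENNReal.ofReal_le_ofReal ((Finset.sum_le_sum fun i _ =>
    pow_le_pow_left₀ (norm_nonneg _) (hz i) 2).trans_eq ?_)
  simp

/-- Cauchy–Schwarz for the average, after which the cell of `x` is enlarged to the cube of
half-width `δ` around `x`. The domain of integration in `z` then no longer depends on `x`, so that
integration in `x` can be done first. -/
lemma enorm_sub_average_sq_le {δ : ℝ} (hδ : 0 < δ) {φ : EuclideanSpace ℝ (Fin n) → ℝ}
    (hφ : Continuous φ) (hs : HasCompactSupport φ) (x : EuclideanSpace ℝ (Fin n)) :
    ‖φ x - (δ ^ n)⁻¹ * ∫ y in gridCell δ (gridIndex δ x), φ y‖ₑ ^ 2 ≤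
      (ENNReal.ofReal δ ^ n)⁻¹ * ∫⁻ z in cube n δ, ‖φ (x + z) - φ x‖ₑ ^ 2 := by
  set Q := gridCell δ (gridIndex δ x) with hQ
  have hδn : 0 < δ ^ n := by positivity
  have hvol : volume Q = ENNReal.ofReal δ ^ n := volume_gridCell hδ _
  have hv0 : ENNReal.ofReal δ ^ n ≠ 0 := pow_ne_zero _ (by simpa using hδ)
  have hvt : ENNReal.ofReal δ ^ n ≠ ⊤ := ENNReal.pow_ne_top (by simp)
  have hi : IntegrableOn φ Q := (hφ.integrable_of_hasCompactSupport hs).integrableOn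
  have : IsFiniteMeasure (volume.restrict Q) := ⟨by simp [hvol, hvt.lt_top]⟩
  have e1 : φ x - (δ ^ n)⁻¹ * ∫ y in Q, φ y = -((δ ^ n)⁻¹ * ∫ y in Q, (φ y - φ x)) := by
    rw [integral_sub hi (integrable_const _), setIntegral_const, measureReal_def, hvol,
      ENNReal.toReal_pow, ENNReal.toReal_ofReal hδ.le, smul_eq_mul, mul_sub,
      inv_mul_cancel_left₀ hδn.ne']
    ring
  have e2 : ‖(δ ^ n)⁻¹‖ₑ = (ENNReal.ofReal δ ^ n)⁻¹ := by
    rw [← ofReal_norm, Real.norm_of_nonneg (by positivity), ENNReal.ofReal_inv_of_pos hδn,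
      ENNReal.ofReal_pow hδ.le]
  have h1 : ‖∫ y in Q, (φ y - φ x)‖ₑ ^ 2 ≤
      ENNReal.ofReal δ ^ n * ∫⁻ y in Q, ‖φ y - φ x‖ₑ ^ 2 := by
    have h2 := lintegral_mul_sq_le (volume.restrict Q) (m := fun _ => 1)
      (f := fun y => ‖φ y - φ x‖ₑ) aemeasurable_const (by fun_prop)
    simp only [one_mul, lintegral_const, Measure.restrict_apply_univ, hvol] at h2
    exact (pow_le_pow_left' (enorm_integral_le_lintegral_enorm _) 2).trans h2
  have h3 : ∫⁻ y in Q, ‖φ y - φ x‖ₑ ^ 2 ≤ ∫⁻ z in cube n δ, ‖φ (x + z) - φ x‖ₑ ^ 2 := by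
    rw [← lintegral_indicator (measurableSet_gridCell _ _),
      ← lintegral_indicator (measurableSet_cube _), ← lintegral_add_left_eq_self _ x]
    refine lintegral_mono fun z => ?_
    by_cases hz : x + z ∈ Q
    · have hz' : z ∈ cube n δ := fun i => by
        have := norm_sub_of_gridIndex_eq hδ (Eq.symm hz) i
        simpa using this
      rw [indicator_of_mem hz, indicator_of_mem hz']
    · rw [indicator_of_notMem hz]
      exact zero_le
  rw [e1, enorm_neg, enorm_mul, mul_pow, e2]
  calc (ENNReal.ofReal δ ^ n)⁻¹ ^ 2 * ‖∫ y in Q, (φ y - φ x)‖ₑ ^ 2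
      ≤ (ENNReal.ofReal δ ^ n)⁻¹ ^ 2 *
        (ENNReal.ofReal δ ^ n * ∫⁻ z in cube n δ, ‖φ (x + z) - φ x‖ₑ ^ 2) := by
        gcongr
        exact h1.trans (by gcongr)
    _ = _ := by
        rw [sq, mul_assoc, ← mul_assoc _ (ENNReal.ofReal δ ^ n),
          ENNReal.inv_mul_cancel hv0 hvt, one_mul]

/-- The constant is the ratio `(2δ)^n / δ^n` of the volumes of cube and cell, times the bound `n δ²`
for `‖z‖²` on the cube. -/
lemma lintegral_enorm_sub_average_sq_le {δ : ℝ} (hδ : 0 < δ)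
    {φ : EuclideanSpace ℝ (Fin n) → ℝ} (hφ : ContDiff ℝ 1 φ) (hs : HasCompactSupport φ) :
    ∫⁻ x, ‖φ x - (δ ^ n)⁻¹ * ∫ y in gridCell δ (gridIndex δ x), φ y‖ₑ ^ 2 ≤
      ENNReal.ofReal (2 ^ n * n * δ ^ 2) * ∫⁻ x, ‖fderiv ℝ φ x‖ₑ ^ 2 := by
  have hv0 : ENNReal.ofReal δ ^ n ≠ 0 := pow_ne_zero _ (by simpa using hδ)
  have hvt : ENNReal.ofReal δ ^ n ≠ ⊤ := ENNReal.pow_ne_top (by simp)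
  calc ∫⁻ x, ‖φ x - (δ ^ n)⁻¹ * ∫ y in gridCell δ (gridIndex δ x), φ y‖ₑ ^ 2
      ≤ ∫⁻ x, (ENNReal.ofReal δ ^ n)⁻¹ * ∫⁻ z in cube n δ, ‖φ (x + z) - φ x‖ₑ ^ 2 :=
        lintegral_mono fun x => enorm_sub_average_sq_le hδ hφ.continuous hs x
    _ = (ENNReal.ofReal δ ^ n)⁻¹ * ∫⁻ z in cube n δ, ∫⁻ x, ‖φ (x + z) - φ x‖ₑ ^ 2 := by
        rw [lintegral_const_mul' _ _ (ENNReal.inv_ne_top.2 hv0)]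
        congr 1
        refine lintegral_lintegral_swap (Continuous.measurable ?_).aemeasurable
        have := hφ.continuous
        exact ENNReal.continuous_pow 2 |>.comp (Continuous.enorm (by fun_prop))
    _ ≤ (ENNReal.ofReal δ ^ n)⁻¹ * ∫⁻ _ in cube n δ,
        ENNReal.ofReal (n * δ ^ 2) * ∫⁻ x, ‖fderiv ℝ φ x‖ₑ ^ 2 := by
        refine mul_le_mul_right (setLIntegral_mono' (measurableSet_cube δ) fun z hz => ?_) _
        exact (lintegral_enorm_translate_sub_sq_le hφ z).trans
          (mul_le_mul_left (enorm_sq_le_of_mem_cube hz) _)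
    _ = _ := by
        have hVV := ENNReal.inv_mul_cancel hv0 hvt
        rw [lintegral_const, Measure.restrict_apply_univ, volume_cube,
          ENNReal.ofReal_mul zero_le_two, mul_assoc (2 ^ n : ℝ),
          ENNReal.ofReal_mul (p := 2 ^ n) (by positivity), ENNReal.ofReal_pow zero_le_two]
        generalize ENNReal.ofReal δ = d at *
        generalize ∫⁻ x, ‖fderiv ℝ φ x‖ₑ ^ 2 = D
        generalize ENNReal.ofReal (n * δ ^ 2) = a
        generalize ENNReal.ofReal 2 = b
        calc (d ^ n)⁻¹ * (a * D * (b * d) ^ n) = ((d ^ n)⁻¹ * d ^ n) * (b ^ n * a * D) := by ring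
          _ = _ := by rw [hVV, one_mul]

end Grid

/-! ## The Rellich embedding of `H₀¹(Ω)` into `L²(Ω)` -/

noncomputable section

namespace EllipticOperator

variable {n : ℕ} (L : EllipticOperator n)

lemma volume_Ω_ne_top : volume L.Ω ≠ ⊤ := L.isBounded_Ω.measure_lt_top.ne

instance : IsFiniteMeasure (volume.restrict L.Ω) := ⟨by
  simpa using L.isBounded_Ω.measure_lt_top⟩

/-- The indicator function of a cell of the grid of mesh size `δ`, as an element of `L²(Ω)`. -/
def cellIndicator (δ : ℝ) (k : Fin n → ℤ) : L.L2 :=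
  indicatorConstLp 2 (measurableSet_gridCell δ k) (measure_ne_top (volume.restrict L.Ω) _) 1

/-- The averages over those cells of the grid of mesh size `δ` whose indices have entries in
`[-N, N]`. -/
def cellAverage (δ : ℝ) (N : ℕ) : L.L2 →L[ℝ] L.L2 :=
  ∑ k ∈ Fintype.piFinset fun _ : Fin n => Finset.Icc (-(N : ℤ)) N,
    (δ ^ n)⁻¹ • (innerSL ℝ (L.cellIndicator δ k)).smulRight (L.cellIndicator δ k)

lemma isCompactOperator_cellAverage (δ : ℝ) (N : ℕ) :
    IsCompactOperator (L.cellAverage δ N) := by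
  have h : L.cellAverage δ N ∈ compactOperator (RingHom.id ℝ) L.L2 L.L2 := by
    refine Submodule.sum_mem _ fun k _ => Submodule.smul_mem _ _ ?_
    change IsCompactOperator _
    have := (isCompactOperator_of_locallyCompactSpace_dom
      (innerSL ℝ (L.cellIndicator δ k))).clm_comp
      (ContinuousLinearMap.toSpanSingleton ℝ (L.cellIndicator δ k))
    exact this
  exact h

/-- The cells are disjoint, so of the finite sum only the cell containing `x` survives; `hN`
guarantees that it is among the summands. -/
lemma cellAverage_apply_ae {δ : ℝ} {N : ℕ} (hN : ∀ x ∈ L.Ω, ∀ i, |gridIndex δ x i| ≤ N) (f : L.L2) :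
    L.cellAverage δ N f =ᵐ[volume.restrict L.Ω] fun x =>
      (δ ^ n)⁻¹ * ∫ y in gridCell δ (gridIndex δ x), f y ∂volume.restrict L.Ω := by
  have e : L.cellAverage δ N f = ∑ k ∈ Fintype.piFinset fun _ : Fin n => Finset.Icc (-(N : ℤ)) N,
      ((δ ^ n)⁻¹ * ∫ y in gridCell δ k, f y ∂volume.restrict L.Ω) • L.cellIndicator δ k := by
    simp only [cellAverage, _root_.sum_apply, _root_.smul_apply,
      ContinuousLinearMap.smulRight_apply, innerSL_apply_apply, smul_smul]
    refine Finset.sum_congr rfl fun k _ => ?_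
    rw [cellIndicator, L2.inner_indicatorConstLp_one]
  rw [e]
  have h2 : ∀ k : Fin n → ℤ,
      (((δ ^ n)⁻¹ * ∫ y in gridCell δ k, f y ∂volume.restrict L.Ω) • L.cellIndicator δ k : L.L2)
        =ᵐ[volume.restrict L.Ω] fun x =>
        ((δ ^ n)⁻¹ * ∫ y in gridCell δ k, f y ∂volume.restrict L.Ω) *
          (gridCell δ k).indicator (fun _ => (1 : ℝ)) x := fun k => by
    filter_upwards [Lp.coeFn_smul
      ((δ ^ n)⁻¹ * ∫ y in gridCell δ k, f y ∂volume.restrict L.Ω) (L.cellIndicator δ k),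
      indicatorConstLp_coeFn (p := 2) (hs := measurableSet_gridCell δ k)
        (hμs := measure_ne_top (volume.restrict L.Ω) _) (c := (1 : ℝ))] with x hx1 hx2
    rw [hx1, Pi.smul_apply, smul_eq_mul, cellIndicator, hx2]
  filter_upwards [Lp.coeFn_finsetSum (Fintype.piFinset fun _ : Fin n => Finset.Icc (-(N : ℤ)) N)
    (fun k => (((δ ^ n)⁻¹ * ∫ y in gridCell δ k, f y ∂volume.restrict L.Ω) •
      L.cellIndicator δ k : L.L2)), ae_all_iff.2 h2,
      ae_restrict_mem L.isOpen_Ω.measurableSet] with x hx1 hx2 hx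
  rw [hx1, Finset.sum_apply, Finset.sum_eq_single (gridIndex δ x)]
  · rw [hx2, indicator_of_mem (show x ∈ gridCell δ (gridIndex δ x) from rfl), mul_one]
  · intro k _ hk
    have hk' : x ∉ gridCell δ k := fun h => hk (Eq.symm h)
    rw [hx2, indicator_of_notMem hk', mul_zero]
  · intro h
    refine absurd (Fintype.mem_piFinset.2 fun i => ?_) h
    exact Finset.mem_Icc.2 (abs_le.1 (hN x hx i))

lemma exists_gridIndex_le {δ : ℝ} (hδ : 0 < δ) :
    ∃ N : ℕ, ∀ x ∈ L.Ω, ∀ i, |gridIndex δ x i| ≤ N := by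
  obtain ⟨R, -, hR⟩ := L.isBounded_Ω.exists_pos_norm_le
  obtain ⟨N, hN⟩ := exists_nat_ge (R / δ + 1)
  refine ⟨N, fun x hx i => ?_⟩
  have h1 : |x i / δ| ≤ R / δ := by
    rw [abs_div, abs_of_pos hδ]
    gcongr
    exact (PiLp.norm_apply_le x i).trans (hR x hx)
  have h2 := abs_le.1 h1
  have h3 := Int.floor_le (x i / δ)
  have h4 := Int.lt_floor_add_one (x i / δ)
  have h5 : |(gridIndex δ x i : ℝ)| ≤ N := by
    rw [gridIndex, abs_le]
    constructor <;> linarith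
  exact_mod_cast h5

lemma enorm_sq_eq_lintegral {E : Type*} [NormedAddCommGroup E]
    (v : Lp E 2 (volume.restrict L.Ω)) : ‖v‖ₑ ^ 2 = ∫⁻ x in L.Ω, ‖v x‖ₑ ^ 2 := by
  rw [Lp.enorm_def, eLpNorm_eq_lintegral_rpow_enorm_toReal (by simp) (by simp)]
  simp only [ENNReal.toReal_ofNat, ENNReal.rpow_two, one_div]
  rw [← ENNReal.rpow_two, ← ENNReal.rpow_mul]
  norm_num

/-- By density it suffices to treat test functions. These extend by zero, so cells crossing the
boundary may be averaged over in full and the whole-space estimate applies. -/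
lemma norm_sub_cellAverage_le {δ : ℝ} (hδ : 0 < δ) {N : ℕ}
    (hN : ∀ x ∈ L.Ω, ∀ i, |gridIndex δ x i| ≤ N) {p : L.L2 × L.L2Vec} (hp : p ∈ L.H10) :
    ‖p.1 - L.cellAverage δ N p.1‖ ≤ √(2 ^ n * n * δ ^ 2) * ‖p.2‖ := by
  have hcl : IsClosed {p : L.L2 × L.L2Vec |
      ‖p.1 - L.cellAverage δ N p.1‖ ≤ √(2 ^ n * n * δ ^ 2) * ‖p.2‖} :=
    isClosed_le (by fun_prop) (by fun_prop)
  refine closure_minimal ?_ hcl hp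
  rintro q ⟨φ, h1, h2, h3, h4, h5⟩
  have hφ0 : ∀ x, x ∉ L.Ω → φ x = 0 := fun x hx =>
    image_eq_zero_of_notMem_tsupport fun h => hx (h3 h)
  have hcell : ∀ k, ∫ y in gridCell δ k, q.1 y ∂volume.restrict L.Ω = ∫ y in gridCell δ k, φ y := by
    intro k
    rw [integral_congr_ae (ae_restrict_of_ae h4),
      Measure.restrict_restrict (measurableSet_gridCell δ k),
      setIntegral_eq_of_subset_of_forall_sdiff_eq_zero (measurableSet_gridCell δ k)
        (inter_subset_left (t := L.Ω)) (fun x hx => hφ0 x fun h => hx.2 ⟨hx.1, h⟩)]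
  have e1 : ‖q.1 - L.cellAverage δ N q.1‖ₑ ^ 2 ≤
      ∫⁻ x, ‖φ x - (δ ^ n)⁻¹ * ∫ y in gridCell δ (gridIndex δ x), φ y‖ₑ ^ 2 := by
    rw [enorm_sq_eq_lintegral]
    refine le_trans (le_of_eq (lintegral_congr_ae ?_)) (setLIntegral_le_lintegral L.Ω _)
    filter_upwards [h4, L.cellAverage_apply_ae hN q.1, Lp.coeFn_sub q.1 (L.cellAverage δ N q.1)]
      with x hx1 hx2 hx3
    rw [hx3, Pi.sub_apply, hx1, hx2, hcell]
  have e2 : ‖q.2‖ₑ ^ 2 = ∫⁻ x, ‖fderiv ℝ φ x‖ₑ ^ 2 := by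
    have hind : (fun x => ‖fderiv ℝ φ x‖ₑ ^ 2) =
        L.Ω.indicator fun x => ‖fderiv ℝ φ x‖ₑ ^ 2 := by
      funext x
      by_cases hx : x ∈ L.Ω
      · rw [indicator_of_mem hx]
      · have : fderiv ℝ φ x = 0 :=
          image_eq_zero_of_notMem_tsupport fun h => hx (h3 (tsupport_fderiv_subset ℝ h))
        rw [indicator_of_notMem hx, ← ofReal_norm, this, norm_zero, ENNReal.ofReal_zero,
          zero_pow two_ne_zero]
    rw [enorm_sq_eq_lintegral, hind, lintegral_indicator L.isOpen_Ω.measurableSet]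
    refine lintegral_congr_ae ?_
    filter_upwards [h5] with x hx
    rw [hx, gradient, LinearIsometryEquiv.enorm_map]
  have e3 := e1.trans (lintegral_enorm_sub_average_sq_le hδ (h1.of_le (by simp)) h2)
  rw [← e2, ← ofReal_norm, ← ofReal_norm, ← ENNReal.ofReal_pow (norm_nonneg _),
    ← ENNReal.ofReal_pow (norm_nonneg _), ← ENNReal.ofReal_mul (by positivity),
    ENNReal.ofReal_le_ofReal_iff (by positivity)] at e3
  change ‖q.1 - L.cellAverage δ N q.1‖ ≤ √(2 ^ n * n * δ ^ 2) * ‖q.2‖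
  refine le_of_sq_le_sq ?_ (by positivity)
  rwa [mul_pow, Real.sq_sqrt (by positivity)]

end EllipticOperator

end

/-! ## Existence of an eigensystem -/

noncomputable section

namespace EllipticOperator

variable {n : ℕ} (L : EllipticOperator n)

lemma exists_testPair {φ : EuclideanSpace ℝ (Fin n) → ℝ} (h1 : ContDiff ℝ ∞ φ)
    (h2 : HasCompactSupport φ) (h3 : tsupport φ ⊆ L.Ω) :
    ∃ p ∈ L.testPairs, p.1 =ᵐ[volume.restrict L.Ω] φ := by
  have hg : Continuous fun x => gradient φ x :=
    (InnerProductSpace.toDual ℝ _).symm.continuous.comp (h1.continuous_fderiv (by simp))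
  have hgs : HasCompactSupport fun x => gradient φ x :=
    (h2.fderiv ℝ).comp_left (g := (InnerProductSpace.toDual ℝ _).symm) (map_zero _)
  have m1 : MemLp φ 2 (volume.restrict L.Ω) := h1.continuous.memLp_of_hasCompactSupport h2
  have m2 : MemLp (fun x => gradient φ x) 2 (volume.restrict L.Ω) :=
    hg.memLp_of_hasCompactSupport hgs
  exact ⟨(m1.toLp φ, m2.toLp _), ⟨φ, h1, h2, h3, m1.coeFn_toLp, m2.coeFn_toLp⟩, m1.coeFn_toLp⟩

/-! ### The bilinear form on the Hilbert space `H₀¹(Ω)`. -/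

/-- The pairs `(φ, ∇ φ)` with `φ ∈ C_c^∞(Ω)`, as a linear subspace. -/
def testSub : Submodule ℝ (L.L2 × L.L2Vec) where
  carrier := L.testPairs
  zero_mem' := by
    refine ⟨fun _ => 0, contDiff_const, HasCompactSupport.zero, by simp [tsupport], ?_, ?_⟩
    · exact Lp.coeFn_zero _ _ _
    · filter_upwards [Lp.coeFn_zero (EuclideanSpace ℝ (Fin n)) 2 (volume.restrict L.Ω)] with x hx
      rw [Prod.snd_zero, hx]
      simp [gradient]
  add_mem' := by
    rintro p q ⟨φ, h1, h2, h3, h4, h5⟩ ⟨ψ, k1, k2, k3, k4, k5⟩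
    refine ⟨φ + ψ, h1.add k1, h2.add k2, (tsupport_add φ ψ).trans (union_subset h3 k3), ?_, ?_⟩
    · filter_upwards [h4, k4, Lp.coeFn_add p.1 q.1] with x hx1 hx2 hx3
      rw [Prod.fst_add, hx3, Pi.add_apply, Pi.add_apply, hx1, hx2]
    · filter_upwards [h5, k5, Lp.coeFn_add p.2 q.2] with x hx1 hx2 hx3
      rw [Prod.snd_add, hx3, Pi.add_apply, hx1, hx2, gradient, gradient, gradient,
        fderiv_add (h1.differentiable (by simp) x) (k1.differentiable (by simp) x), map_add]
  smul_mem' := by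
    rintro a p ⟨φ, h1, h2, h3, h4, h5⟩
    refine ⟨a • φ, h1.const_smul a, h2.smul_left (f := fun _ => a), ?_, ?_, ?_⟩
    · exact (tsupport_smul_subset_right (fun _ => a) φ).trans h3
    · filter_upwards [h4, Lp.coeFn_smul a p.1] with x hx1 hx2
      rw [Prod.smul_fst, hx2, Pi.smul_apply, Pi.smul_apply, hx1]
    · filter_upwards [h5, Lp.coeFn_smul a p.2] with x hx1 hx2
      rw [Prod.smul_snd, hx2, Pi.smul_apply, hx1, gradient, gradient,
        fderiv_const_smul (h1.differentiable (by simp) x), map_smul]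

/-- `H₀¹(Ω)` as a closed subspace of the Hilbert space `L²(Ω) × L²(Ω; ℝⁿ)`. -/
def H10Sub : Submodule ℝ (WithLp 2 (L.L2 × L.L2Vec)) :=
  L.testSub.topologicalClosure.comap
    (WithLp.prodContinuousLinearEquiv 2 ℝ L.L2 L.L2Vec : _ →L[ℝ] _).toLinearMap

lemma mem_H10Sub_iff (p : WithLp 2 (L.L2 × L.L2Vec)) : p ∈ L.H10Sub ↔ (p.fst, p.snd) ∈ L.H10 :=
  Iff.rfl

instance : CompleteSpace L.H10Sub := by
  have : IsClosed (L.H10Sub : Set (WithLp 2 (L.L2 × L.L2Vec))) :=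
    L.testSub.isClosed_topologicalClosure.preimage
      (WithLp.prodContinuousLinearEquiv 2 ℝ L.L2 L.L2Vec).continuous
  exact this.completeSpace_coe

lemma form_add_left (p p' q : L.L2 × L.L2Vec) :
    L.form (p + p') q = L.form p q + L.form p' q := by
  rw [form, form, form, ← integral_add (L.integrable_form p q) (L.integrable_form p' q)]
  refine integral_congr_ae ?_
  filter_upwards [Lp.coeFn_add p.1 p'.1, Lp.coeFn_add p.2 p'.2] with x h1 h2
  simp only [Prod.fst_add, Prod.snd_add, h1, h2, Pi.add_apply, PiLp.add_apply, mul_add, add_mul,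
    Finset.sum_add_distrib]
  ring

lemma form_smul_left (a : ℝ) (p q : L.L2 × L.L2Vec) : L.form (a • p) q = a * L.form p q := by
  rw [form, form, ← integral_const_mul]
  refine integral_congr_ae ?_
  filter_upwards [Lp.coeFn_smul a p.1, Lp.coeFn_smul a p.2] with x h1 h2
  simp only [Prod.smul_fst, Prod.smul_snd, h1, h2, Pi.smul_apply, PiLp.smul_apply, smul_eq_mul,
    mul_add, Finset.mul_sum]
  congr 1
  · refine Finset.sum_congr rfl fun i _ => Finset.sum_congr rfl fun j _ => ?_
    ring
  · ring

lemma form_comm (p q : L.L2 × L.L2Vec) : L.form p q = L.form q p := by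
  rw [form, form]
  refine integral_congr_ae ?_
  filter_upwards [ae_restrict_mem L.isOpen_Ω.measurableSet] with x hx
  rw [Finset.sum_comm]
  congr 1
  · refine Finset.sum_congr rfl fun i _ => Finset.sum_congr rfl fun j _ => ?_
    rw [(L.symm_A x hx).apply]
    ring
  · ring

lemma exists_bound_A : ∃ M : ℝ, 0 ≤ M ∧ ∀ x ∈ L.Ω, ∀ i j, |L.A x i j| ≤ M := by
  have h : ∀ i j, ∃ M : ℝ, 0 ≤ M ∧ ∀ x ∈ L.Ω, |L.A x i j| ≤ M := fun i j => by
    obtain ⟨K, hK⟩ := L.lipschitz_A i j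
    obtain ⟨x₀, hx₀⟩ := L.nonempty_Ω
    obtain ⟨D, hD⟩ := Metric.isBounded_iff.1 L.isBounded_Ω
    have hD0 : 0 ≤ D := dist_nonneg.trans (hD hx₀ hx₀)
    refine ⟨‖L.A x₀ i j‖ + K * D, by positivity, fun x hx => ?_⟩
    have h1 := hK.dist_le_mul x hx x₀ hx₀
    have h2 := mul_le_mul_of_nonneg_left (hD hx hx₀) K.2
    have h3 := norm_le_norm_add_norm_sub' (L.A x i j) (L.A x₀ i j)
    rw [← dist_eq_norm] at h3
    exact h3.trans (by gcongr; exact h1.trans h2)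
  choose M hM0 hM using h
  refine ⟨∑ i, ∑ j, M i j, Finset.sum_nonneg fun i _ => Finset.sum_nonneg fun j _ => hM0 i j,
    fun x hx i j => (hM i j x hx).trans ?_⟩
  exact (Finset.single_le_sum (fun j _ => hM0 i j) (Finset.mem_univ j)).trans
    (Finset.single_le_sum (f := fun i => ∑ j, M i j)
      (fun i _ => Finset.sum_nonneg fun j _ => hM0 i j) (Finset.mem_univ i))

lemma integral_norm_mul_norm_le {E : Type*} [NormedAddCommGroup E] [InnerProductSpace ℝ E]
    (v w : Lp E 2 (volume.restrict L.Ω)) :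
    ∫ x in L.Ω, ‖v x‖ * ‖w x‖ ≤ ‖v‖ * ‖w‖ := by
  have h := integral_mul_norm_le_Lp_mul_Lq Real.HolderConjugate.two_two (μ := volume.restrict L.Ω)
    (f := v) (g := w) (by simpa using Lp.memLp v) (by simpa using Lp.memLp w)
  simp only [Real.rpow_two] at h
  rwa [← L.norm_sq_eq_setIntegral, ← L.norm_sq_eq_setIntegral, ← Real.sqrt_eq_rpow,
    ← Real.sqrt_eq_rpow, Real.sqrt_sq (norm_nonneg _), Real.sqrt_sq (norm_nonneg _)] at h

lemma integrable_norm_mul_norm {E : Type*} [NormedAddCommGroup E] [InnerProductSpace ℝ E]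
    (v w : Lp E 2 (volume.restrict L.Ω)) :
    IntegrableOn (fun x => ‖v x‖ * ‖w x‖) L.Ω :=
  (Lp.memLp v).norm.integrable_mul (Lp.memLp w).norm

lemma exists_abs_form_le : ∃ C : ℝ, 0 ≤ C ∧ ∀ p q : L.L2 × L.L2Vec,
    |L.form p q| ≤ C * (‖p.2‖ * ‖q.2‖ + ‖p.1‖ * ‖q.1‖) := by
  obtain ⟨M, hM0, hM⟩ := L.exists_bound_A
  set c₀ := (eLpNorm L.c ⊤ (volume.restrict L.Ω)).toReal with hc₀
  have hc0 : 0 ≤ c₀ := ENNReal.toReal_nonneg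
  have hc : ∀ᵐ x ∂volume.restrict L.Ω, ‖L.c x‖ ≤ c₀ := by
    filter_upwards [enorm_ae_le_eLpNormEssSup L.c (volume.restrict L.Ω)] with x hx
    rw [← toReal_enorm]
    exact ENNReal.toReal_mono L.memLp_c.2.ne (by simpa using hx)
  set C := (n : ℝ) * n * M + c₀ with hC
  have hCM : (n : ℝ) * n * M ≤ C := by linarith
  have hCc : c₀ ≤ C := by
    have : 0 ≤ (n : ℝ) * n * M := by positivity
    linarith
  refine ⟨C, by positivity, fun p q => ?_⟩
  have i2 := L.integrable_norm_mul_norm p.2 q.2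
  have i1 := L.integrable_norm_mul_norm p.1 q.1
  have key : ∀ᵐ x ∂volume.restrict L.Ω,
      ‖(∑ i, ∑ j, L.A x i j * (p.2 x) j * (q.2 x) i) + L.c x * p.1 x * q.1 x‖ ≤
        C * (‖p.2 x‖ * ‖q.2 x‖ + ‖p.1 x‖ * ‖q.1 x‖) := by
    filter_upwards [ae_restrict_mem L.isOpen_Ω.measurableSet, hc] with x hx hcx
    have h1 : ‖∑ i, ∑ j, L.A x i j * (p.2 x) j * (q.2 x) i‖ ≤
        (n : ℝ) * n * M * (‖p.2 x‖ * ‖q.2 x‖) := by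
      have : ∀ i j, ‖L.A x i j * (p.2 x) j * (q.2 x) i‖ ≤ M * (‖p.2 x‖ * ‖q.2 x‖) :=
        fun i j => by
        rw [norm_mul, norm_mul, mul_assoc]
        gcongr
        · exact hM x hx i j
        · exact PiLp.norm_apply_le _ _
        · exact PiLp.norm_apply_le _ _
      refine (norm_sum_le _ _).trans ((Finset.sum_le_sum fun i _ => (norm_sum_le _ _).trans
        (Finset.sum_le_sum fun j _ => this i j)).trans_eq ?_)
      simp
      ring
    have h2 : ‖L.c x * p.1 x * q.1 x‖ ≤ c₀ * (‖p.1 x‖ * ‖q.1 x‖) := by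
      rw [norm_mul, norm_mul, mul_assoc]
      gcongr
    refine (norm_add_le _ _).trans ((add_le_add h1 h2).trans ?_)
    rw [mul_add]
    gcongr
  rw [form, ← Real.norm_eq_abs]
  refine (norm_integral_le_of_norm_le ((i2.add i1).const_mul C) key).trans ?_
  simp only [Pi.add_apply]
  rw [integral_const_mul, integral_add i2 i1]
  gcongr
  · exact L.integral_norm_mul_norm_le _ _
  · exact L.integral_norm_mul_norm_le _ _

/-- The form of `𝓛` as a bilinear map on `H₀¹(Ω)`. -/
def formBilin : L.H10Sub →ₗ[ℝ] L.H10Sub →ₗ[ℝ] ℝ :=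
  LinearMap.mk₂ ℝ (fun p q => L.form (p.1.fst, p.1.snd) (q.1.fst, q.1.snd))
    (fun p p' q => L.form_add_left _ _ _) (fun a p q => L.form_smul_left _ _ _)
    (fun p q q' => by
      rw [form_comm, L.form_comm _ (q.1.fst, q.1.snd), L.form_comm _ (q'.1.fst, q'.1.snd)]
      exact L.form_add_left _ _ _)
    (fun a p q => by
      rw [form_comm, L.form_comm _ (q.1.fst, q.1.snd)]
      exact L.form_smul_left _ _ _)

lemma exists_norm_formBilin_le : ∃ C : ℝ, ∀ p q : L.H10Sub,
    ‖L.formBilin p q‖ ≤ C * ‖p‖ * ‖q‖ := by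
  obtain ⟨C, hC0, hC⟩ := L.exists_abs_form_le
  refine ⟨2 * C, fun p q => (hC _ _).trans ?_⟩
  have h1 : ∀ p : L.H10Sub, ‖p.1.fst‖ ≤ ‖p‖ := fun p => WithLp.norm_fst_le L.L2 p.1
  have h2 : ∀ p : L.H10Sub, ‖p.1.snd‖ ≤ ‖p‖ := fun p => WithLp.norm_snd_le L.L2 p.1
  have h3 := mul_le_mul (h1 p) (h1 q) (norm_nonneg _) (norm_nonneg _)
  have h4 := mul_le_mul (h2 p) (h2 q) (norm_nonneg _) (norm_nonneg _)
  calc C * (‖p.1.snd‖ * ‖q.1.snd‖ + ‖p.1.fst‖ * ‖q.1.fst‖)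
      ≤ C * (‖p‖ * ‖q‖ + ‖p‖ * ‖q‖) := by gcongr
    _ = _ := by ring

/-- The form of `𝓛` as a bounded bilinear map on `H₀¹(Ω)`. -/
def formCLM : L.H10Sub →L[ℝ] L.H10Sub →L[ℝ] ℝ :=
  L.formBilin.mkContinuous₂ L.exists_norm_formBilin_le.choose
    L.exists_norm_formBilin_le.choose_spec

lemma formCLM_apply (p q : L.H10Sub) :
    L.formCLM p q = L.form (p.1.fst, p.1.snd) (q.1.fst, q.1.snd) := rfl

lemma exists_le_form : ∃ α : ℝ, 0 < α ∧ ∀ p : L.L2 × L.L2Vec, α * ‖p.2‖ ^ 2 ≤ L.form p p := by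
  obtain ⟨α, hα0, hα⟩ := L.posDef_A
  refine ⟨α, hα0, fun p => ?_⟩
  rw [norm_sq_eq_setIntegral, ← integral_const_mul]
  refine integral_mono_ae ?_ (L.integrable_form p p) ?_
  · exact ((memLp_two_iff_integrable_sq_norm (Lp.memLp p.2).1).1 (Lp.memLp p.2)).const_mul α
  · filter_upwards [ae_restrict_mem L.isOpen_Ω.measurableSet, L.nonneg_c] with x hx hc
    have := hα x hx (p.2 x)
    have h0 : 0 ≤ L.c x * p.1 x * p.1 x := by
      rw [mul_assoc]
      exact mul_nonneg hc (mul_self_nonneg _)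
    linarith

lemma isCoercive_formCLM : IsCoercive L.formCLM := by
  obtain ⟨K, hK0, hK⟩ := L.poincare
  obtain ⟨α, hα0, hα⟩ := L.exists_le_form
  -- Poincaré's inequality bounds the full squared norm by `(K² + 1)` times that of the gradient.
  refine ⟨α / (K ^ 2 + 1), by positivity, fun p => ?_⟩
  have h1 : ‖p.1.fst‖ ^ 2 ≤ K ^ 2 * ‖p.1.snd‖ ^ 2 := by
    rw [← mul_pow]
    exact pow_le_pow_left₀ (norm_nonneg _) (hK _ ((L.mem_H10Sub_iff _).1 p.2)) 2
  have h2 : ‖p‖ ^ 2 = ‖p.1.fst‖ ^ 2 + ‖p.1.snd‖ ^ 2 := WithLp.prod_norm_sq_eq_of_L2 p.1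
  rw [formCLM_apply]
  refine le_trans ?_ (hα _)
  rw [mul_assoc, ← sq, h2, div_mul_eq_mul_div, div_le_iff₀ (by positivity)]
  nlinarith

/-! ### Compactness of the embedding and the inverse of `𝓛`. -/

/-- The embedding `H₀¹(Ω) → L²(Ω)`. -/
def H10Fst : L.H10Sub →L[ℝ] L.L2 := (WithLp.fstL 2 ℝ L.L2 L.L2Vec).comp L.H10Sub.subtypeL

/-- The cell averages have finite rank and approximate the embedding in operator norm with error at
most a constant times the mesh size. -/
lemma isCompactOperator_H10Fst : IsCompactOperator L.H10Fst := by
  have hδ : ∀ m : ℕ, (0 : ℝ) < 1 / ((m : ℝ) + 1) := fun m => by positivity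
  choose N hN using fun m : ℕ => L.exists_gridIndex_le (hδ m)
  refine isCompactOperator_of_tendsto (l := atTop)
    (F := fun m : ℕ => (L.cellAverage (1 / ((m : ℝ) + 1)) (N m)).comp L.H10Fst) ?_
    (.of_forall fun m => (L.isCompactOperator_cellAverage _ _).comp_clm L.H10Fst)
  refine (tendsto_iff_norm_sub_tendsto_zero (E := L.H10Sub →L[ℝ] L.L2)).2 ?_
  have hlim : Tendsto (fun m : ℕ => √(2 ^ n * n) * (1 / ((m : ℝ) + 1))) atTop (𝓝 0) := by
    simpa using tendsto_one_div_add_atTop_nhds_zero_nat.const_mul (√(2 ^ n * n))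
  refine squeeze_zero (fun m => norm_nonneg (E := L.H10Sub →L[ℝ] L.L2) _) (fun m => ?_) hlim
  refine ContinuousLinearMap.opNorm_le_bound _ (by positivity) fun p => ?_
  have h1 := L.norm_sub_cellAverage_le (hδ m) (hN m) ((L.mem_H10Sub_iff _).1 p.2)
  rw [Real.sqrt_mul (by positivity), Real.sqrt_sq (hδ m).le] at h1
  rw [← norm_neg]
  have h2 : ‖p.1.snd‖ ≤ ‖p‖ := WithLp.norm_snd_le L.L2 p.1
  refine le_trans (le_of_eq ?_) (h1.trans (by gcongr))
  congr 1
  change -(L.cellAverage _ _ p.1.fst - p.1.fst) = _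
  rw [neg_sub]

/-- The solution operator of `𝓛 w = f` in `Ω`, `w = 0` on `∂Ω`. -/
def solve : L.L2 →L[ℝ] L.H10Sub :=
  (L.isCoercive_formCLM.continuousLinearEquivOfBilin.symm : L.H10Sub →L[ℝ] L.H10Sub).comp
    (ContinuousLinearMap.adjoint L.H10Fst)

/-- Lax–Milgram: the adjoint of the embedding is the Riesz representative of the functional `q ↦ (f,
q)`, and the inverse of the operator of the form is applied to it. -/
lemma formCLM_solve (f : L.L2) (q : L.H10Sub) :
    L.formCLM (L.solve f) q = inner ℝ f (L.H10Fst q) := by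
  rw [← L.isCoercive_formCLM.continuousLinearEquivOfBilin_apply, solve,
    ContinuousLinearMap.comp_apply, ContinuousLinearEquiv.coe_coe,
    ContinuousLinearEquiv.apply_symm_apply, ContinuousLinearMap.adjoint_inner_left]

/-- The inverse of `𝓛` as an operator in `L²(Ω)`. -/
def invOp : L.L2 →L[ℝ] L.L2 := L.H10Fst.comp L.solve

lemma isCompactOperator_invOp : IsCompactOperator L.invOp :=
  L.isCompactOperator_H10Fst.comp_clm L.solve

lemma isSymmetric_invOp : (L.invOp : L.L2 →ₗ[ℝ] L.L2).IsSymmetric := fun f g => by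
  change inner ℝ (L.H10Fst (L.solve f)) g = inner ℝ f (L.H10Fst (L.solve g))
  rw [real_inner_comm, ← formCLM_solve, ← formCLM_solve, formCLM_apply, formCLM_apply, form_comm]

/-- Testing the equation with its solution gives energy zero, hence solution zero by coercivity.
Then `f` is orthogonal to all test functions. This excludes the eigenvalue `0` of the inverse, so
reciprocals may be taken. -/
lemma eq_zero_of_invOp_eq_zero {f : L.L2} (hf : L.invOp f = 0) : f = 0 := by
  have h1 : L.formCLM (L.solve f) (L.solve f) = 0 := by
    rw [formCLM_solve]
    change inner ℝ f (L.invOp f) = 0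
    rw [hf, inner_zero_right]
  obtain ⟨c, hc0, hc⟩ := L.isCoercive_formCLM
  have h2 : L.solve f = 0 := by
    have := hc (L.solve f)
    rw [h1] at this
    have h3 : ‖L.solve f‖ * ‖L.solve f‖ ≤ 0 := by
      by_contra h
      push Not at h
      nlinarith
    exact norm_eq_zero.1 (mul_self_eq_zero.1 (le_antisymm h3 (mul_self_nonneg _)))
  have h4 : ∀ q : L.H10Sub, inner ℝ f (L.H10Fst q) = 0 := fun q => by
    rw [← formCLM_solve, h2]
    simp
  have hloc : LocallyIntegrableOn f L.Ω := by
    have : IntegrableOn f L.Ω := (Lp.memLp f).integrable (by norm_num)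
    exact this.locallyIntegrableOn
  have h5 := L.isOpen_Ω.ae_eq_zero_of_integral_contDiff_smul_eq_zero hloc fun φ k1 k2 k3 => by
    obtain ⟨p, hp, hpφ⟩ := L.exists_testPair k1 k2 k3
    have h6 := h4 ⟨WithLp.toLp 2 p, subset_closure hp⟩
    change inner ℝ f p.1 = 0 at h6
    rw [L2.inner_def] at h6
    rw [← setIntegral_eq_integral_of_forall_compl_eq_zero (s := L.Ω), ← h6]
    · refine integral_congr_ae ?_
      filter_upwards [hpφ] with x hx
      simp [hx]
    · intro x hx
      rw [image_eq_zero_of_notMem_tsupport fun h => hx (k3 h), zero_smul]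
  refine Lp.ext ?_
  have h7 := (ae_restrict_iff' L.isOpen_Ω.measurableSet).2 h5
  filter_upwards [h7, Lp.coeFn_zero ℝ 2 (volume.restrict L.Ω)] with x hx hx0
  rw [hx, hx0, Pi.zero_apply]

lemma isEigenpair_of_invOp {κ : ℝ} {φ : L.L2} (hφ : φ ≠ 0) (h : L.invOp φ = κ • φ) :
    L.IsEigenpair κ⁻¹ φ := by
  have hκ : κ ≠ 0 := by
    rintro rfl
    exact hφ (L.eq_zero_of_invOp_eq_zero (by rw [h, zero_smul]))
  have h1 : (κ⁻¹ • L.solve φ).1.fst = φ := by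
    change κ⁻¹ • L.invOp φ = φ
    rw [h, smul_smul, inv_mul_cancel₀ hκ, one_smul]
  refine ⟨hφ, (κ⁻¹ • L.solve φ).1.snd, ?_, fun q hq => ?_⟩
  · have := (L.mem_H10Sub_iff _).1 (κ⁻¹ • L.solve φ).2
    rwa [h1] at this
  · have h2 := L.formCLM_solve φ ⟨WithLp.toLp 2 q, hq⟩
    have h3 : L.formCLM (κ⁻¹ • L.solve φ) ⟨WithLp.toLp 2 q, hq⟩ =
        κ⁻¹ * inner ℝ φ q.1 := by
      rw [map_smul, _root_.smul_apply, h2, smul_eq_mul]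
      rfl
    rw [formCLM_apply, h1] at h3
    rw [L2.inner_def] at h3
    refine h3.trans ?_
    congr 1
    refine integral_congr_ae (.of_forall fun x => ?_)
    simp [mul_comm]

end EllipticOperator

end

/-! ### An orthonormal eigenbasis indexed by `ℕ`. -/

noncomputable section

/-- Orthonormal vectors have mutual distance `√2`, so the balls of radius `1/2` around them are
disjoint open sets in a separable space. -/
lemma Orthonormal.countable_index {ι E : Type*} [NormedAddCommGroup E] [InnerProductSpace ℝ E]
    [TopologicalSpace.SeparableSpace E] {v : ι → E} (hv : Orthonormal ℝ v) : Countable ι := by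
  have hd : ∀ i j, i ≠ j → 1 < dist (v i) (v j) := fun i j hij => by
    have h : ‖v i - v j‖ ^ 2 = 2 := by
      rw [norm_sub_sq_real, hv.1 i, hv.1 j, hv.2 hij]
      norm_num
    rw [dist_eq_norm]
    nlinarith [norm_nonneg (v i - v j)]
  have hdisj : (univ : Set ι).PairwiseDisjoint fun i => Metric.ball (v i) (1 / 2) := by
    intro i _ j _ hij
    refine Metric.ball_disjoint_ball ?_
    linarith [hd i j hij]
  exact countable_univ_iff.1 (hdisj.countable_of_isOpen (fun i _ => Metric.isOpen_ball)
    fun i _ => ⟨v i, Metric.mem_ball_self (by norm_num)⟩)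

namespace EllipticOperator

variable {n : ℕ} (L : EllipticOperator n)

/-- The indicators of infinitely many disjoint open shells around a point of `Ω` are orthogonal and
nonzero. The eigenbasis is therefore infinite and can be indexed by `ℕ`. -/
lemma not_finiteDimensional_L2 : ¬ FiniteDimensional ℝ L.L2 := by
  intro hfin
  obtain ⟨x₀, hx₀⟩ := L.nonempty_Ω
  obtain ⟨r, hr0, hr⟩ := Metric.isOpen_iff.1 L.isOpen_Ω x₀ hx₀
  set S : ℕ → Set (EuclideanSpace ℝ (Fin n)) := fun k =>
    {x | r / ((k : ℝ) + 2) < ‖x - x₀‖ ∧ ‖x - x₀‖ < r / ((k : ℝ) + 1)} with hS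
  have hSo : ∀ k, IsOpen (S k) := fun k =>
    IsOpen.inter (s := {x | r / ((k : ℝ) + 2) < ‖x - x₀‖}) (t := {x | ‖x - x₀‖ < r / ((k : ℝ) + 1)})
      (isOpen_lt continuous_const (by fun_prop)) (isOpen_lt (by fun_prop) continuous_const)
  have hSΩ : ∀ k, S k ⊆ L.Ω := fun k x hx => hr (by
    rw [mem_ball_iff_norm]
    exact hx.2.trans_le (div_le_self hr0.le (by linarith [(k.cast_nonneg : (0 : ℝ) ≤ k)])))
  have hSne : ∀ k, (S k).Nonempty := fun k => by
    have hk : (0 : ℝ) ≤ k := k.cast_nonneg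
    obtain ⟨ρ, h1, h2⟩ := exists_between
      (div_lt_div_of_pos_left hr0 (by linarith) (by linarith) : r / ((k : ℝ) + 2) < r / (k + 1))
    have hρ : 0 < ρ := lt_trans (by positivity) h1
    refine ⟨x₀ + EuclideanSpace.single ⟨0, L.dim_pos⟩ ρ, ?_⟩
    simp only [hS, Set.mem_ofPred_eq, add_sub_cancel_left, PiLp.norm_single,
      Real.norm_of_nonneg hρ.le]
    exact ⟨h1, h2⟩
  have hdisj : ∀ k l, k < l → S k ∩ S l = ∅ := fun k l hkl => by
    ext x
    simp only [mem_inter_iff, mem_empty_iff_false, iff_false, not_and]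
    intro hk hl
    have h1 : (k : ℝ) + 1 ≤ l := by exact_mod_cast hkl
    have h2 : r / ((l : ℝ) + 1) ≤ r / ((k : ℝ) + 2) :=
      div_le_div_of_nonneg_left hr0.le (by positivity) (by linarith)
    linarith [hk.1, hl.2]
  set v : ℕ → L.L2 := fun k => indicatorConstLp 2 (hSo k).measurableSet
    (measure_ne_top (volume.restrict L.Ω) _) 1 with hv
  have hinner : ∀ k l, inner ℝ (v k) (v l) = (volume.restrict L.Ω).real (S k ∩ S l) := fun k l => by
    simp only [hv]
    rw [L2.inner_indicatorConstLp_one, setIntegral_congr_ae (g := (S l).indicator fun _ => (1 : ℝ))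
      (hSo k).measurableSet, setIntegral_indicator (hSo l).measurableSet]
    · simp
    · filter_upwards [indicatorConstLp_coeFn (p := 2) (hs := (hSo l).measurableSet)
        (hμs := measure_ne_top (volume.restrict L.Ω) _) (c := (1 : ℝ))] with x hx _
      exact hx
  have hli : LinearIndependent ℝ v := by
    refine linearIndependent_of_ne_zero_of_inner_eq_zero (fun k h0 => ?_) fun k l hkl => ?_
    · have h1 := hinner k k
      rw [h0, inner_zero_left, inter_self, measureReal_restrict_apply (hSo k).measurableSet,
        inter_eq_left.2 (hSΩ k)] at h1
      have h2 : 0 < volume (S k) := (hSo k).measure_pos volume (hSne k)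
      have h3 : volume (S k) ≠ ⊤ := measure_ne_top_of_subset (hSΩ k) L.volume_Ω_ne_top
      exact (ENNReal.toReal_pos h2.ne' h3).ne h1
    · change inner ℝ (v k) (v l) = 0
      rw [hinner]
      rcases lt_or_gt_of_ne hkl with h | h
      · rw [hdisj k l h, measureReal_empty]
      · rw [inter_comm, hdisj l k h, measureReal_empty]
  exact Infinite.not_finite (α := ℕ) hli.finite

/-- The eigenfunctions of the operator `𝓛` form an orthonormal basis of `L²(Ω)`. -/
theorem nonempty_eigenSystem : Nonempty L.EigenSystem := by
  set T : Module.End ℝ L.L2 := (L.invOp : L.L2 →ₗ[ℝ] L.L2) with hT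
  have hcl : ∀ μ : ℝ, IsClosed (Module.End.eigenspace T μ : Set L.L2) := fun μ => by
    have : (Module.End.eigenspace T μ : Set L.L2) = {f | L.invOp f = μ • f} := by
      ext f
      exact Module.End.mem_eigenspace_iff
    rw [this]
    exact isClosed_eq L.invOp.continuous (continuous_const_smul μ)
  have hcompl : ∀ μ : ℝ, CompleteSpace (Module.End.eigenspace T μ) := fun μ =>
    (hcl μ).completeSpace_coe
  -- One Hilbert basis for each real `μ`; where the eigenspace is trivial, it is empty and
  -- contributes nothing.
  choose w b hb using fun μ : ℝ => exists_hilbertBasis ℝ (Module.End.eigenspace T μ)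
  set v : (Σ μ : ℝ, w μ) → L.L2 := fun a => ((b a.1 a.2 : Module.End.eigenspace T a.1) : L.L2)
    with hv
  have hvo : Orthonormal ℝ v :=
    L.isSymmetric_invOp.orthogonalFamily_eigenspaces.orthonormal_sigma_orthonormal
      (v_family := fun μ i => b μ i) fun μ => (b μ).orthonormal
  -- Orthogonality passes from a basis to the closure of its span, hence to every eigenspace; the
  -- spectral theorem for compact symmetric operators finishes.
  have hspan : ∀ x : L.L2, (∀ a, inner ℝ (v a) x = 0) → x = 0 := by
    intro x hx
    have hmem : x ∈ (⨆ μ, Module.End.eigenspace T μ)ᗮ := by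
      rw [← Submodule.iInf_orthogonal, Submodule.mem_iInf]
      intro μ y hy
      have hd := (b μ).dense_span
      have hcont : Continuous fun y : Module.End.eigenspace T μ => inner ℝ (y : L.L2) x := by
        fun_prop
      have hclosed : IsClosed {y : Module.End.eigenspace T μ | inner ℝ (y : L.L2) x = 0} :=
        isClosed_eq hcont continuous_const
      have hsub : (Submodule.span ℝ (range (b μ)) : Set (Module.End.eigenspace T μ)) ⊆
          {y | inner ℝ (y : L.L2) x = 0} := by
        intro y hy
        induction hy using Submodule.span_induction with
        | mem y hy =>
          obtain ⟨i, rfl⟩ := hy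
          exact hx ⟨μ, i⟩
        | zero => simp
        | add y z _ _ hy hz =>
          simp only [Set.mem_ofPred_eq, Submodule.coe_add, inner_add_left] at *
          rw [hy, hz, add_zero]
        | smul a y _ hy =>
          simp only [Set.mem_ofPred_eq, Submodule.coe_smul, real_inner_smul_left] at *
          rw [hy, mul_zero]
      have := closure_minimal hsub hclosed
        (show (⟨y, hy⟩ : Module.End.eigenspace T μ) ∈ closure _ by
          have h1 : (⟨y, hy⟩ : Module.End.eigenspace T μ) ∈
              (Submodule.span ℝ (range (b μ))).topologicalClosure := by
            rw [hd]; trivial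
          exact h1)
      exact this
    rw [ContinuousLinearMap.orthogonalComplement_iSup_eigenspaces_eq_bot
      L.isCompactOperator_invOp L.isSymmetric_invOp] at hmem
    exact (Submodule.mem_bot ℝ).1 hmem
  have : Fact ((2 : ℝ≥0∞) ≠ ⊤) := ⟨by simp⟩
  have hcount : Countable (Σ μ : ℝ, w μ) := hvo.countable_index
  have hinf : Infinite (Σ μ : ℝ, w μ) := by
    by_contra h
    rw [not_infinite_iff_finite] at h
    refine L.not_finiteDimensional_L2 ?_
    have := Fintype.ofFinite (Σ μ : ℝ, w μ)
    have htop : Submodule.span ℝ (range v) = ⊤ := by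
      have : FiniteDimensional ℝ (Submodule.span ℝ (range v)) :=
        FiniteDimensional.span_of_finite ℝ (finite_range v)
      rw [← Submodule.orthogonal_eq_bot_iff, Submodule.eq_bot_iff]
      intro x hx
      exact hspan x fun a => hx _ (Submodule.subset_span ⟨a, rfl⟩)
    exact Module.finite_def.2 (htop ▸ Submodule.fg_span (finite_range v))
  obtain ⟨e⟩ : Nonempty (ℕ ≃ Σ μ : ℝ, w μ) := by
    obtain ⟨d⟩ := nonempty_denumerable (Σ μ : ℝ, w μ)
    exact ⟨(Denumerable.eqv _).symm⟩
  have hveo : Orthonormal ℝ (v ∘ e) := hvo.comp e e.injective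
  have hbot : (Submodule.span ℝ (range (v ∘ e)))ᗮ = ⊥ := by
    rw [Submodule.eq_bot_iff]
    intro x hx
    refine hspan x fun a => hx _ (Submodule.subset_span ⟨e.symm a, by simp⟩)
  refine ⟨⟨fun k => (e k).1⁻¹, HilbertBasis.mkOfOrthogonalEqBot hveo hbot, fun k => ?_⟩⟩
  rw [HilbertBasis.coe_mkOfOrthogonalEqBot]
  refine L.isEigenpair_of_invOp ?_ ?_
  · exact hveo.ne_zero k
  · exact Module.End.mem_eigenspace_iff.1 (b (e k).1 (e k).2).2

end EllipticOperator

end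

/-! ## Diagonal operators and convolutions with diagonal kernels -/

noncomputable section

namespace EllipticOperator.EigenSystem

variable {n : ℕ} {L : EllipticOperator n} (S : L.EigenSystem)

lemma ext_coeff {v w : L.L2} (h : ∀ k, S.coeff v k = S.coeff w k) : v = w := by
  apply S.φ.repr.injective
  ext k
  simpa [coeff, HilbertBasis.repr_apply_apply] using h k

lemma hasSum_coeff_sq (w : L.L2) : HasSum (fun k => S.coeff w k ^ 2) (‖w‖ ^ 2) := by
  have := S.φ.hasSum_inner_mul_inner w w
  rw [real_inner_self_eq_norm_sq] at this
  simpa only [coeff, pow_two, real_inner_comm] using this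

lemma coeff_sub (v w : L.L2) (k : ℕ) : S.coeff (v - w) k = S.coeff v k - S.coeff w k :=
  inner_sub_right _ _ _

lemma coeff_neg (w : L.L2) (k : ℕ) : S.coeff (-w) k = -S.coeff w k :=
  inner_neg_right _ _

lemma coeff_φ (k j : ℕ) : S.coeff (S.φ k) j = if j = k then 1 else 0 := by
  rw [coeff, orthonormal_iff_ite.1 S.φ.orthonormal]

/-- The coefficient functional `w ↦ w_k`. -/
def coeffL (k : ℕ) : L.L2 →L[ℝ] ℝ := innerSL ℝ (S.φ k)

lemma coeffL_apply (k : ℕ) (w : L.L2) : S.coeffL k w = S.coeff w k := rfl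

lemma exists_hasSum_smul {x : ℕ → ℝ} (hx : Summable fun k => x k ^ 2) :
    ∃ w : L.L2, HasSum (fun k => x k • S.φ k) w ∧ ∀ k, S.coeff w k = x k := by
  have hm : Memℓp x 2 := by
    rw [memℓp_gen_iff (by norm_num)]
    simpa using hx
  refine ⟨S.φ.repr.symm ⟨x, hm⟩, S.φ.hasSum_repr_symm ⟨x, hm⟩, fun k => ?_⟩
  rw [coeff, ← HilbertBasis.repr_apply_apply, LinearIsometryEquiv.apply_symm_apply]

/-- The diagonal operator `w ↦ ∑_k a_k w_k φ_k`. -/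
def diag (a : ℕ → ℝ) (w : L.L2) : L.L2 := ∑' k, (a k * S.coeff w k) • S.φ k

variable {S}

lemma hasSum_diag {a : ℕ → ℝ} {w : L.L2} (h : Summable fun k => (a k * S.coeff w k) ^ 2) :
    HasSum (fun k => (a k * S.coeff w k) • S.φ k) (S.diag a w) := by
  obtain ⟨v, hv, -⟩ := S.exists_hasSum_smul h
  exact hv.summable.hasSum

lemma coeff_diag_of_summable {a : ℕ → ℝ} {w : L.L2}
    (h : Summable fun k => (a k * S.coeff w k) ^ 2) (k : ℕ) :
    S.coeff (S.diag a w) k = a k * S.coeff w k := by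
  obtain ⟨v, hv, hc⟩ := S.exists_hasSum_smul h
  rw [diag, hv.tsum_eq, hc]

lemma summable_diag {a : ℕ → ℝ} {M : ℝ} (ha : ∀ k, |a k| ≤ M) (w : L.L2) :
    Summable fun k => (a k * S.coeff w k) ^ 2 := by
  refine Summable.of_nonneg_of_le (fun k => sq_nonneg _) (fun k => ?_)
    ((S.hasSum_coeff_sq w).summable.mul_left (M ^ 2))
  rw [mul_pow]
  gcongr ?_ * _
  exact sq_le_sq' (by linarith [abs_le.1 (ha k)]) (abs_le.1 (ha k)).2

lemma coeff_diag {a : ℕ → ℝ} {M : ℝ} (ha : ∀ k, |a k| ≤ M) (w : L.L2) (k : ℕ) :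
    S.coeff (S.diag a w) k = a k * S.coeff w k :=
  coeff_diag_of_summable (summable_diag ha w) k

lemma norm_diag_le {a : ℕ → ℝ} {M : ℝ} (ha : ∀ k, |a k| ≤ M) (w : L.L2) :
    ‖S.diag a w‖ ≤ M * ‖w‖ := by
  have hM : 0 ≤ M := (abs_nonneg _).trans (ha 0)
  refine le_of_sq_le_sq ?_ (by positivity)
  rw [mul_pow, ← (S.hasSum_coeff_sq _).tsum_eq, ← (S.hasSum_coeff_sq w).tsum_eq, ← tsum_mul_left]
  refine (S.hasSum_coeff_sq _).summable.tsum_le_tsum (fun k => ?_)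
    ((S.hasSum_coeff_sq w).summable.mul_left _)
  rw [coeff_diag ha, mul_pow]
  gcongr ?_ * _
  exact sq_le_sq' (by linarith [abs_le.1 (ha k)]) (abs_le.1 (ha k)).2

/-- Dominated convergence in `k`: convergence of each multiplier with a uniform bound gives strong
convergence of the operators. No uniformity in `k` of the convergence is needed. -/
lemma tendsto_diag {ι : Type*} {l : Filter ι} {a : ι → ℕ → ℝ} {a₀ : ℕ → ℝ} {M : ℝ}
    (ha : ∀ᶠ i in l, ∀ k, |a i k| ≤ M) (ha₀ : ∀ k, |a₀ k| ≤ M)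
    (h : ∀ k, Tendsto (fun i => a i k) l (𝓝 (a₀ k))) (w : L.L2) :
    Tendsto (fun i => S.diag (a i) w) l (𝓝 (S.diag a₀ w)) := by
  have hM : 0 ≤ M := (abs_nonneg _).trans (ha₀ 0)
  rw [tendsto_iff_norm_sub_tendsto_zero]
  have hsq : Tendsto (fun i => ∑' k, ((a i k - a₀ k) * S.coeff w k) ^ 2) l (𝓝 0) := by
    have h0 : (0 : ℝ) = ∑' k : ℕ, (0 : ℝ) := by simp
    rw [h0]
    refine tendsto_tsum_of_dominated_convergence
      (bound := fun k => (2 * M) ^ 2 * S.coeff w k ^ 2)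
      ((S.hasSum_coeff_sq w).summable.mul_left _) (fun k => ?_) ?_
    · have h1 := (((h k).sub_const (a₀ k)).mul_const (S.coeff w k)).pow 2
      simpa using h1
    · filter_upwards [ha] with i hi k
      rw [Real.norm_of_nonneg (sq_nonneg _), mul_pow]
      gcongr ?_ * _
      have h1 := abs_le.1 (hi k)
      have h2 := abs_le.1 (ha₀ k)
      exact sq_le_sq' (by linarith) (by linarith)
  have hsqrt := (Real.continuous_sqrt.tendsto 0).comp hsq
  rw [Real.sqrt_zero] at hsqrt
  refine hsqrt.congr' ?_
  filter_upwards [ha] with i hi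
  rw [Function.comp_apply, ← Real.sqrt_sq (norm_nonneg (S.diag (a i) w - S.diag a₀ w)),
    ← (S.hasSum_coeff_sq _).tsum_eq]
  congr 1
  refine tsum_congr fun k => ?_
  rw [coeff_sub, coeff_diag hi, coeff_diag ha₀, sub_mul]

lemma continuousOn_diag {a : ℝ → ℕ → ℝ} {s : Set ℝ} {M : ℝ} (ha : ∀ t ∈ s, ∀ k, |a t k| ≤ M)
    (hc : ∀ k, ContinuousOn (fun t => a t k) s) (w : L.L2) :
    ContinuousOn (fun t => S.diag (a t) w) s := fun t ht =>
  tendsto_diag (eventually_nhdsWithin_of_forall ha) (ha t ht) (fun k => hc k t ht) w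

lemma aestronglyMeasurable_diag {α : Type*} [MeasurableSpace α] {μ : Measure α} {a : α → ℕ → ℝ}
    {f : α → L.L2} (ha : ∀ k, AEStronglyMeasurable (fun r => a r k) μ)
    (hab : ∀ᵐ r ∂μ, ∃ M, ∀ k, |a r k| ≤ M) (hf : AEStronglyMeasurable f μ) :
    AEStronglyMeasurable (fun r => S.diag (a r) (f r)) μ := by
  refine aestronglyMeasurable_of_tendsto_ae atTop
    (f := fun N r => ∑ k ∈ Finset.range N, (a r k * S.coeff (f r) k) • S.φ k) (fun N => ?_) ?_
  · refine Finset.aestronglyMeasurable_fun_sum _ fun k _ => ?_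
    exact ((ha k).mul ((S.coeffL k).continuous.comp_aestronglyMeasurable hf)).smul_const _
  · filter_upwards [hab] with r hr
    obtain ⟨M, hM⟩ := hr
    exact (hasSum_diag (summable_diag hM (f r))).tendsto_sum_nat

end EllipticOperator.EigenSystem

/-! ### Weakly singular kernels -/

/-- A family of kernels on `(0,T]` that is bounded by `M * t ^ (β - 1)`. -/
structure IsSingularKernel (T M β : ℝ) (a : ℝ → ℕ → ℝ) : Prop where
  pos : 0 < β
  le_one : β ≤ 1
  nonneg : 0 ≤ M
  continuousOn : ∀ k, ContinuousOn (fun t => a t k) (Ioi 0)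
  bound : ∀ t ∈ Ioc 0 T, ∀ k, |a t k| ≤ M * t ^ (β - 1)

/-- The function `M * t ^ (β - 1)` on `(0,T)`, extended by `0`. -/
def singularMajorant (T M β : ℝ) : ℝ → ℝ≥0∞ :=
  (Ioo 0 T).indicator fun t => ENNReal.ofReal (M * t ^ (β - 1))

lemma measurable_singularMajorant (T M β : ℝ) : Measurable (singularMajorant T M β) :=
  (ENNReal.measurable_ofReal.comp (by fun_prop)).indicator measurableSet_Ioo

lemma lintegral_ofReal_rpow {T M β : ℝ} (hT : 0 ≤ T) (hM : 0 ≤ M) (hβ : 0 < β) :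
    ∫⁻ t in Ioo 0 T, ENNReal.ofReal (M * t ^ (β - 1)) = ENNReal.ofReal (M * (T ^ β / β)) := by
  rw [← ofReal_integral_eq_lintegral_ofReal ((integrableOn_rpow_Ioo hβ T).const_mul M)]
  · rw [integral_const_mul, ← integral_Ioc_eq_integral_Ioo, ← intervalIntegral.integral_of_le hT,
      integral_rpow (Or.inl (by linarith))]
    simp [Real.zero_rpow hβ.ne']
  · filter_upwards [ae_restrict_mem measurableSet_Ioo] with t ht
    exact mul_nonneg hM (Real.rpow_nonneg ht.1.le _)

lemma lintegral_singularMajorant {T M β : ℝ} (hT : 0 ≤ T) (hM : 0 ≤ M) (hβ : 0 < β) :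
    ∫⁻ t, singularMajorant T M β t = ENNReal.ofReal (M * (T ^ β / β)) := by
  rw [singularMajorant, lintegral_indicator measurableSet_Ioo, lintegral_ofReal_rpow hT hM hβ]

lemma lintegral_singularMajorant_sq {T M β : ℝ} (hT : 0 ≤ T) (hM : 0 ≤ M) (hβ : 1 / 2 < β) :
    ∫⁻ t, singularMajorant T M β t ^ 2 =
      ENNReal.ofReal (M ^ 2 * (T ^ (2 * β - 1) / (2 * β - 1))) := by
  rw [← lintegral_ofReal_rpow hT (sq_nonneg M) (by linarith), ← lintegral_indicator measurableSet_Ioo]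
  refine lintegral_congr fun t => ?_
  by_cases ht : t ∈ Ioo 0 T
  · rw [singularMajorant, indicator_of_mem ht, indicator_of_mem ht,
      ← ENNReal.ofReal_pow (mul_nonneg hM (Real.rpow_nonneg ht.1.le _)), mul_pow,
      ← Real.rpow_natCast (t ^ (β - 1)) 2, ← Real.rpow_mul ht.1.le]
    ring_nf
  · rw [singularMajorant, indicator_of_notMem ht, indicator_of_notMem ht, zero_pow two_ne_zero]

namespace EllipticOperator.EigenSystem

variable {n : ℕ} {L : EllipticOperator n} {S : L.EigenSystem}
  {T M β : ℝ} {a : ℝ → ℕ → ℝ} {f : ℝ → L.L2}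

variable (S) in
/-- The convolution `∫₀ᵗ ∑_k a_k(t - r) f_k(r) φ_k dr`. -/
def conv (a : ℝ → ℕ → ℝ) (f : ℝ → L.L2) (t : ℝ) : L.L2 :=
  ∫ r in (0 : ℝ)..t, S.diag (a (t - r)) (f r)

lemma exists_ae_norm_le (hf : MemLp f ⊤ (timeMeasure T)) :
    ∃ B : ℝ, 0 ≤ B ∧ ∀ᵐ r ∂timeMeasure T, ‖f r‖ ≤ B := by
  refine ⟨(eLpNorm f ⊤ (timeMeasure T)).toReal, ENNReal.toReal_nonneg, ?_⟩
  filter_upwards [enorm_ae_le_eLpNormEssSup f (timeMeasure T)] with r hr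
  rw [← toReal_enorm]
  exact ENNReal.toReal_mono hf.2.ne (by simpa using hr)

lemma aestronglyMeasurable_conv (ha : IsSingularKernel T M β a)
    (hf : AEStronglyMeasurable f (timeMeasure T)) {t : ℝ} (hT : t ≤ T) :
    AEStronglyMeasurable (fun r => S.diag (a (t - r)) (f r)) (volume.restrict (Ioo 0 t)) := by
  refine aestronglyMeasurable_diag (fun k => ?_) ?_
    (hf.mono_measure (Measure.restrict_mono (Ioo_subset_Ioo_right hT) le_rfl))
  · refine ContinuousOn.aestronglyMeasurable ?_ measurableSet_Ioo
    exact (ha.continuousOn k).comp (by fun_prop) fun r hr => by simpa using hr.2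
  · filter_upwards [ae_restrict_mem measurableSet_Ioo] with r hr
    exact ⟨_, ha.bound (t - r) ⟨by linarith [hr.2], by linarith [hr.1]⟩⟩

lemma integrableOn_sub_rpow {β : ℝ} (hβ : 0 < β) {t : ℝ} (h0 : 0 ≤ t) :
    IntegrableOn (fun r : ℝ => (t - r) ^ (β - 1)) (Ioo 0 t) := by
  have h := (intervalIntegral.intervalIntegrable_rpow' (a := t) (b := 0) (r := β - 1)
    (by linarith)).comp_sub_left t
  rw [sub_self, sub_zero] at h
  exact (intervalIntegrable_iff_integrableOn_Ioo_of_le h0).1 h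

lemma integrableOn_conv (ha : IsSingularKernel T M β a) (hf : MemLp f ⊤ (timeMeasure T))
    {t : ℝ} (h0 : 0 ≤ t) (hT : t ≤ T) :
    IntegrableOn (fun r => S.diag (a (t - r)) (f r)) (Ioo 0 t) := by
  obtain ⟨B, hB0, hB⟩ := exists_ae_norm_le hf
  refine ((integrableOn_sub_rpow ha.pos h0).const_mul (M * B)).mono'
    (aestronglyMeasurable_conv ha hf.1 hT) ?_
  filter_upwards [ae_restrict_mem measurableSet_Ioo,
    ae_restrict_of_ae_restrict_of_subset (Ioo_subset_Ioo_right hT) hB] with r hr hrB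
  have htr : t - r ∈ Ioc 0 T := ⟨by linarith [hr.2], by linarith [hr.1]⟩
  have h1 := norm_diag_le (S := S) (ha.bound (t - r) htr) (f r)
  have h2 : 0 ≤ (t - r) ^ (β - 1) := Real.rpow_nonneg htr.1.le _
  have h3 := mul_nonneg ha.nonneg h2
  calc ‖S.diag (a (t - r)) (f r)‖ ≤ M * (t - r) ^ (β - 1) * B := h1.trans (by gcongr)
    _ = _ := by ring

lemma intervalIntegrable_conv (ha : IsSingularKernel T M β a) (hf : MemLp f ⊤ (timeMeasure T))
    {t : ℝ} (h0 : 0 ≤ t) (hT : t ≤ T) :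
    IntervalIntegrable (fun r => S.diag (a (t - r)) (f r)) volume 0 t :=
  (intervalIntegrable_iff_integrableOn_Ioo_of_le h0).2 (integrableOn_conv ha hf h0 hT)

lemma coeff_conv (ha : IsSingularKernel T M β a) (hf : MemLp f ⊤ (timeMeasure T))
    {t : ℝ} (h0 : 0 ≤ t) (hT : t ≤ T) (k : ℕ) :
    S.coeff (S.conv a f t) k = ∫ r in (0 : ℝ)..t, a (t - r) k * S.coeff (f r) k := by
  rw [← coeffL_apply, conv,
    ← (S.coeffL k).intervalIntegral_comp_comm (intervalIntegrable_conv ha hf h0 hT),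
    intervalIntegral.integral_of_le h0, intervalIntegral.integral_of_le h0,
    integral_Ioc_eq_integral_Ioo, integral_Ioc_eq_integral_Ioo]
  refine setIntegral_congr_fun measurableSet_Ioo fun r hr => ?_
  exact coeff_diag (ha.bound (t - r) ⟨by linarith [hr.2], by linarith [hr.1]⟩) (f r) k

/-- The vector-valued convolution is dominated by a scalar one, from which the sup, Cauchy–Schwarz
and Young bounds all follow. -/
lemma enorm_conv_le (ha : IsSingularKernel T M β a) {t : ℝ} (h0 : 0 ≤ t) (hT : t ≤ T) :
    ‖S.conv a f t‖ₑ ≤ ∫⁻ r in Ioo 0 T, singularMajorant T M β (t - r) * ‖f r‖ₑ := by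
  rw [conv, intervalIntegral.integral_of_le h0, integral_Ioc_eq_integral_Ioo]
  refine (enorm_integral_le_lintegral_enorm _).trans (le_trans (setLIntegral_mono' measurableSet_Ioo
    fun r hr => ?_) (lintegral_mono_set (Ioo_subset_Ioo_right hT)))
  have htr : t - r ∈ Ioc 0 T := ⟨by linarith [hr.2], by linarith [hr.1]⟩
  have htr' : t - r ∈ Ioo 0 T := ⟨by linarith [hr.2], by linarith [hr.1]⟩
  rw [singularMajorant, indicator_of_mem htr', ← ofReal_norm, ← ofReal_norm,
    ← ENNReal.ofReal_mul (mul_nonneg ha.nonneg (Real.rpow_nonneg htr.1.le _))]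
  exact ENNReal.ofReal_le_ofReal (norm_diag_le (ha.bound (t - r) htr) (f r))

lemma lintegral_singularMajorant_sub_le (hT : 0 ≤ T) (hM : 0 ≤ M) (hβ : 0 < β) (t : ℝ) :
    ∫⁻ r in Ioo 0 T, singularMajorant T M β (t - r) ≤ ENNReal.ofReal (M * (T ^ β / β)) := by
  refine (setLIntegral_le_lintegral _ _).trans_eq ?_
  rw [lintegral_sub_left_eq_self (singularMajorant T M β) t, lintegral_singularMajorant hT hM hβ]

lemma enorm_conv_le_top (ha : IsSingularKernel T M β a) {t : ℝ} (h0 : 0 ≤ t) (hT : t ≤ T) :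
    ‖S.conv a f t‖ₑ ≤ ENNReal.ofReal (M * (T ^ β / β)) * eLpNorm f ⊤ (timeMeasure T) := by
  refine (enorm_conv_le ha h0 hT).trans ?_
  calc ∫⁻ r in Ioo 0 T, singularMajorant T M β (t - r) * ‖f r‖ₑ
      ≤ ∫⁻ r in Ioo 0 T, singularMajorant T M β (t - r) * eLpNorm f ⊤ (timeMeasure T) := by
        refine lintegral_mono_ae ?_
        filter_upwards [enorm_ae_le_eLpNormEssSup f (timeMeasure T)] with r hr
        rw [eLpNorm_exponent_top]
        gcongr
    _ = (∫⁻ r in Ioo 0 T, singularMajorant T M β (t - r)) * eLpNorm f ⊤ (timeMeasure T) := by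
        have hm : Measurable fun r => singularMajorant T M β (t - r) :=
          (measurable_singularMajorant T M β).comp (measurable_const.sub measurable_id)
        rw [lintegral_mul_const _ hm]
    _ ≤ _ := by
        gcongr
        exact lintegral_singularMajorant_sub_le (h0.trans hT) ha.nonneg ha.pos t

lemma eLpNorm_two_sq {X : Type*} [NormedAddCommGroup X] (g : ℝ → X) (μ : Measure ℝ) :
    eLpNorm g 2 μ ^ 2 = ∫⁻ r, ‖g r‖ₑ ^ 2 ∂μ := by
  rw [eLpNorm_eq_lintegral_rpow_enorm_toReal (by simp) (by simp)]
  simp only [ENNReal.toReal_ofNat, ENNReal.rpow_two, one_div]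
  rw [← ENNReal.rpow_two, ← ENNReal.rpow_mul]
  norm_num

lemma le_of_sq_le_sq_enn {x y : ℝ≥0∞} (h : x ^ 2 ≤ y ^ 2) : x ≤ y :=
  (ENNReal.pow_le_pow_left_iff two_ne_zero).1 h

/-- The Cauchy–Schwarz bound. -/
lemma enorm_conv_le_two (ha : IsSingularKernel T M β a) (hβ : 1 / 2 < β)
    (hf : AEStronglyMeasurable f (timeMeasure T)) {t : ℝ} (h0 : 0 ≤ t) (hT : t ≤ T) :
    ‖S.conv a f t‖ₑ ≤ ENNReal.ofReal (M * √(T ^ (2 * β - 1) / (2 * β - 1))) *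
      eLpNorm f 2 (timeMeasure T) := by
  have hT0 := h0.trans hT
  have hm : Measurable fun r => singularMajorant T M β (t - r) :=
    (measurable_singularMajorant T M β).comp (measurable_const.sub measurable_id)
  have h := ENNReal.lintegral_mul_le_Lp_mul_Lq (timeMeasure T) Real.HolderConjugate.two_two
    (f := fun r => singularMajorant T M β (t - r)) (g := fun r => ‖f r‖ₑ) hm.aemeasurable hf.enorm
  have e : ∀ x : ℝ≥0∞, (x ^ (1 / 2 : ℝ)) ^ 2 = x := fun x => by
    rw [← ENNReal.rpow_two, ← ENNReal.rpow_mul]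
    norm_num
  have h2 := pow_le_pow_left' ((enorm_conv_le (S := S) (f := f) ha h0 hT).trans h) 2
  rw [mul_pow, e, e] at h2
  simp only [ENNReal.rpow_two] at h2
  rw [← eLpNorm_two_sq] at h2
  refine le_of_sq_le_sq_enn (h2.trans ?_)
  rw [mul_pow]
  gcongr
  refine (setLIntegral_le_lintegral _ _).trans_eq ?_
  have hpos : 0 ≤ T ^ (2 * β - 1) / (2 * β - 1) :=
    div_nonneg (Real.rpow_nonneg hT0 _) (by linarith)
  rw [lintegral_sub_left_eq_self (fun s => singularMajorant T M β s ^ 2) t,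
    lintegral_singularMajorant_sq hT0 ha.nonneg hβ,
    ← ENNReal.ofReal_pow (mul_nonneg ha.nonneg (Real.sqrt_nonneg _)), mul_pow, Real.sq_sqrt hpos]

/-- Young's inequality. -/
lemma eLpNorm_conv_le_two (ha : IsSingularKernel T M β a) (hT : 0 ≤ T)
    (hf : AEStronglyMeasurable f (timeMeasure T)) :
    eLpNorm (S.conv a f) 2 (timeMeasure T) ≤
      ENNReal.ofReal (M * (T ^ β / β)) * eLpNorm f 2 (timeMeasure T) := by
  set K := ENNReal.ofReal (M * (T ^ β / β)) with hK
  have hm : Measurable fun p : ℝ × ℝ => singularMajorant T M β (p.1 - p.2) :=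
    (measurable_singularMajorant T M β).comp (measurable_fst.sub measurable_snd)
  have hm1 : ∀ t, Measurable fun r => singularMajorant T M β (t - r) := fun t =>
    (measurable_singularMajorant T M β).comp (measurable_const.sub measurable_id)
  refine le_of_sq_le_sq_enn ?_
  rw [eLpNorm_two_sq, mul_pow, eLpNorm_two_sq]
  -- Weighted Cauchy–Schwarz yields one factor `K`, the mass of the kernel; after Tonelli the
  -- integral in `t` yields the other.
  calc ∫⁻ t in Ioo 0 T, ‖S.conv a f t‖ₑ ^ 2
      ≤ ∫⁻ t in Ioo 0 T, K * ∫⁻ r in Ioo 0 T, singularMajorant T M β (t - r) * ‖f r‖ₑ ^ 2 := by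
        refine setLIntegral_mono' measurableSet_Ioo fun t ht => ?_
        refine (pow_le_pow_left' (enorm_conv_le ha ht.1.le ht.2.le) 2).trans
          ((lintegral_mul_sq_le _ (hm1 t).aemeasurable hf.enorm).trans ?_)
        gcongr
        exact lintegral_singularMajorant_sub_le hT ha.nonneg ha.pos t
    _ = K * ∫⁻ t in Ioo 0 T, ∫⁻ r in Ioo 0 T, singularMajorant T M β (t - r) * ‖f r‖ₑ ^ 2 := by
        rw [lintegral_const_mul' _ _ ENNReal.ofReal_ne_top]
    _ = K * ∫⁻ r in Ioo 0 T, ∫⁻ t in Ioo 0 T, singularMajorant T M β (t - r) * ‖f r‖ₑ ^ 2 := by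
        congr 1
        refine lintegral_lintegral_swap (hm.aemeasurable.mul ?_)
        exact (hf.enorm.pow_const 2).comp_snd
    _ ≤ K * ∫⁻ r in Ioo 0 T, K * ‖f r‖ₑ ^ 2 := by
        gcongr with r
        have hmr : Measurable fun t => singularMajorant T M β (t - r) :=
          (measurable_singularMajorant T M β).comp (measurable_id.sub measurable_const)
        rw [lintegral_mul_const _ hmr]
        gcongr
        refine (setLIntegral_le_lintegral _ _).trans_eq ?_
        rw [lintegral_sub_right_eq_self (singularMajorant T M β) r,
          lintegral_singularMajorant hT ha.nonneg ha.pos]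
    _ = _ := by
        rw [lintegral_const_mul' _ _ ENNReal.ofReal_ne_top, ← mul_assoc, sq]

end EllipticOperator.EigenSystem

end

/-! ### Continuity of convolutions -/

noncomputable section

namespace EllipticOperator.EigenSystem

variable {n : ℕ} {L : EllipticOperator n} {S : L.EigenSystem}
  {T M β : ℝ} {a : ℝ → ℕ → ℝ} {f : ℝ → L.L2}

/-- The integrand of `conv a f`, cut off where `t - r ≤ δ`. -/
def truncIntegrand (S : L.EigenSystem) (a : ℝ → ℕ → ℝ) (f : ℝ → L.L2) (δ t r : ℝ) : L.L2 :=
  if δ < t - r then S.diag (a (t - r)) (f r) else 0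

lemma norm_truncIntegrand_le (ha : IsSingularKernel T M β a) {B δ t r : ℝ} (hδ : 0 < δ)
    (hB : ‖f r‖ ≤ B) (hr : r ∈ Ioo 0 T) (ht : t ∈ Icc 0 T) :
    ‖truncIntegrand S a f δ t r‖ ≤ M * δ ^ (β - 1) * B := by
  have hB0 : 0 ≤ B := (norm_nonneg _).trans hB
  have h0 : 0 ≤ M * δ ^ (β - 1) := mul_nonneg ha.nonneg (Real.rpow_nonneg hδ.le _)
  unfold truncIntegrand
  split_ifs with h
  · refine (norm_diag_le (ha.bound (t - r) ⟨hδ.trans h, by linarith [hr.1, ht.2]⟩) (f r)).trans ?_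
    have h1 : (t - r) ^ (β - 1) ≤ δ ^ (β - 1) :=
      Real.rpow_le_rpow_of_nonpos hδ h.le (by linarith [ha.le_one])
    have := ha.nonneg
    gcongr
  · rw [norm_zero]
    positivity

lemma aestronglyMeasurable_truncIntegrand (ha : IsSingularKernel T M β a)
    (hf : AEStronglyMeasurable f (timeMeasure T)) {δ t : ℝ} (hδ : 0 < δ) (ht : t ∈ Icc 0 T) :
    AEStronglyMeasurable (truncIntegrand S a f δ t) (timeMeasure T) := by
  have h := (aestronglyMeasurable_conv (S := S) ha hf ht.2).indicator
    (measurableSet_Iio (a := t - δ))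
  have h2 := (aestronglyMeasurable_indicator_iff measurableSet_Ioo).2 h
  refine (h2.mono_measure Measure.restrict_le_self).congr ?_
  filter_upwards [ae_restrict_mem measurableSet_Ioo] with r hr
  unfold truncIntegrand
  by_cases h : δ < t - r
  · have h1 : r ∈ Ioo 0 t := ⟨hr.1, by linarith⟩
    have h2 : r ∈ Iio (t - δ) := by simp only [mem_Iio]; linarith
    rw [if_pos h, indicator_of_mem h1, indicator_of_mem h2]
  · rw [if_neg h]
    by_cases h' : r ∈ Ioo 0 t
    · rw [indicator_of_mem h', indicator_of_notMem (by simp; linarith)]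
    · rw [indicator_of_notMem h']

/-- Without the singularity dominated convergence applies: the integrand at `r` is continuous at
`t₀` except when `r = t₀ - δ`, a null set. -/
lemma continuousOn_integral_truncIntegrand (ha : IsSingularKernel T M β a)
    (hf : MemLp f ⊤ (timeMeasure T)) {δ : ℝ} (hδ : 0 < δ) :
    ContinuousOn (fun t => ∫ r in Ioo 0 T, truncIntegrand S a f δ t r) (Icc 0 T) := by
  obtain ⟨B, hB0, hB⟩ := exists_ae_norm_le hf
  intro t₀ ht₀
  refine continuousWithinAt_of_dominated (bound := fun _ => M * δ ^ (β - 1) * B) ?_ ?_ ?_ ?_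
  · exact eventually_nhdsWithin_of_forall fun t ht =>
      aestronglyMeasurable_truncIntegrand ha hf.1 hδ ht
  · refine eventually_nhdsWithin_of_forall fun t ht => ?_
    filter_upwards [hB, ae_restrict_mem measurableSet_Ioo] with r hr hr'
    exact norm_truncIntegrand_le ha hδ hr hr' ht
  · exact integrable_const _
  · have hne : ∀ᵐ r ∂timeMeasure T, r ≠ t₀ - δ :=
      ae_restrict_of_ae (measure_eq_zero_iff_ae_notMem.1 (Real.volume_singleton (a := t₀ - δ)))
    filter_upwards [hne, ae_restrict_mem measurableSet_Ioo] with r hr hr'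
    rcases lt_or_gt_of_ne hr with h | h
    · have hev : ∀ᶠ t in 𝓝[Icc 0 T] t₀, r + δ < t :=
        mem_nhdsWithin_of_mem_nhds (lt_mem_nhds (by linarith))
      have hc : ContinuousOn (fun t => S.diag (a (t - r)) (f r)) (Icc (r + δ) T) := by
        refine continuousOn_diag (M := M * δ ^ (β - 1)) (fun t ht k => ?_) (fun k => ?_) (f r)
        · refine (ha.bound (t - r) ⟨by linarith [ht.1], by linarith [ht.2, hr'.1]⟩ k).trans ?_
          have := Real.rpow_le_rpow_of_nonpos (z := β - 1) hδ (by linarith [ht.1] : δ ≤ t - r)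
            (by linarith [ha.le_one])
          have := ha.nonneg
          gcongr
        · exact (ha.continuousOn k).comp (by fun_prop) fun t ht => by
            simp only [mem_Ioi]
            linarith [ht.1]
      have hc' := hc t₀ ⟨by linarith, ht₀.2⟩
      have hc2 : ContinuousWithinAt (fun t => S.diag (a (t - r)) (f r)) (Icc 0 T) t₀ := by
        refine hc'.mono_of_mem_nhdsWithin ?_
        filter_upwards [hev, self_mem_nhdsWithin] with t h1 h2
        exact ⟨h1.le, h2.2⟩
      refine hc2.congr_of_eventuallyEq ?_ ?_
      · filter_upwards [hev] with t h1
        rw [truncIntegrand, if_pos (by linarith)]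
      · rw [truncIntegrand, if_pos (by linarith)]
    · have hev : ∀ᶠ t in 𝓝[Icc 0 T] t₀, t < r + δ :=
        mem_nhdsWithin_of_mem_nhds (gt_mem_nhds (by linarith))
      refine (continuousWithinAt_const (b := (0 : L.L2))).congr_of_eventuallyEq ?_ ?_
      · filter_upwards [hev] with t h1
        rw [truncIntegrand, if_neg (by linarith)]
      · rw [truncIntegrand, if_neg (by linarith)]

lemma enorm_conv_sub_le (ha : IsSingularKernel T M β a) (hf : MemLp f ⊤ (timeMeasure T))
    {B δ t : ℝ} (hδ : 0 < δ) (hB0 : 0 ≤ B) (hB : ∀ᵐ r ∂timeMeasure T, ‖f r‖ ≤ B)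
    (ht : t ∈ Icc 0 T) :
    ‖S.conv a f t - ∫ r in Ioo 0 T, truncIntegrand S a f δ t r‖ₑ ≤
      ENNReal.ofReal (M * ((2 * δ) ^ β / β) * B) := by
  have hi : Integrable (truncIntegrand S a f δ t) (timeMeasure T) := by
    refine (integrable_const (M * δ ^ (β - 1) * B)).mono'
      (aestronglyMeasurable_truncIntegrand ha hf.1 hδ ht) ?_
    filter_upwards [hB, ae_restrict_mem measurableSet_Ioo] with r hr hr'
    exact norm_truncIntegrand_le ha hδ hr hr' ht
  have hsub : ∫ r in Ioo 0 T, truncIntegrand S a f δ t r =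
      ∫ r in Ioo 0 t, truncIntegrand S a f δ t r := by
    refine (setIntegral_eq_of_subset_of_forall_sdiff_eq_zero measurableSet_Ioo
      (Ioo_subset_Ioo_right ht.2) fun r hr => ?_)
    rw [truncIntegrand, if_neg]
    intro h
    exact hr.2 ⟨hr.1.1, by linarith⟩
  rw [hsub, conv, intervalIntegral.integral_of_le ht.1, integral_Ioc_eq_integral_Ioo,
    ← integral_sub (integrableOn_conv ha hf ht.1 ht.2)
      (hi.mono_measure (Measure.restrict_mono (Ioo_subset_Ioo_right ht.2) le_rfl))]
  have hm : Measurable fun r => singularMajorant (2 * δ) M β (t - r) :=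
    (measurable_singularMajorant _ M β).comp (measurable_const.sub measurable_id)
  calc _ ≤ ∫⁻ r in Ioo 0 t, ‖S.diag (a (t - r)) (f r) - truncIntegrand S a f δ t r‖ₑ :=
        enorm_integral_le_lintegral_enorm _
    _ ≤ ∫⁻ r in Ioo 0 t, singularMajorant (2 * δ) M β (t - r) * ENNReal.ofReal B := by
        refine lintegral_mono_ae ?_
        filter_upwards [ae_restrict_mem measurableSet_Ioo,
          ae_restrict_of_ae_restrict_of_subset (Ioo_subset_Ioo_right ht.2) hB] with r hr hrB
        unfold truncIntegrand
        split_ifs with h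
        · simp
        · have htr : t - r ∈ Ioc 0 T := ⟨by linarith [hr.2], by linarith [hr.1, ht.2]⟩
          -- The discarded part includes `t - r = δ`, while the majorant lives on an open interval;
          -- hence `2δ` in place of `δ`.
          have htr' : t - r ∈ Ioo 0 (2 * δ) := ⟨by linarith [hr.2], by linarith⟩
          have h0 := mul_nonneg ha.nonneg (Real.rpow_nonneg htr.1.le (β - 1))
          rw [sub_zero, singularMajorant, indicator_of_mem htr', ← ofReal_norm,
            ← ENNReal.ofReal_mul h0]
          exact ENNReal.ofReal_le_ofReal ((norm_diag_le (ha.bound (t - r) htr) (f r)).trans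
            (by gcongr))
    _ ≤ ∫⁻ r, singularMajorant (2 * δ) M β (t - r) * ENNReal.ofReal B :=
        setLIntegral_le_lintegral _ _
    _ = _ := by
        rw [lintegral_mul_const _ hm, lintegral_sub_left_eq_self (singularMajorant (2 * δ) M β) t,
          lintegral_singularMajorant (by positivity) ha.nonneg ha.pos,
          ENNReal.ofReal_mul' hB0]

/-- Uniform limit of the truncated convolutions: the error is of order `δ ^ β` uniformly in `t`. -/
lemma continuousOn_conv (ha : IsSingularKernel T M β a) (hf : MemLp f ⊤ (timeMeasure T)) :
    ContinuousOn (S.conv a f) (Icc 0 T) := by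
  obtain ⟨B, hB0, hB⟩ := exists_ae_norm_le hf
  refine continuousOn_of_uniform_approx_of_continuousOn fun v hv => ?_
  obtain ⟨ε, hε, hv⟩ := Metric.mem_uniformity_dist.1 hv
  have hlim : Tendsto (fun δ : ℝ => M * ((2 * δ) ^ β / β) * B) (𝓝[>] 0) (𝓝 0) := by
    have hc : Continuous fun δ : ℝ => M * ((2 * δ) ^ β / β) * B := by
      have := ha.pos.le
      exact ((((continuous_const.mul continuous_id).rpow_const fun _ => Or.inr this).div_const
        β).const_mul M).mul_const B
    have := hc.tendsto 0
    rw [mul_zero, Real.zero_rpow ha.pos.ne', zero_div, mul_zero, zero_mul] at this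
    exact this.mono_left nhdsWithin_le_nhds
  obtain ⟨δ, hδε, hδ⟩ := ((hlim.eventually (gt_mem_nhds hε)).and self_mem_nhdsWithin).exists
  refine ⟨_, continuousOn_integral_truncIntegrand (S := S) ha hf (δ := δ) hδ, fun t ht => hv ?_⟩
  rw [dist_eq_norm]
  have h := enorm_conv_sub_le (S := S) ha hf hδ hB0 hB ht
  rw [← ofReal_norm, ENNReal.ofReal_le_ofReal_iff'] at h
  rcases h with h | h
  · exact h.trans_lt hδε
  · exact h.trans_lt hε

end EllipticOperator.EigenSystem

end

/-! ### The Mittag-Leffler kernels -/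

noncomputable section

/-- With `x = lam t^γ`, the power `lam^θ` equals `x^θ t^(-θγ)`, and `x^θ ≤ 1 + x` is absorbed by the
decay `C / (1 + x)`. Powers of the eigenvalue are thus traded for powers of time. -/
lemma exists_rpow_mul_mlKernel_le {γ μ : ℝ} (hγ1 : 1 < γ) (hγ2 : γ < 2) (hμ : 0 < μ)
    (hμγ : μ < γ + 1) : ∃ C : ℝ, 0 < C ∧ ∀ lam θ t : ℝ, 0 < lam → 0 ≤ θ → θ ≤ 1 → 0 < t →
      |lam ^ θ * mlKernel γ lam μ t| ≤ C * t ^ (μ - θ * γ - 1) := by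
  obtain ⟨C, hC, h⟩ := exists_abs_mittagLeffler_neg_le hγ1 hγ2 hμ hμγ
  refine ⟨C, hC, fun lam θ t hlam hθ0 hθ1 ht => ?_⟩
  have htγ : 0 < t ^ γ := Real.rpow_pos_of_pos ht _
  set x := lam * t ^ γ with hx
  have hx0 : 0 < x := mul_pos hlam htγ
  have hθ : x ^ θ ≤ 1 + x := by
    rcases le_total x 1 with h1 | h1
    · exact (Real.rpow_le_one hx0.le h1 hθ0).trans (by linarith)
    · have := Real.rpow_le_rpow_of_exponent_le h1 hθ1
      rw [Real.rpow_one] at this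
      linarith
  have e : lam ^ θ = x ^ θ * t ^ (-(θ * γ)) := by
    rw [hx, Real.mul_rpow hlam.le htγ.le, ← Real.rpow_mul ht.le, mul_assoc, ← Real.rpow_add ht,
      mul_comm γ θ, add_neg_cancel, Real.rpow_zero, mul_one]
  have e2 : t ^ (μ - θ * γ - 1) = t ^ (-(θ * γ)) * t ^ (μ - 1) := by
    rw [← Real.rpow_add ht]
    ring_nf
  have hE : x ^ θ * |mittagLeffler γ μ (-x)| ≤ C := by
    calc x ^ θ * |mittagLeffler γ μ (-x)| ≤ (1 + x) * (C / (1 + x)) :=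
          mul_le_mul hθ (h x hx0.le) (abs_nonneg _) (by linarith)
      _ = C := by field_simp
  rw [mlKernel, ← hx, e, e2, abs_mul, abs_mul, abs_mul,
    abs_of_nonneg (Real.rpow_nonneg hx0.le _), abs_of_nonneg (Real.rpow_nonneg ht.le _),
    abs_of_nonneg (Real.rpow_nonneg ht.le _)]
  calc x ^ θ * t ^ (-(θ * γ)) * (t ^ (μ - 1) * |mittagLeffler γ μ (-x)|)
      = x ^ θ * |mittagLeffler γ μ (-x)| * (t ^ (-(θ * γ)) * t ^ (μ - 1)) := by ring
    _ ≤ _ := by gcongr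

/-- For `β = 1` the bound is constant, so continuity carries it to `t = 0`. This gives the initial
values. -/
lemma IsSingularKernel.bound_one {T M : ℝ} {a : ℝ → ℕ → ℝ} (ha : IsSingularKernel T M 1 a)
    (hT : 0 < T) (hc : ∀ k, Continuous fun t => a t k) {t : ℝ} (ht : t ∈ Icc 0 T) (k : ℕ) :
    |a t k| ≤ M := by
  rw [← closure_Ioc hT.ne] at ht
  refine closure_minimal (t := {t | |a t k| ≤ M}) (fun r hr => ?_)
    (isClosed_le (hc k).abs continuous_const) ht
  simpa using ha.bound r hr k

lemma isSingularKernel_const {γ μ : ℝ} (hγ : 1 ≤ γ) (hμ : 0 < μ) (hμ1 : μ ≤ 1) (T : ℝ) :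
    IsSingularKernel T (Real.Gamma μ)⁻¹ μ fun t _ => mlKernel γ 0 μ t where
  pos := hμ
  le_one := hμ1
  nonneg := inv_nonneg.2 (Real.Gamma_pos_of_pos hμ).le
  continuousOn _ := continuousOn_mlKernel hγ hμ 0
  bound t ht _ := by
    rw [mlKernel_lam_zero, abs_of_nonneg (mul_nonneg (Real.rpow_nonneg ht.1.le _)
      (inv_nonneg.2 (Real.Gamma_pos_of_pos hμ).le)), mul_comm]

namespace EllipticOperator.EigenSystem

variable {n : ℕ} {L : EllipticOperator n} (S : L.EigenSystem)

/-- The kernels `κ_k ^ θ * t ^ (μ - 1) * E_{γ,μ}(-κ_k t^γ)` with `κ_k = lam_k ^ s`. -/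
def kern (s : ℝ≥0) (γ θ μ t : ℝ) (k : ℕ) : ℝ :=
  (S.lam k ^ (s : ℝ)) ^ θ * mlKernel γ (S.lam k ^ (s : ℝ)) μ t

lemma kern_zero (s : ℝ≥0) (γ μ t : ℝ) (k : ℕ) :
    S.kern s γ 0 μ t k = mlKernel γ (S.lam k ^ (s : ℝ)) μ t := by
  rw [kern, Real.rpow_zero, one_mul]

lemma lam_rpow_pos (r : ℝ) (k : ℕ) : 0 < S.lam k ^ r := Real.rpow_pos_of_pos (S.lam_pos k) _

lemma kern_half (s : ℝ≥0) (γ μ t : ℝ) (k : ℕ) : S.kern s γ (1 / 2) μ t k =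
    S.lam k ^ ((s : ℝ) / 2) * mlKernel γ (S.lam k ^ (s : ℝ)) μ t := by
  rw [kern, ← Real.rpow_mul (S.lam_pos k).le, mul_one_div]

lemma continuous_kern {s : ℝ≥0} {γ θ μ : ℝ} (hγ : 1 ≤ γ) (hμ : 1 ≤ μ) (k : ℕ) :
    Continuous fun t => S.kern s γ θ μ t k :=
  (continuous_mlKernel hγ hμ _).const_mul _

/-- The surplus power `t^(μ-θγ-β)` is bounded by its value at `T`. The constant is chosen before the
eigensystem, which makes the final constant independent of it. -/
lemma exists_isSingularKernel_kern (L : EllipticOperator n) (s : ℝ≥0) {γ θ μ β : ℝ} (hγ1 : 1 < γ)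
    (hγ2 : γ < 2) (hμ : 0 < μ) (hμγ : μ < γ + 1) (hθ0 : 0 ≤ θ) (hθ1 : θ ≤ 1) (hβ : 0 < β)
    (hβ1 : β ≤ 1) (hβμ : β ≤ μ - θ * γ) {T : ℝ} (hT : 0 < T) :
    ∃ M : ℝ, ∀ S : L.EigenSystem, IsSingularKernel T M β (S.kern s γ θ μ) := by
  obtain ⟨C, hC, h⟩ := exists_rpow_mul_mlKernel_le hγ1 hγ2 hμ hμγ
  refine ⟨C * T ^ (μ - θ * γ - β), fun S => ⟨hβ, hβ1, by positivity, fun k => ?_, fun t ht k => ?_⟩⟩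
  · exact (continuousOn_mlKernel hγ1.le hμ _).const_mul _
  · refine (h _ θ t (S.lam_rpow_pos s k) hθ0 hθ1 ht.1).trans ?_
    have e : t ^ (μ - θ * γ - 1) = t ^ (μ - θ * γ - β) * t ^ (β - 1) := by
      rw [← Real.rpow_add ht.1]
      ring_nf
    have h1 : t ^ (μ - θ * γ - β) ≤ T ^ (μ - θ * γ - β) :=
      Real.rpow_le_rpow ht.1.le ht.2 (by linarith)
    have h2 : 0 ≤ t ^ (β - 1) := Real.rpow_nonneg ht.1.le _
    rw [e, mul_assoc]
    gcongr

variable {S} {T M β : ℝ} {a : ℝ → ℕ → ℝ}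

lemma eLpNorm_diag_le_two (ha : IsSingularKernel T M β a) (hβ : 1 / 2 < β) (hT : 0 ≤ T)
    (w : L.L2) : eLpNorm (fun t => S.diag (a t) w) 2 (timeMeasure T) ≤
      ENNReal.ofReal (M * √(T ^ (2 * β - 1) / (2 * β - 1))) * ‖w‖ₑ := by
  have hpos : 0 ≤ T ^ (2 * β - 1) / (2 * β - 1) :=
    div_nonneg (Real.rpow_nonneg hT _) (by linarith)
  refine le_of_sq_le_sq_enn ?_
  rw [eLpNorm_two_sq, mul_pow, ← ENNReal.ofReal_pow (mul_nonneg ha.nonneg (Real.sqrt_nonneg _)),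
    mul_pow, Real.sq_sqrt hpos, ← lintegral_singularMajorant_sq hT ha.nonneg hβ,
    ← lintegral_mul_const _ ((measurable_singularMajorant T M β).pow_const 2)]
  refine (setLIntegral_mono' measurableSet_Ioo fun t ht => ?_).trans
    (setLIntegral_le_lintegral (Ioo 0 T) _)
  rw [← mul_pow, singularMajorant, indicator_of_mem ht, ← ofReal_norm, ← ofReal_norm,
    ← ENNReal.ofReal_mul (mul_nonneg ha.nonneg (Real.rpow_nonneg ht.1.le _))]
  gcongr
  exact norm_diag_le (ha.bound t ⟨ht.1, ht.2.le⟩) w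

lemma enorm_diag_le {b : ℕ → ℝ} (hb : ∀ k, |b k| ≤ M) (w : L.L2) :
    ‖S.diag b w‖ₑ ≤ ENNReal.ofReal M * ‖w‖ₑ := by
  rw [← ofReal_norm, ← ofReal_norm, ← ENNReal.ofReal_mul ((abs_nonneg _).trans (hb 0))]
  exact ENNReal.ofReal_le_ofReal (norm_diag_le hb w)

end EllipticOperator.EigenSystem

end

/-! ### Isometries between `L²(Ω)`, `ℍ^r(Ω)` and `ℍ^{-r}(Ω)` -/

noncomputable section

namespace EllipticOperator.EigenSystem

variable {n : ℕ} {L : EllipticOperator n} (S : L.EigenSystem)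

/-- Division of the coefficients by `lam_k^(r/2)` is a bounded diagonal operator because the
eigenvalues are bounded away from zero. -/
lemma exists_toSeq_eq (r : ℝ≥0) (w : L.L2) : ∃ v : S.HSpace r, S.toSeq r v = S.φ.repr w := by
  obtain ⟨m, hm, hml⟩ := S.exists_le_lam
  have hb : ∀ k, |S.lam k ^ (-((r : ℝ) / 2))| ≤ m ^ (-((r : ℝ) / 2)) := fun k => by
    rw [abs_of_pos (S.lam_rpow_pos _ k)]
    exact Real.rpow_le_rpow_of_nonpos hm (hml k) (neg_nonpos.2 (by positivity))
  have hw : ∀ k, S.wcoeff r (S.diag (fun k => S.lam k ^ (-((r : ℝ) / 2))) w) k = S.coeff w k :=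
    fun k => by
      rw [wcoeff, coeff_diag hb, ← mul_assoc, ← Real.rpow_add (S.lam_pos k), add_neg_cancel,
        Real.rpow_zero, one_mul]
  have hmem : S.diag (fun k => S.lam k ^ (-((r : ℝ) / 2))) w ∈ S.hSub r := by
    refine ((S.memℓp_wcoeff_iff r _).1 ?_)
    have : S.wcoeff r (S.diag (fun k => S.lam k ^ (-((r : ℝ) / 2))) w) = S.φ.repr w := by
      funext k
      rw [hw, HilbertBasis.repr_apply_apply, coeff]
    rw [this]
    exact (S.φ.repr w).2
  refine ⟨⟨_, hmem⟩, ?_⟩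
  ext k
  exact (hw k).trans (S.φ.repr_apply_apply w k).symm

/-- `𝓛^{-r/2} : L²(Ω) → ℍ^r(Ω)`. -/
def lift (r : ℝ≥0) : L.L2 →ₗᵢ[ℝ] S.HSpace r where
  toFun w := (S.exists_toSeq_eq r w).choose
  map_add' v w := S.toSeq_injective r <| (S.exists_toSeq_eq r (v + w)).choose_spec.trans <| by
    simp only [map_add, (S.exists_toSeq_eq r v).choose_spec, (S.exists_toSeq_eq r w).choose_spec]
  map_smul' a w := S.toSeq_injective r <| (S.exists_toSeq_eq r (a • w)).choose_spec.trans <| by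
    simp only [map_smul, (S.exists_toSeq_eq r w).choose_spec, RingHom.id_apply]
  norm_map' w := by
    change ‖S.toSeq r (S.exists_toSeq_eq r w).choose‖ = ‖w‖
    rw [(S.exists_toSeq_eq r w).choose_spec, LinearIsometryEquiv.norm_map]

lemma toSeq_lift (r : ℝ≥0) (w : L.L2) : S.toSeq r (S.lift r w) = S.φ.repr w :=
  (S.exists_toSeq_eq r w).choose_spec

lemma incl_injective (r : ℝ≥0) : Function.Injective (S.incl r) := fun _ _ h => Subtype.ext h

lemma rpow_mul_coeff_lift (r : ℝ≥0) (w : L.L2) (k : ℕ) :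
    S.lam k ^ ((r : ℝ) / 2) * S.coeff (S.incl r (S.lift r w)) k = S.coeff w k := by
  change S.toSeq r (S.lift r w) k = _
  rw [toSeq_lift, HilbertBasis.repr_apply_apply, coeff]

lemma coeff_incl_lift (r : ℝ≥0) (w : L.L2) (k : ℕ) :
    S.coeff (S.incl r (S.lift r w)) k = S.lam k ^ (-((r : ℝ) / 2)) * S.coeff w k := by
  rw [← S.rpow_mul_coeff_lift r w k, ← mul_assoc, ← Real.rpow_add (S.lam_pos k), neg_add_cancel,
    Real.rpow_zero, one_mul]

/-- `𝓛^{r/2} : L²(Ω) → ℍ^{-r}(Ω)`. -/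
def dualLift (r : ℝ≥0) : L.L2 →L[ℝ] S.HDual r :=
  ((ContinuousLinearMap.compL ℝ (S.HSpace r) (lp (fun _ : ℕ => ℝ) 2) ℝ).flip
    (LinearIsometry.mk (S.toSeq r) fun _ => rfl).toContinuousLinearMap).comp
    ((innerSL ℝ).comp (S.φ.repr : L.L2 →L[ℝ] lp (fun _ : ℕ => ℝ) 2))

lemma dualLift_apply (r : ℝ≥0) (w : L.L2) (v : S.HSpace r) :
    S.dualLift r w v = inner ℝ (S.φ.repr w) (S.toSeq r v) := rfl

lemma fracPow_lift (r : ℝ≥0) (w : L.L2) : S.fracPow r (S.lift r w) = S.dualLift r w := by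
  ext v
  rw [dualLift_apply, ← toSeq_lift, inner_toSeq]
  rfl

/-- `𝓛^{r/2} 𝓛^{-r/2}` is the identity. An identity in `ℍ^{-r}` can thus be proved in `L²` after
applying `𝓛^{-r/2}`, and then carried back by `dualLift`. -/
lemma dualLift_incl_lift (r : ℝ≥0) (w : L.L2) :
    S.dualLift r (S.incl r (S.lift r w)) = S.toDual r w := by
  ext v
  rw [dualLift_apply, toDual_apply, ← S.φ.repr.inner_map_map w, lp.inner_eq_tsum, lp.inner_eq_tsum]
  refine tsum_congr fun k => ?_
  rw [toSeq_apply, wcoeff, HilbertBasis.repr_apply_apply, HilbertBasis.repr_apply_apply,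
    HilbertBasis.repr_apply_apply]
  change inner ℝ (S.coeff (S.incl r (S.lift r w)) k) (_ * S.coeff (S.incl r v) k) =
    inner ℝ (S.coeff w k) (S.coeff (S.incl r v) k)
  rw [← S.rpow_mul_coeff_lift r w k]
  simp only [RCLike.inner_apply, conj_trivial]
  ring

/-- The eigenfunction `φ_k` as an element of `ℍ^r(Ω)`. -/
lemma exists_incl_eq_φ (r : ℝ≥0) (k : ℕ) : ∃ v : S.HSpace r, S.incl r v = S.φ k := by
  refine ⟨S.lift r (S.lam k ^ ((r : ℝ) / 2) • S.φ k), S.ext_coeff fun j => ?_⟩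
  rw [coeff_incl_lift, coeff_smul, coeff_φ]
  split_ifs with h
  · rw [h, mul_one, ← Real.rpow_add (S.lam_pos k), neg_add_cancel, Real.rpow_zero]
  · simp

lemma toDual_apply_eq_coeff {r : ℝ≥0} {k : ℕ} {v : S.HSpace r} (hv : S.incl r v = S.φ k)
    (w : L.L2) : S.toDual r w v = S.coeff w k := by
  rw [toDual_apply, hv, real_inner_comm, coeff]

lemma fracPow_apply_eq_coeff {r : ℝ≥0} {k : ℕ} {v : S.HSpace r} (hv : S.incl r v = S.φ k)
    (w : S.HSpace r) : S.fracPow r w v = S.lam k ^ (r : ℝ) * S.coeff (S.incl r w) k := by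
  change ∑' j, S.lam j ^ (r : ℝ) * (S.coeff (S.incl r w) j * S.coeff (S.incl r v) j) = _
  rw [hv, tsum_eq_single k fun j hj => by rw [coeff_φ, if_neg hj]; ring, coeff_φ, if_pos rfl]
  ring

lemma mem_hSub_of_le {r r' : ℝ≥0} (h : r ≤ r') {w : L.L2} (hw : w ∈ S.hSub r') :
    w ∈ S.hSub r := by
  obtain ⟨m, hm, hml⟩ := S.exists_le_lam
  refine Summable.of_nonneg_of_le (fun k => mul_nonneg (S.lam_rpow_pos _ k).le (sq_nonneg _))
    (fun k => ?_) (Summable.mul_left (m ^ ((r : ℝ) - r')) hw)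
  rw [← mul_assoc]
  gcongr
  have e : S.lam k ^ (r : ℝ) = S.lam k ^ ((r : ℝ) - r') * S.lam k ^ (r' : ℝ) := by
    rw [← Real.rpow_add (S.lam_pos k), sub_add_cancel]
  rw [e]
  refine mul_le_mul_of_nonneg_right ?_ (S.lam_rpow_pos _ k).le
  exact Real.rpow_le_rpow_of_nonpos hm (hml k) (by simpa using h)

/-- `𝓛^{r/2} w ∈ L²(Ω)` for `w ∈ ℍ^r(Ω)`. -/
lemma exists_coeff_eq_wcoeff {r : ℝ≥0} {w : L.L2} (hw : w ∈ S.hSub r) :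
    ∃ v : L.L2, (∀ k, S.coeff v k = S.wcoeff r w k) ∧ ‖v‖ = S.hNorm r w := by
  have e : ∀ k, S.wcoeff r w k ^ 2 = S.lam k ^ (r : ℝ) * S.coeff w k ^ 2 := fun k => by
    rw [pow_two, wcoeff_mul, pow_two]
  obtain ⟨v, -, hv⟩ := S.exists_hasSum_smul (x := S.wcoeff r w) (by simp only [e]; exact hw)
  refine ⟨v, hv, ?_⟩
  rw [hNorm, ← Real.sqrt_sq (norm_nonneg v), ← (S.hasSum_coeff_sq v).tsum_eq]
  simp only [hv, e]

end EllipticOperator.EigenSystem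

end

/-! ### Weak derivatives in time -/

noncomputable section

section WeakDerivative

variable {X Y Z : Type*} [NormedAddCommGroup Z] [NormedAddCommGroup X] [NormedSpace ℝ X] [NormedAddCommGroup Y]
  [NormedSpace ℝ Y] {T : ℝ}

lemma HasWeakTimeDeriv.congr {u u' v : ℝ → X} (h : HasWeakTimeDeriv T u v)
    (hu : u =ᵐ[timeMeasure T] u') : HasWeakTimeDeriv T u' v := by
  obtain ⟨h1, h2, h3⟩ := h
  refine ⟨h1.congr hu, h2, fun ψ hψ hψc hψs => ?_⟩
  rw [← h3 ψ hψ hψc hψs]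
  refine integral_congr_ae ?_
  filter_upwards [hu] with t ht
  rw [ht]

lemma integrable_smul_of_continuous {ψ : ℝ → ℝ} (hψ : Continuous ψ) {u : ℝ → X}
    (hu : Integrable u (timeMeasure T)) : Integrable (fun t => ψ t • u t) (timeMeasure T) := by
  obtain ⟨C, hC⟩ := (isCompact_Icc (a := 0) (b := T)).exists_bound_of_continuousOn hψ.continuousOn
  refine hu.bdd_smul C hψ.aestronglyMeasurable ?_
  filter_upwards [ae_restrict_mem measurableSet_Ioo] with t ht
  exact hC t (Ioo_subset_Icc_self ht)

lemma integrable_mul_of_continuous {ψ : ℝ → ℝ} (hψ : Continuous ψ) {u : ℝ → ℝ}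
    (hu : Integrable u (timeMeasure T)) : Integrable (fun t => ψ t * u t) (timeMeasure T) :=
  integrable_smul_of_continuous hψ hu

lemma HasWeakTimeDeriv.clm [CompleteSpace X] [CompleteSpace Y] {u v : ℝ → X}
    (h : HasWeakTimeDeriv T u v) (A : X →L[ℝ] Y) :
    HasWeakTimeDeriv T (fun t => A (u t)) (fun t => A (v t)) := by
  obtain ⟨h1, h2, h3⟩ := h
  refine ⟨A.integrable_comp h1, A.integrable_comp h2, fun ψ hψ hψc hψs => ?_⟩
  have hd : Continuous (deriv ψ) := hψ.continuous_deriv (by simp)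
  have e := congrArg A (h3 ψ hψ hψc hψs)
  rw [map_neg, ← A.integral_comp_comm (integrable_smul_of_continuous hd h1),
    ← A.integral_comp_comm (integrable_smul_of_continuous hψ.continuous h2)] at e
  simpa only [map_smul] using e

lemma HasInitialValue.clm {u : ℝ → X} {x : X} (h : HasInitialValue T u x) (A : X →L[ℝ] Y) :
    HasInitialValue T (fun t => A (u t)) (A x) := by
  obtain ⟨v, h1, h2, h3⟩ := h
  refine ⟨fun t => A (v t), A.continuous.comp_continuousOn h1, ?_, congrArg A h3⟩
  filter_upwards [h2] with t ht
  rw [ht]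

lemma ContinuousOn.memLp_top_time {u : ℝ → Z} (hu : ContinuousOn u (Icc 0 T)) :
    MemLp u ⊤ (timeMeasure T) := by
  obtain ⟨C, hC⟩ := isCompact_Icc.exists_bound_of_continuousOn hu
  refine memLp_top_of_bound ((hu.mono Ioo_subset_Icc_self).aestronglyMeasurable measurableSet_Ioo)
    C ?_
  filter_upwards [ae_restrict_mem measurableSet_Ioo] with t ht
  exact hC t (Ioo_subset_Icc_self ht)

lemma integrable_of_memLp_top {u : ℝ → Z} (hu : MemLp u ⊤ (timeMeasure T)) :
    Integrable u (timeMeasure T) := hu.integrable (by simp)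

lemma intervalIntegrable_of_time {u : ℝ → Z} (hu : Integrable u (timeMeasure T)) {t : ℝ}
    (h0 : 0 ≤ t) (hT : t ≤ T) : IntervalIntegrable u volume 0 t :=
  (intervalIntegrable_iff_integrableOn_Ioo_of_le h0).2
    (IntegrableOn.mono_set (t := Ioo 0 T) hu (Ioo_subset_Ioo_right hT))

lemma integral_time_eq {u : ℝ → X} (hT : 0 ≤ T) :
    ∫ t, u t ∂timeMeasure T = ∫ t in (0 : ℝ)..T, u t := by
  rw [intervalIntegral.integral_of_le hT, integral_Ioc_eq_integral_Ioo]

lemma continuousOn_primitive_time {q : ℝ → ℝ} (hT : 0 ≤ T) (hq : Integrable q (timeMeasure T)) :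
    ContinuousOn (fun t => ∫ r in (0 : ℝ)..t, q r) (Icc 0 T) := by
  have h := (intervalIntegrable_of_time hq hT le_rfl).absolutelyContinuousOnInterval_intervalIntegral
    (c := 0) (by simp)
  simpa only [uIcc_of_le hT] using h.continuousOn

/-- Integration by parts for absolutely continuous functions; the boundary terms vanish with `ψ`. -/
lemma integral_deriv_mul_primitive {q ψ : ℝ → ℝ} (hT : 0 ≤ T) (hq : Integrable q (timeMeasure T))
    (hψ : ContDiff ℝ ∞ ψ) (hψs : tsupport ψ ⊆ Ioo 0 T) :
    ∫ t, deriv ψ t * (∫ r in (0 : ℝ)..t, q r) ∂timeMeasure T = -∫ t, ψ t * q t ∂timeMeasure T := by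
  have hqi := intervalIntegrable_of_time hq hT le_rfl
  have hQ := hqi.absolutelyContinuousOnInterval_intervalIntegral (c := 0) (by simp)
  have hψa : AbsolutelyContinuousOnInterval ψ 0 T :=
    (hψ.of_le (by simp)).contDiffOn.absolutelyContinuousOnInterval
  have h := hψa.integral_mul_deriv_eq_deriv_mul hQ
  have z0 : ψ 0 = 0 := image_eq_zero_of_notMem_tsupport fun h => (hψs h).1.ne rfl
  have zT : ψ T = 0 := image_eq_zero_of_notMem_tsupport fun h => (hψs h).2.ne rfl
  rw [z0, zT, zero_mul, zero_mul, sub_zero, zero_sub] at h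
  rw [integral_time_eq hT, integral_time_eq hT, ← neg_eq_iff_eq_neg, ← h]
  refine intervalIntegral.integral_congr_ae ?_
  filter_upwards [hqi.ae_hasDerivAt_integral] with t ht htm
  rw [(ht (uIoc_subset_uIcc htm) 0 (by simp)).deriv]

lemma hasWeakTimeDeriv_primitive {p q : ℝ → ℝ} (hT : 0 ≤ T) (hq : Integrable q (timeMeasure T))
    (c : ℝ) (hp : ∀ t ∈ Ioo 0 T, p t = c + ∫ r in (0 : ℝ)..t, q r) : HasWeakTimeDeriv T p q := by
  have hQ : Integrable (fun t => ∫ r in (0 : ℝ)..t, q r) (timeMeasure T) :=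
    integrable_of_memLp_top (continuousOn_primitive_time hT hq).memLp_top_time
  have hw : HasWeakTimeDeriv T (fun t => c + ∫ r in (0 : ℝ)..t, q r) q := by
    refine ⟨(integrable_const c).add hQ, hq, fun ψ hψ _ hψs => ?_⟩
    have hd : Continuous (deriv ψ) := hψ.continuous_deriv (by simp)
    have z0 : ψ 0 = 0 := image_eq_zero_of_notMem_tsupport fun h => (hψs h).1.ne rfl
    have zT : ψ T = 0 := image_eq_zero_of_notMem_tsupport fun h => (hψs h).2.ne rfl
    have hz : ∫ t, deriv ψ t * c ∂timeMeasure T = 0 := by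
      rw [integral_mul_const, integral_time_eq hT, intervalIntegral.integral_deriv_eq_sub
        (fun t _ => hψ.differentiable (by simp) t) (hd.intervalIntegrable _ _), z0, zT]
      simp
    simp only [smul_eq_mul, mul_add]
    rw [integral_add (integrable_mul_of_continuous hd (integrable_const c))
      (integrable_mul_of_continuous hd hQ), hz, zero_add,
      integral_deriv_mul_primitive hT hq hψ hψs]
  refine hw.congr ?_
  filter_upwards [ae_restrict_mem measurableSet_Ioo] with t ht
  rw [hp t ht]

lemma ae_eq_zero_of_integral_test {r : ℝ → ℝ} (hr : Integrable r (timeMeasure T))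
    (h : ∀ ψ : ℝ → ℝ, ContDiff ℝ ∞ ψ → HasCompactSupport ψ → tsupport ψ ⊆ Ioo 0 T →
      ∫ t, ψ t * r t ∂timeMeasure T = 0) : r =ᵐ[timeMeasure T] 0 := by
  have hl : LocallyIntegrableOn r (Ioo 0 T) volume :=
    IntegrableOn.locallyIntegrableOn hr
  have := isOpen_Ioo.ae_eq_zero_of_integral_contDiff_smul_eq_zero hl fun ψ h1 h2 h3 => by
    rw [← h ψ h1 h2 h3]
    refine (setIntegral_eq_integral_of_forall_compl_eq_zero fun t ht => ?_).symm
    rw [image_eq_zero_of_notMem_tsupport fun h => ht (h3 h), zero_smul]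
  exact (ae_restrict_iff' measurableSet_Ioo).2 this

lemma HasWeakTimeDeriv.unique {p q q' : ℝ → ℝ} (h : HasWeakTimeDeriv T p q)
    (h' : HasWeakTimeDeriv T p q') : q =ᵐ[timeMeasure T] q' := by
  have := ae_eq_zero_of_integral_test (h.2.1.sub h'.2.1) fun ψ h1 h2 h3 => by
    have e := (h.2.2 ψ h1 h2 h3).symm.trans (h'.2.2 ψ h1 h2 h3)
    simp only [smul_eq_mul, neg_inj] at e
    simp only [Pi.sub_apply, mul_sub]
    rw [integral_sub (integrable_mul_of_continuous h1.continuous h.2.1)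
      (integrable_mul_of_continuous h1.continuous h'.2.1), e, sub_self]
  filter_upwards [this] with t ht
  exact sub_eq_zero.1 ht

/-- A test function on `(0,T)` with vanishing integral is the derivative of a test function. -/
lemma exists_test_primitive {ψ : ℝ → ℝ} (hψ : ContDiff ℝ ∞ ψ) (hψc : HasCompactSupport ψ)
    (hψs : tsupport ψ ⊆ Ioo 0 T) (h0 : ∫ t, ψ t = 0) :
    ∃ Ψ : ℝ → ℝ, ContDiff ℝ ∞ Ψ ∧ HasCompactSupport Ψ ∧ tsupport Ψ ⊆ Ioo 0 T ∧ deriv Ψ = ψ := by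
  have hder : ∀ t, HasDerivAt (fun t => ∫ r in (0 : ℝ)..t, ψ r) (ψ t) t := fun t =>
    intervalIntegral.integral_hasDerivAt_right (hψ.continuous.intervalIntegrable _ _)
      hψ.continuous.stronglyMeasurable.stronglyMeasurableAtFilter hψ.continuous.continuousAt
  have hde : deriv (fun t => ∫ r in (0 : ℝ)..t, ψ r) = ψ := funext fun t => (hder t).deriv
  have hK : ∃ a b : ℝ, tsupport ψ ⊆ Icc a b ∧ Icc a b ⊆ Ioo 0 T := by
    rcases (tsupport ψ).eq_empty_or_nonempty with he | hne
    · exact ⟨1, 0, by simp [he], by simp⟩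
    · obtain ⟨a, ha⟩ := IsCompact.exists_isLeast hψc hne
      obtain ⟨b, hb⟩ := IsCompact.exists_isGreatest hψc hne
      exact ⟨a, b, fun t ht => ⟨ha.2 ht, hb.2 ht⟩,
        fun t ht => ⟨(hψs ha.1).1.trans_le ht.1, ht.2.trans_lt (hψs hb.1).2⟩⟩
  obtain ⟨a, b, hab, habT⟩ := hK
  have hsupp : Function.support (fun t => ∫ r in (0 : ℝ)..t, ψ r) ⊆ Icc a b := by
    intro t ht
    by_contra hn
    refine ht ?_
    change ∫ r in (0 : ℝ)..t, ψ r = 0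
    rcases lt_or_ge b a with hba | hba
    · have hz : ∀ r, ψ r = 0 := fun r => image_eq_zero_of_notMem_tsupport fun h => by
        have := hab h
        rw [Icc_eq_empty (not_le.2 hba)] at this
        exact this
      simp [hz]
    have ha := (habT (left_mem_Icc.2 hba)).1
    rcases lt_or_ge t a with hta | hta
    · have : ∀ r ∈ uIcc 0 t, ψ r = 0 := fun r hr => image_eq_zero_of_notMem_tsupport fun h => by
        have h1 := (hab h).1
        rcases mem_uIcc.1 hr with h2 | h2 <;> linarith [h2.1, h2.2]
      rw [intervalIntegral.integral_congr (g := fun _ => (0 : ℝ)) this]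
      simp
    · have htb : b < t := by
        by_contra h
        exact hn ⟨hta, not_lt.1 h⟩
      -- Beyond `b` the interval contains the whole support, so the primitive equals the total
      -- integral, which is zero.
      rw [intervalIntegral.integral_eq_integral_of_support_subset, h0]
      intro r hr
      have := hab (subset_tsupport _ hr)
      exact ⟨by linarith [this.1], by linarith [this.2]⟩
  have hts : tsupport (fun t => ∫ r in (0 : ℝ)..t, ψ r) ⊆ Icc a b :=
    closure_minimal hsupp isClosed_Icc
  refine ⟨_, ?_, HasCompactSupport.of_support_subset_isCompact isCompact_Icc hsupp,
    hts.trans habT, hde⟩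
  rw [contDiff_infty_iff_deriv, hde]
  exact ⟨fun t => (hder t).differentiableAt, hψ⟩

lemma exists_test_integral_eq_one (hT : 0 < T) : ∃ η : ℝ → ℝ, ContDiff ℝ ∞ η ∧
    HasCompactSupport η ∧ tsupport η ⊆ Ioo 0 T ∧ ∫ t, η t = 1 := by
  let b : ContDiffBump (T / 2) := ⟨T / 8, T / 4, by positivity, by linarith⟩
  refine ⟨b.normed volume, b.contDiff_normed, b.hasCompactSupport_normed, ?_, b.integral_normed⟩
  rw [b.tsupport_normed_eq, Real.closedBall_eq_Icc]
  intro t ht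
  have h1 : T / 2 - T / 4 ≤ t := ht.1
  have h2 : t ≤ T / 2 + T / 4 := ht.2
  exact ⟨by linarith, by linarith⟩

/-- The lemma of du Bois-Reymond. -/
lemma HasWeakTimeDeriv.exists_ae_eq {p q : ℝ → ℝ} (hT : 0 < T) (h : HasWeakTimeDeriv T p q) :
    ∃ c : ℝ, ∀ᵐ t ∂timeMeasure T, p t = c + ∫ r in (0 : ℝ)..t, q r := by
  obtain ⟨η, hη, hηc, hηs, hη1⟩ := exists_test_integral_eq_one hT
  set r : ℝ → ℝ := fun t => p t - ∫ r in (0 : ℝ)..t, q r with hr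
  have hQ : Integrable (fun t => ∫ r in (0 : ℝ)..t, q r) (timeMeasure T) :=
    integrable_of_memLp_top (continuousOn_primitive_time hT.le h.2.1).memLp_top_time
  have hri : Integrable r (timeMeasure T) := h.1.sub hQ
  have hr0 : ∀ Ψ : ℝ → ℝ, ContDiff ℝ ∞ Ψ → HasCompactSupport Ψ → tsupport Ψ ⊆ Ioo 0 T →
      ∫ t, deriv Ψ t * r t ∂timeMeasure T = 0 := fun Ψ h1 h2 h3 => by
    have hd : Continuous (deriv Ψ) := h1.continuous_deriv (by simp)
    simp only [hr, mul_sub]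
    rw [integral_sub (integrable_mul_of_continuous hd h.1) (integrable_mul_of_continuous hd hQ),
      integral_deriv_mul_primitive hT.le h.2.1 h1 h3]
    have := h.2.2 Ψ h1 h2 h3
    simp only [smul_eq_mul] at this
    rw [this, sub_self]
  set c := ∫ t, η t * r t ∂timeMeasure T with hc
  have hfull : ∀ ψ : ℝ → ℝ, tsupport ψ ⊆ Ioo 0 T → ∫ t, ψ t ∂timeMeasure T = ∫ t, ψ t :=
    fun ψ hs => setIntegral_eq_integral_of_forall_compl_eq_zero fun t ht =>
      image_eq_zero_of_notMem_tsupport fun h => ht (hs h)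
  refine ⟨c, ?_⟩
  -- Subtracting `m η` makes the mean of `ψ` vanish, so the difference is the derivative of a test
  -- function and is annihilated by `r`. What remains is `∫ ψ r = m c`, whence the choice of `c`.
  have hz := ae_eq_zero_of_integral_test (hri.sub (integrable_const c)) fun ψ h1 h2 h3 => by
    set m := ∫ t, ψ t with hm
    have hsub : tsupport (fun t => ψ t - m * η t) ⊆ tsupport ψ ∪ tsupport η := by
      refine closure_minimal (fun t ht => ?_) ((isClosed_tsupport _).union (isClosed_tsupport _))
      by_contra hn
      rw [mem_union, not_or] at hn
      exact ht (by simp [image_eq_zero_of_notMem_tsupport hn.1,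
        image_eq_zero_of_notMem_tsupport hn.2])
    obtain ⟨Ψ, g1, g2, g3, g4⟩ := exists_test_primitive (T := T) (ψ := fun t => ψ t - m * η t)
      (h1.sub (contDiff_const.mul hη))
      (HasCompactSupport.of_support_subset_isCompact (IsCompact.union h2 hηc)
        ((subset_tsupport _).trans hsub))
      (hsub.trans (union_subset h3 hηs)) (by
        rw [integral_sub (h1.continuous.integrable_of_hasCompactSupport h2)
          ((hη.continuous.integrable_of_hasCompactSupport hηc).const_mul m), integral_const_mul,
          hη1, mul_one, hm, sub_self])
    have e := hr0 Ψ g1 g2 g3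
    rw [g4] at e
    simp only [sub_mul, mul_assoc] at e
    rw [integral_sub (integrable_mul_of_continuous h1.continuous hri)
      ((integrable_mul_of_continuous hη.continuous hri).const_mul m), integral_const_mul] at e
    simp only [Pi.sub_apply, mul_sub]
    rw [integral_sub (integrable_mul_of_continuous h1.continuous hri)
      (integrable_mul_of_continuous h1.continuous (integrable_const c)), integral_mul_const,
      hfull ψ h3]
    exact e
  filter_upwards [hz] with t ht
  have : p t - (∫ r in (0 : ℝ)..t, q r) - c = 0 := ht
  linarith

lemma eq_of_ae_eq_time {u v : ℝ → Z} (hT : 0 < T) (hu : ContinuousOn u (Icc 0 T))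
    (hv : ContinuousOn v (Icc 0 T)) (h : u =ᵐ[timeMeasure T] v) : EqOn u v (Icc 0 T) := by
  refine Measure.eqOn_Icc_of_ae_eq volume hT.ne ?_ hu hv
  rwa [← restrict_Ioo_eq_restrict_Icc]

/-- Two continuous representatives agree everywhere, in particular at `0`, where the primitive
vanishes; this identifies the constant of integration. -/
lemma HasWeakTimeDeriv.ae_eq {p q : ℝ → ℝ} {x : ℝ} (hT : 0 < T) (h : HasWeakTimeDeriv T p q)
    (hx : HasInitialValue T p x) : ∀ᵐ t ∂timeMeasure T, p t = x + ∫ r in (0 : ℝ)..t, q r := by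
  obtain ⟨c, hc⟩ := h.exists_ae_eq hT
  obtain ⟨v, hv, hpv, hv0⟩ := hx
  have := eq_of_ae_eq_time hT hv ((continuousOn_primitive_time hT.le h.2.1).const_add c) (by
    filter_upwards [hc, hpv] with t h1 h2
    rw [← h2, h1]) (left_mem_Icc.2 hT.le)
  simp only [intervalIntegral.integral_same, add_zero] at this
  rw [← hv0, this]
  exact hc

lemma HasInitialValue.unique {u u' : ℝ → Z} {x y : Z} (hT : 0 < T) (hx : HasInitialValue T u x)
    (hy : HasInitialValue T u' y) (h : u =ᵐ[timeMeasure T] u') : x = y := by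
  obtain ⟨v, hv, huv, hv0⟩ := hx
  obtain ⟨v', hv', huv', hv0'⟩ := hy
  rw [← hv0, ← hv0']
  exact eq_of_ae_eq_time hT hv hv' (huv.symm.trans (h.trans huv')) (left_mem_Icc.2 hT.le)

end WeakDerivative

namespace EllipticOperator.EigenSystem

variable {n : ℕ} {L : EllipticOperator n} (S : L.EigenSystem)

/-- The coefficient functionals commute with the integrals and separate points, so scalar integral
identities suffice. -/
lemma hasWeakTimeDeriv_of_coeff {T : ℝ} (hT : 0 ≤ T) {p q : ℝ → L.L2}
    (hp : Integrable p (timeMeasure T)) (hq : Integrable q (timeMeasure T)) (c : ℕ → ℝ)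
    (h : ∀ k, ∀ t ∈ Ioo 0 T, S.coeff (p t) k = c k + ∫ r in (0 : ℝ)..t, S.coeff (q r) k) :
    HasWeakTimeDeriv T p q := by
  refine ⟨hp, hq, fun ψ h1 h2 h3 => S.ext_coeff fun k => ?_⟩
  have hd : Continuous (deriv ψ) := h1.continuous_deriv (by simp)
  have := (hasWeakTimeDeriv_primitive hT ((S.coeffL k).integrable_comp hq) (c k)
    (h k)).2.2 ψ h1 h2 h3
  rw [coeff_neg, ← coeffL_apply, ← coeffL_apply,
    ← (S.coeffL k).integral_comp_comm (integrable_smul_of_continuous hd hp),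
    ← (S.coeffL k).integral_comp_comm (integrable_smul_of_continuous h1.continuous hq)]
  simp only [map_smul]
  exact this

end EllipticOperator.EigenSystem

end

/-! ### The scalar fractional equation -/

noncomputable section

section Scalar

variable {γ μ σ T : ℝ}

lemma mlKernel_zero_one (γ t : ℝ) : mlKernel γ 0 1 t = 1 := by
  simp [mlKernel_lam_zero]

lemma intervalIntegral_congr_Ioo {f g : ℝ → ℝ} {t : ℝ} (ht : 0 ≤ t)
    (h : ∀ r ∈ Ioo 0 t, f r = g r) : ∫ r in (0 : ℝ)..t, f r = ∫ r in (0 : ℝ)..t, g r := by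
  rw [intervalIntegral.integral_of_le ht, intervalIntegral.integral_of_le ht,
    integral_Ioc_eq_integral_Ioo, integral_Ioc_eq_integral_Ioo]
  exact setIntegral_congr_fun measurableSet_Ioo h

lemma intervalIntegral_congr_ae_time {f g : ℝ → ℝ} {t : ℝ} (h0 : 0 ≤ t) (hT : t ≤ T)
    (h : ∀ᵐ r ∂timeMeasure T, f r = g r) :
    ∫ r in (0 : ℝ)..t, f r = ∫ r in (0 : ℝ)..t, g r := by
  rw [intervalIntegral.integral_of_le h0, intervalIntegral.integral_of_le h0,
    integral_Ioc_eq_integral_Ioo, integral_Ioc_eq_integral_Ioo]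
  exact integral_congr_ae (ae_restrict_of_ae_restrict_of_subset (Ioo_subset_Ioo_right hT) h)

lemma exists_ae_abs_le {F : ℝ → ℝ} (hF : MemLp F ⊤ (timeMeasure T)) :
    ∃ B : ℝ, ∀ᵐ r ∂timeMeasure T, ‖F r‖ ≤ B := by
  refine ⟨(eLpNorm F ⊤ (timeMeasure T)).toReal, ?_⟩
  filter_upwards [enorm_ae_le_eLpNormEssSup F (timeMeasure T)] with r hr
  rw [← toReal_enorm]
  exact ENNReal.toReal_mono hF.2.ne (by simpa using hr)

lemma intervalIntegrable_mlKernel (hγ : 1 ≤ γ) (hμ : 0 < μ) (lam : ℝ) {t : ℝ} (ht : 0 ≤ t) :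
    IntervalIntegrable (mlKernel γ lam μ) volume 0 t :=
  (intervalIntegrable_iff_integrableOn_Ioo_of_le ht).2 (integrableOn_mlKernel hγ hμ lam t)

lemma intervalIntegrable_mlKernel_mul (hγ : 1 ≤ γ) (hμ : 0 < μ) (lam : ℝ) {F : ℝ → ℝ}
    (hF : MemLp F ⊤ (timeMeasure T)) {t : ℝ} (h0 : 0 ≤ t) (hT : t ≤ T) :
    IntervalIntegrable (fun r => mlKernel γ lam μ (t - r) * F r) volume 0 t := by
  obtain ⟨B, hB⟩ := exists_ae_abs_le hF
  have h := ((intervalIntegrable_mlKernel hγ hμ lam h0).comp_sub_left t).symm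
  rw [sub_self, sub_zero, intervalIntegrable_iff_integrableOn_Ioo_of_le h0] at h
  rw [intervalIntegrable_iff_integrableOn_Ioo_of_le h0]
  exact h.mul_bdd (c := B)
    (hF.1.mono_measure (Measure.restrict_mono (Ioo_subset_Ioo_right hT) le_rfl))
    (ae_restrict_of_ae_restrict_of_subset (Ioo_subset_Ioo_right hT) hB)

lemma integral_mlKernel (hγ : 1 ≤ γ) (hμ : 0 < μ) (lam : ℝ) {t : ℝ} (ht : 0 < t) :
    ∫ r in (0 : ℝ)..t, mlKernel γ lam μ r = mlKernel γ lam (μ + 1) t := by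
  simpa only [mlKernel_zero_one, one_mul] using
    integral_mlKernel_mul_mlKernel hγ one_pos hμ lam ht

/-- The convolution of `F` with the kernel of index `μ`. -/
def mlConv (γ lam μ : ℝ) (F : ℝ → ℝ) (t : ℝ) : ℝ :=
  ∫ r in (0 : ℝ)..t, mlKernel γ lam μ (t - r) * F r

lemma mlConv_zero_one (F : ℝ → ℝ) (t : ℝ) : mlConv γ 0 1 F t = ∫ r in (0 : ℝ)..t, F r := by
  simp only [mlConv, mlKernel_zero_one, one_mul]

lemma mlConv_mlConv (hγ : 1 ≤ γ) (hσ : 0 < σ) (hμ : 0 < μ) (lam : ℝ) {F : ℝ → ℝ}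
    (hF : MemLp F ⊤ (timeMeasure T)) {t : ℝ} (ht : t ∈ Icc 0 T) :
    mlConv γ 0 σ (mlConv γ lam μ F) t = mlConv γ lam (μ + σ) F t := by
  obtain ⟨B, hB⟩ := exists_ae_abs_le hF
  exact mlKernel_convolution_assoc hγ hσ hμ lam hF.1 hB ht.1 ht.2

lemma integral_mlConv (hγ : 1 ≤ γ) (hμ : 0 < μ) (lam : ℝ) {F : ℝ → ℝ}
    (hF : MemLp F ⊤ (timeMeasure T)) {t : ℝ} (ht : t ∈ Icc 0 T) :
    ∫ r in (0 : ℝ)..t, mlConv γ lam μ F r = mlConv γ lam (μ + 1) F t := by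
  rw [← mlConv_zero_one (γ := γ), mlConv_mlConv hγ one_pos hμ lam hF ht]

lemma mlConv_eq_sub (hγ : 1 ≤ γ) (hμ : 0 < μ) (lam : ℝ) {F : ℝ → ℝ}
    (hF : MemLp F ⊤ (timeMeasure T)) {t : ℝ} (ht : t ∈ Icc 0 T) :
    mlConv γ lam μ F t = mlConv γ 0 μ F t - lam * mlConv γ lam (μ + γ) F t := by
  rw [mlConv, mlConv, mlConv, ← intervalIntegral.integral_const_mul, ← intervalIntegral.integral_sub
    (intervalIntegrable_mlKernel_mul hγ hμ 0 hF ht.1 ht.2)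
    ((intervalIntegrable_mlKernel_mul hγ (by linarith) lam hF ht.1 ht.2).const_mul lam)]
  refine intervalIntegral_congr_Ioo ht.1 fun r hr => ?_
  rw [mlKernel_eq_sub hγ hμ lam (by linarith [hr.2])]
  ring

/-- The coefficients of the solution are primitives of those of its derivative. -/
lemma solution_eq_integral (hγ : 1 < γ) (lam g h : ℝ) {F : ℝ → ℝ}
    (hF : MemLp F ⊤ (timeMeasure T)) (hm : ContinuousOn (mlConv γ lam (γ - 1) F) (Icc 0 T)) {t : ℝ}
    (ht : t ∈ Ioc 0 T) :
    mlKernel γ lam 1 t * g + mlKernel γ lam 2 t * h + mlConv γ lam γ F t =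
      g + ∫ r in (0 : ℝ)..t, (-(lam * mlKernel γ lam γ r * g) + mlKernel γ lam 1 r * h +
        mlConv γ lam (γ - 1) F r) := by
  have hγ' := hγ.le
  have i1 := intervalIntegrable_mlKernel hγ' (by linarith : 0 < γ) lam ht.1.le
  have i2 := intervalIntegrable_mlKernel hγ' one_pos lam ht.1.le
  have i3 : IntervalIntegrable (mlConv γ lam (γ - 1) F) volume 0 t :=
    intervalIntegrable_of_time (integrable_of_memLp_top hm.memLp_top_time) ht.1.le ht.2
  have i4 : IntervalIntegrable (fun r => -(lam * mlKernel γ lam γ r * g)) volume 0 t :=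
    ((i1.const_mul lam).mul_const g).neg
  rw [intervalIntegral.integral_add (i4.add (i2.mul_const h)) i3,
    intervalIntegral.integral_add i4 (i2.mul_const h),
    intervalIntegral.integral_neg, intervalIntegral.integral_mul_const,
    intervalIntegral.integral_mul_const, intervalIntegral.integral_const_mul,
    integral_mlKernel hγ' (by linarith) lam ht.1, integral_mlKernel hγ' one_pos lam ht.1,
    integral_mlConv hγ' (by linarith) lam hF ⟨ht.1.le, ht.2⟩,
    mlKernel_eq_sub hγ' one_pos lam ht.1, mlKernel_zero_one, sub_add_cancel, one_add_one_eq_two,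
    add_comm 1 γ]
  ring

/-- The coefficients of the solution satisfy the integrated equation. -/
lemma solution_caputo (hγ1 : 1 < γ) (hγ2 : γ < 2) (lam g h : ℝ) {F : ℝ → ℝ}
    (hF : MemLp F ⊤ (timeMeasure T)) (hm : ContinuousOn (mlConv γ lam (γ - 1) F) (Icc 0 T))
    (hm' : ContinuousOn (mlConv γ lam γ F) (Icc 0 T)) {t : ℝ} (ht : t ∈ Ioc 0 T) :
    mlConv γ 0 (2 - γ) (fun r => -(lam * mlKernel γ lam γ r * g) + mlKernel γ lam 1 r * h +
        mlConv γ lam (γ - 1) F r - h) t =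
      ∫ r in (0 : ℝ)..t, (F r - lam *
        (mlKernel γ lam 1 r * g + mlKernel γ lam 2 r * h + mlConv γ lam γ F r)) := by
  have hγ' := hγ1.le
  have ht' : t ∈ Icc 0 T := ⟨ht.1.le, ht.2⟩
  have hk : ∀ μ, 1 ≤ μ → MemLp (mlKernel γ lam μ) ⊤ (timeMeasure T) := fun μ hμ =>
    (continuous_mlKernel hγ' hμ lam).continuousOn.memLp_top_time
  have j : ∀ F : ℝ → ℝ, MemLp F ⊤ (timeMeasure T) →
      IntervalIntegrable (fun r => mlKernel γ 0 (2 - γ) (t - r) * F r) volume 0 t := fun F hF =>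
    intervalIntegrable_mlKernel_mul hγ' (by linarith) 0 hF ht.1.le ht.2
  have e1 : mlConv γ 0 (2 - γ) (fun r => -(lam * mlKernel γ lam γ r * g) + mlKernel γ lam 1 r * h +
      mlConv γ lam (γ - 1) F r - h) t = ∫ r in (0 : ℝ)..t,
        (-(lam * g) * (mlKernel γ 0 (2 - γ) (t - r) * mlKernel γ lam γ r) +
        -(lam * h) * (mlKernel γ 0 (2 - γ) (t - r) * mlKernel γ lam (γ + 1) r) +
        mlKernel γ 0 (2 - γ) (t - r) * mlConv γ lam (γ - 1) F r) := by
    refine intervalIntegral_congr_Ioo ht.1.le fun r hr => ?_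
    beta_reduce
    -- `K_1 = 1 - lam K_{γ+1}`, so subtracting `h` cancels the constant part of `K_1 h`.
    rw [mlKernel_eq_sub hγ' one_pos lam hr.1, mlKernel_zero_one, add_comm 1 γ]
    ring
  have i1 := intervalIntegrable_mlKernel hγ' one_pos lam ht.1.le
  have i2 := intervalIntegrable_mlKernel hγ' two_pos lam ht.1.le
  have i3 : IntervalIntegrable (mlConv γ lam γ F) volume 0 t :=
    intervalIntegrable_of_time (integrable_of_memLp_top hm'.memLp_top_time) ht.1.le ht.2
  have i4 : IntervalIntegrable F volume 0 t :=
    intervalIntegrable_of_time (integrable_of_memLp_top hF) ht.1.le ht.2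
  have e2 := mlConv_mlConv hγ' (by linarith : 0 < 2 - γ) (by linarith : 0 < γ - 1) lam hF ht'
  rw [mlConv] at e2
  -- Convolution of order `2 - γ` shifts the indices `γ`, `γ + 1`, `γ - 1` on the left to `2`, `3`,
  -- `1`. Integration shifts `1`, `2`, `γ` on the right to `2`, `3`, `γ + 1`. The source terms then
  -- match because `K_1 = 1 - lam K_{γ+1}`.
  rw [e1, intervalIntegral.integral_add (((j _ (hk γ hγ')).const_mul _).add
      ((j _ (hk (γ + 1) (by linarith))).const_mul _)) (j _ hm.memLp_top_time),
    intervalIntegral.integral_add ((j _ (hk γ hγ')).const_mul _)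
      ((j _ (hk (γ + 1) (by linarith))).const_mul _),
    intervalIntegral.integral_const_mul, intervalIntegral.integral_const_mul,
    integral_mlKernel_mul_mlKernel hγ' (by linarith) (by linarith) lam ht.1,
    integral_mlKernel_mul_mlKernel hγ' (by linarith) (by linarith) lam ht.1, e2,
    intervalIntegral.integral_sub i4 (((i1.mul_const g).add (i2.mul_const h)).add i3 |>.const_mul _),
    intervalIntegral.integral_const_mul,
    intervalIntegral.integral_add ((i1.mul_const g).add (i2.mul_const h)) i3,
    intervalIntegral.integral_add (i1.mul_const g) (i2.mul_const h),
    intervalIntegral.integral_mul_const, intervalIntegral.integral_mul_const,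
    integral_mlKernel hγ' one_pos lam ht.1, integral_mlKernel hγ' two_pos lam ht.1,
    integral_mlConv hγ' (by linarith) lam hF ht', ← mlConv_zero_one (γ := γ),
    show γ - 1 + (2 - γ) = 1 by ring, show γ + (2 - γ) = 1 + 1 by ring,
    show γ + 1 + (2 - γ) = 2 + 1 by ring, mlConv_eq_sub hγ' one_pos lam hF ht', add_comm 1 γ]
  ring

/-- The integral of order `γ - 1` is applied to the integrated equation: orders `2 - γ` and `γ - 1`
combine to `1` and recover `c`, while orders `1` and `γ - 1` combine to `γ`. -/
lemma ae_eq_volterra (hγ1 : 1 < γ) (hγ2 : γ < 2) {lam g h : ℝ} {F c d : ℝ → ℝ}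
    (hF : MemLp F ⊤ (timeMeasure T)) (hc : MemLp c ⊤ (timeMeasure T))
    (hd : MemLp d ⊤ (timeMeasure T))
    (hcd : ∀ᵐ t ∂timeMeasure T, c t = g + ∫ r in (0 : ℝ)..t, d r)
    (heq : ∀ᵐ t ∂timeMeasure T, mlConv γ 0 (2 - γ) (fun r => d r - h) t =
      ∫ r in (0 : ℝ)..t, (F r - lam * c r)) :
    ∀ᵐ t ∂timeMeasure T, c t = g + t * h + mlConv γ 0 γ (fun r => F r - lam * c r) t := by
  have hγ' := hγ1.le
  have hdh : MemLp (fun r => d r - h) ⊤ (timeMeasure T) := hd.sub (memLp_const h)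
  have hFc : MemLp (fun r => F r - lam * c r) ⊤ (timeMeasure T) := hF.sub (hc.const_mul lam)
  filter_upwards [hcd, ae_restrict_mem measurableSet_Ioo] with t h1 ht
  have ht' := Ioo_subset_Icc_self ht
  have e1 := mlConv_mlConv hγ' (by linarith : 0 < γ - 1) (by linarith : 0 < 2 - γ) 0 hdh ht'
  have e2 := mlConv_mlConv hγ' (by linarith : 0 < γ - 1) one_pos 0 hFc ht'
  have e3 : mlConv γ 0 (γ - 1) (mlConv γ 0 (2 - γ) fun r => d r - h) t =
      mlConv γ 0 (γ - 1) (mlConv γ 0 1 fun r => F r - lam * c r) t := by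
    refine intervalIntegral_congr_ae_time ht.1.le ht.2.le ?_
    filter_upwards [heq] with r hr
    rw [hr, mlConv_zero_one]
  rw [show 2 - γ + (γ - 1) = 1 by ring, mlConv_zero_one, intervalIntegral.integral_sub
    (intervalIntegrable_of_time (integrable_of_memLp_top hd) ht.1.le ht.2.le)
    intervalIntegrable_const] at e1
  rw [e1, e2, add_sub_cancel] at e3
  rw [h1, ← e3]
  simp

/-- Let `k` be the kernel of the integral of order `γ`. Convolving `z = -lam k * z` with `K_γ` gives
`K_γ * z = -lam K_{2γ} * z`. On the other hand `K_γ = k - lam K_{2γ}`, so `k * z = 0` and therefore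
`z = 0`. -/
lemma ae_eq_zero_of_volterra (hγ : 1 ≤ γ) {lam : ℝ} {z : ℝ → ℝ} (hz : MemLp z ⊤ (timeMeasure T))
    (h : ∀ᵐ t ∂timeMeasure T, z t = -(lam * mlConv γ 0 γ z t)) : z =ᵐ[timeMeasure T] 0 := by
  obtain ⟨B, hB⟩ := exists_ae_abs_le hz
  have hγ0 : 0 < γ := by linarith
  filter_upwards [h, ae_restrict_mem measurableSet_Ioo] with t h1 ht
  have ht' := Ioo_subset_Icc_self ht
  have e1 : mlConv γ lam γ z t = -(lam * mlConv γ lam γ (mlConv γ 0 γ z) t) := by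
    rw [mlConv, mlConv, ← intervalIntegral.integral_const_mul, ← intervalIntegral.integral_neg]
    refine intervalIntegral_congr_ae_time ht.1.le ht.2.le ?_
    filter_upwards [h] with r hr
    rw [hr]
    ring
  have e2 : mlConv γ lam γ (mlConv γ 0 γ z) t = mlConv γ lam (γ + γ) z t := by
    refine (intervalIntegral_convolution_assoc (integrableOn_mlKernel hγ hγ0 lam T)
      (integrableOn_mlKernel hγ hγ0 0 T) hz.1 hB ht.1.le ht.2.le).trans ?_
    refine intervalIntegral_congr_Ioo ht.1.le fun q hq => ?_
    rw [← integral_mlKernel_mul_mlKernel hγ hγ0 hγ0 lam (by linarith [hq.2] : 0 < t - q)]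
    -- The reflection `r ↦ t - q - r` exchanges the two factors, since the index-shift rule is
    -- stated with the fractional kernel on the left.
    have := intervalIntegral.integral_comp_sub_left (a := 0) (b := t - q)
      (fun r => mlKernel γ 0 γ (t - q - r) * mlKernel γ lam γ r) (t - q)
    rw [sub_self, sub_zero] at this
    rw [← this]
    simp only [sub_sub_cancel]
    congr 1
    exact intervalIntegral.integral_congr fun r _ => mul_comm _ _
  have e3 := mlConv_eq_sub hγ hγ0 lam hz ht'
  rw [e1, e2] at e3
  rw [h1, Pi.zero_apply, (by linarith : mlConv γ 0 γ z t = 0), mul_zero, neg_zero]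

lemma ae_eq_of_volterra (hγ : 1 ≤ γ) {lam : ℝ} {b F c c' : ℝ → ℝ}
    (hF : MemLp F ⊤ (timeMeasure T)) (hc : MemLp c ⊤ (timeMeasure T))
    (hc' : MemLp c' ⊤ (timeMeasure T))
    (h : ∀ᵐ t ∂timeMeasure T, c t = b t + mlConv γ 0 γ (fun r => F r - lam * c r) t)
    (h' : ∀ᵐ t ∂timeMeasure T, c' t = b t + mlConv γ 0 γ (fun r => F r - lam * c' r) t) :
    c =ᵐ[timeMeasure T] c' := by
  have hFc : ∀ c : ℝ → ℝ, MemLp c ⊤ (timeMeasure T) →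
      MemLp (fun r => F r - lam * c r) ⊤ (timeMeasure T) := fun c hc => hF.sub (hc.const_mul lam)
  have hz := ae_eq_zero_of_volterra hγ (lam := lam) (hc.sub hc') (by
    filter_upwards [h, h', ae_restrict_mem measurableSet_Ioo] with t h1 h2 ht
    have hγ0 : 0 < γ := by linarith
    rw [Pi.sub_apply, h1, h2, mlConv, mlConv, mlConv, add_sub_add_left_eq_sub,
      ← intervalIntegral.integral_sub
        (intervalIntegrable_mlKernel_mul hγ hγ0 0 (hFc c hc) ht.1.le ht.2.le)
        (intervalIntegrable_mlKernel_mul hγ hγ0 0 (hFc c' hc') ht.1.le ht.2.le),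
      ← intervalIntegral.integral_const_mul, ← intervalIntegral.integral_neg]
    refine intervalIntegral.integral_congr fun r _ => ?_
    simp only [Pi.sub_apply]
    ring)
  filter_upwards [hz] with t ht
  exact sub_eq_zero.1 ht

end Scalar

end

/-! ### Construction of the solution -/

noncomputable section

lemma integrableOn_rpow_smul {X : Type*} [NormedAddCommGroup X] [NormedSpace ℝ X] {T σ : ℝ}
    (hσ : 0 < σ) {u : ℝ → X} (hu : MemLp u ⊤ (timeMeasure T)) {t : ℝ} (ht : t ∈ Icc 0 T) :
    IntervalIntegrable (fun r => (t - r) ^ (σ - 1) • u r) volume 0 t := by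
  rw [intervalIntegrable_iff_integrableOn_Ioo_of_le ht.1]
  exact (EllipticOperator.EigenSystem.integrableOn_sub_rpow hσ ht.1).smul_of_top_left
    (hu.mono_measure (Measure.restrict_mono (Ioo_subset_Ioo_right ht.2) le_rfl))

lemma ContinuousLinearMap.map_fracIntegral {X Y : Type*} [NormedAddCommGroup X] [NormedSpace ℝ X]
    [NormedAddCommGroup Y] [NormedSpace ℝ Y] [CompleteSpace X] [CompleteSpace Y] (A : X →L[ℝ] Y)
    {T σ : ℝ} (hσ : 0 < σ) {u : ℝ → X} (hu : MemLp u ⊤ (timeMeasure T)) {t : ℝ}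
    (ht : t ∈ Icc 0 T) :
    A (fracIntegral σ u t) = fracIntegral σ (fun r => A (u r)) t := by
  rw [fracIntegral, fracIntegral, map_smul,
    ← A.intervalIntegral_comp_comm (integrableOn_rpow_smul hσ hu ht)]
  simp only [map_smul]

lemma IsSingularKernel.mono {T M M' β : ℝ} {a : ℝ → ℕ → ℝ} (h : IsSingularKernel T M β a)
    (hM : M ≤ M') : IsSingularKernel T M' β a where
  pos := h.pos
  le_one := h.le_one
  nonneg := h.nonneg.trans hM
  continuousOn := h.continuousOn
  bound t ht k := (h.bound t ht k).trans
    (mul_le_mul_of_nonneg_right hM (Real.rpow_nonneg ht.1.le _))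

namespace EllipticOperator.EigenSystem

variable {n : ℕ} {L : EllipticOperator n} (S : L.EigenSystem)

lemma diag_const (c : ℝ) (w : L.L2) : S.diag (fun _ => c) w = c • w :=
  S.ext_coeff fun k => by rw [coeff_diag (M := |c|) fun _ => le_rfl, coeff_smul]

lemma fracIntegral_eq_conv (γ σ : ℝ) (u : ℝ → L.L2) (t : ℝ) :
    fracIntegral σ u t = S.conv (fun t _ => mlKernel γ 0 σ t) u t := by
  rw [fracIntegral, conv, ← intervalIntegral.integral_smul]
  refine intervalIntegral.integral_congr fun r _ => ?_
  simp only [diag_const, mlKernel_lam_zero, smul_smul]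
  rw [mul_comm]

/-- The bounds for the Mittag-Leffler kernels that enter the solution and its derivative. -/
structure KernelBounds (s : ℝ≥0) (γ T M : ℝ) : Prop where
  zero_one : IsSingularKernel T M 1 (S.kern s γ 0 1)
  zero_one' : IsSingularKernel T M (γ / 2) (S.kern s γ 0 1)
  half_two : IsSingularKernel T M 1 (S.kern s γ (1 / 2) 2)
  half_gamma : IsSingularKernel T M (γ / 2) (S.kern s γ (1 / 2) γ)
  zero_gamma : IsSingularKernel T M 1 (S.kern s γ 0 γ)
  zero_sub_one : IsSingularKernel T M (γ - 1) (S.kern s γ 0 (γ - 1))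

/-- The exponents are admissible because `μ - θγ` is at least `β` in each case; for `θ = 1/2`, `μ =
2` this is `2 - γ/2 ≥ 1`. The kernel of `G_γ` also appears with the weaker exponent `γ/2`, so that
the `L²` bounds of the `g` and `h` terms share one constant. -/
lemma exists_kernelBounds (L : EllipticOperator n) (s : ℝ≥0) {γ T : ℝ} (hγ1 : 1 < γ) (hγ2 : γ < 2)
    (hT : 0 < T) : ∃ M : ℝ, ∀ S : L.EigenSystem, S.KernelBounds s γ T M := by
  obtain ⟨M₁, h₁⟩ := exists_isSingularKernel_kern L s (γ := γ) (θ := 0) (μ := 1) (β := 1) hγ1 hγ2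
    (by norm_num) (by linarith) le_rfl zero_le_one one_pos le_rfl (by linarith) hT
  obtain ⟨M₂, h₂⟩ := exists_isSingularKernel_kern L s (γ := γ) (θ := 0) (μ := 1) (β := γ / 2) hγ1
    hγ2 (by norm_num) (by linarith) le_rfl zero_le_one (by linarith) (by linarith) (by linarith) hT
  obtain ⟨M₃, h₃⟩ := exists_isSingularKernel_kern L s (γ := γ) (θ := 1 / 2) (μ := 2) (β := 1) hγ1
    hγ2 (by norm_num) (by linarith) (by norm_num) (by norm_num) one_pos le_rfl (by linarith) hT
  obtain ⟨M₄, h₄⟩ := exists_isSingularKernel_kern L s (γ := γ) (θ := 1 / 2) (μ := γ) (β := γ / 2)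
    hγ1 hγ2 (by linarith) (by linarith) (by norm_num) (by norm_num) (by linarith) (by linarith)
    (by linarith) hT
  obtain ⟨M₅, h₅⟩ := exists_isSingularKernel_kern L s (γ := γ) (θ := 0) (μ := γ) (β := 1) hγ1 hγ2
    (by linarith) (by linarith) le_rfl zero_le_one one_pos le_rfl (by linarith) hT
  obtain ⟨M₆, h₆⟩ := exists_isSingularKernel_kern L s (γ := γ) (θ := 0) (μ := γ - 1) (β := γ - 1)
    hγ1 hγ2 (by linarith) (by linarith) le_rfl zero_le_one (by linarith) (by linarith)
    (by linarith) hT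
  refine ⟨max (max (max M₁ M₂) (max M₃ M₄)) (max M₅ M₆), fun S =>
    ⟨(h₁ S).mono ?_, (h₂ S).mono ?_, (h₃ S).mono ?_, (h₄ S).mono ?_, (h₅ S).mono ?_,
      (h₆ S).mono ?_⟩⟩ <;> simp

/-- `𝓛^{s/2} u(t)` for the solution `u`, in terms of `G = 𝓛^{s/2} g`, `h` and `f`. -/
def solution (s : ℝ≥0) (γ : ℝ) (f : ℝ → L.L2) (G h : L.L2) (t : ℝ) : L.L2 :=
  S.diag (S.kern s γ 0 1 t) G + S.diag (S.kern s γ (1 / 2) 2 t) h +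
    S.conv (S.kern s γ (1 / 2) γ) f t

/-- `∂ₜ u(t)` for the solution `u`, in terms of `G = 𝓛^s g`, `h` and `f`. -/
def solutionDeriv (s : ℝ≥0) (γ : ℝ) (f : ℝ → L.L2) (G h : L.L2) (t : ℝ) : L.L2 :=
  -S.diag (S.kern s γ 0 γ t) G + S.diag (S.kern s γ 0 1 t) h + S.conv (S.kern s γ 0 (γ - 1)) f t

variable {S} {s : ℝ≥0} {γ T M : ℝ} {f : ℝ → L.L2} {g G h : L.L2}

lemma memLp_coeff (hf : MemLp f ⊤ (timeMeasure T)) (k : ℕ) :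
    MemLp (fun r => S.coeff (f r) k) ⊤ (timeMeasure T) :=
  hf.continuousLinearMap_comp (S.coeffL k)

lemma coeff_conv_kern_zero {μ β : ℝ} (ha : IsSingularKernel T M β (S.kern s γ 0 μ))
    (hf : MemLp f ⊤ (timeMeasure T)) {t : ℝ} (ht : t ∈ Icc 0 T) (k : ℕ) :
    S.coeff (S.conv (S.kern s γ 0 μ) f t) k =
      mlConv γ (S.lam k ^ (s : ℝ)) μ (fun r => S.coeff (f r) k) t := by
  rw [coeff_conv ha hf ht.1 ht.2, mlConv]
  simp only [kern_zero]

lemma coeff_conv_kern_half {μ β : ℝ} (ha : IsSingularKernel T M β (S.kern s γ (1 / 2) μ))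
    (hf : MemLp f ⊤ (timeMeasure T)) {t : ℝ} (ht : t ∈ Icc 0 T) (k : ℕ) :
    S.coeff (S.conv (S.kern s γ (1 / 2) μ) f t) k =
      S.lam k ^ ((s : ℝ) / 2) * mlConv γ (S.lam k ^ (s : ℝ)) μ (fun r => S.coeff (f r) k) t := by
  rw [coeff_conv ha hf ht.1 ht.2, mlConv, ← intervalIntegral.integral_const_mul]
  simp only [kern_half, mul_assoc]

lemma continuousOn_mlConv_coeff {μ β : ℝ} (ha : IsSingularKernel T M β (S.kern s γ 0 μ))
    (hf : MemLp f ⊤ (timeMeasure T)) (k : ℕ) : ContinuousOn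
      (mlConv γ (S.lam k ^ (s : ℝ)) μ (fun r => S.coeff (f r) k)) (Icc 0 T) :=
  ((S.coeffL k).continuous.comp_continuousOn (continuousOn_conv ha hf)).congr fun _ ht =>
    (coeff_conv_kern_zero ha hf ht k).symm

lemma continuousOn_diag_kern {θ μ : ℝ} (hγ : 1 ≤ γ) (hμ : 1 ≤ μ) (hT : 0 < T)
    (ha : IsSingularKernel T M 1 (S.kern s γ θ μ)) (w : L.L2) :
    ContinuousOn (fun t => S.diag (S.kern s γ θ μ t) w) (Icc 0 T) :=
  continuousOn_diag (fun _ ht => ha.bound_one hT (S.continuous_kern hγ hμ) ht)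
    (fun k => (S.continuous_kern hγ hμ k).continuousOn) w

lemma continuousOn_solution (hγ : 1 < γ) (hT : 0 < T) (hk : S.KernelBounds s γ T M)
    (hf : MemLp f ⊤ (timeMeasure T)) : ContinuousOn (S.solution s γ f G h) (Icc 0 T) :=
  ((continuousOn_diag_kern hγ.le le_rfl hT hk.zero_one G).add
    (continuousOn_diag_kern hγ.le (by norm_num) hT hk.half_two h)).add
    (continuousOn_conv hk.half_gamma hf)

lemma continuousOn_solutionDeriv (hγ : 1 < γ) (hT : 0 < T) (hk : S.KernelBounds s γ T M)
    (hf : MemLp f ⊤ (timeMeasure T)) : ContinuousOn (S.solutionDeriv s γ f G h) (Icc 0 T) :=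
  ((continuousOn_diag_kern hγ.le hγ.le hT hk.zero_gamma G).neg.add
    (continuousOn_diag_kern hγ.le le_rfl hT hk.zero_one h)).add
    (continuousOn_conv hk.zero_sub_one hf)

lemma coeff_diag_kern {θ μ : ℝ} (hγ : 1 ≤ γ) (hμ : 1 ≤ μ) (hT : 0 < T)
    (ha : IsSingularKernel T M 1 (S.kern s γ θ μ)) (w : L.L2) {t : ℝ} (ht : t ∈ Icc 0 T) (k : ℕ) :
    S.coeff (S.diag (S.kern s γ θ μ t) w) k = S.kern s γ θ μ t k * S.coeff w k :=
  coeff_diag (ha.bound_one hT (S.continuous_kern hγ hμ) ht) w k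

lemma coeff_solution (hγ : 1 < γ) (hT : 0 < T) (hk : S.KernelBounds s γ T M)
    (hf : MemLp f ⊤ (timeMeasure T)) (hG : ∀ k, S.coeff G k = S.wcoeff s g k) {t : ℝ}
    (ht : t ∈ Icc 0 T) (k : ℕ) : S.coeff (S.solution s γ f G h t) k = S.lam k ^ ((s : ℝ) / 2) *
      (mlKernel γ (S.lam k ^ (s : ℝ)) 1 t * S.coeff g k +
        mlKernel γ (S.lam k ^ (s : ℝ)) 2 t * S.coeff h k +
        mlConv γ (S.lam k ^ (s : ℝ)) γ (fun r => S.coeff (f r) k) t) := by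
  rw [solution, coeff_add, coeff_add, coeff_diag_kern hγ.le le_rfl hT hk.zero_one G ht,
    coeff_diag_kern hγ.le (by norm_num) hT hk.half_two h ht, coeff_conv_kern_half hk.half_gamma hf ht,
    hG, wcoeff, kern_zero, kern_half]
  ring

lemma coeff_incl_solution (hγ : 1 < γ) (hT : 0 < T) (hk : S.KernelBounds s γ T M)
    (hf : MemLp f ⊤ (timeMeasure T)) (hG : ∀ k, S.coeff G k = S.wcoeff s g k) {t : ℝ}
    (ht : t ∈ Icc 0 T) (k : ℕ) :
    S.coeff (S.incl s (S.lift s (S.solution s γ f G h t))) k =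
      mlKernel γ (S.lam k ^ (s : ℝ)) 1 t * S.coeff g k +
        mlKernel γ (S.lam k ^ (s : ℝ)) 2 t * S.coeff h k +
        mlConv γ (S.lam k ^ (s : ℝ)) γ (fun r => S.coeff (f r) k) t := by
  rw [coeff_incl_lift, coeff_solution hγ hT hk hf hG ht, ← mul_assoc,
    ← Real.rpow_add (S.lam_pos k), neg_add_cancel, Real.rpow_zero, one_mul]

lemma coeff_solutionDeriv (hγ : 1 < γ) (hT : 0 < T) (hk : S.KernelBounds s γ T M)
    (hf : MemLp f ⊤ (timeMeasure T)) (hG : ∀ k, S.coeff G k = S.wcoeff (2 * s) g k) {t : ℝ}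
    (ht : t ∈ Icc 0 T) (k : ℕ) : S.coeff (S.solutionDeriv s γ f G h t) k =
      -(S.lam k ^ (s : ℝ) * mlKernel γ (S.lam k ^ (s : ℝ)) γ t * S.coeff g k) +
        mlKernel γ (S.lam k ^ (s : ℝ)) 1 t * S.coeff h k +
        mlConv γ (S.lam k ^ (s : ℝ)) (γ - 1) (fun r => S.coeff (f r) k) t := by
  rw [solutionDeriv, coeff_add, coeff_add, coeff_neg,
    coeff_diag_kern hγ.le hγ.le hT hk.zero_gamma G ht,
    coeff_diag_kern hγ.le le_rfl hT hk.zero_one h ht, coeff_conv_kern_zero hk.zero_sub_one hf ht,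
    hG, wcoeff, kern_zero, kern_zero, NNReal.coe_mul, NNReal.coe_ofNat,
    mul_div_cancel_left₀ _ (two_ne_zero' ℝ)]
  ring

lemma mlConv_at_zero (γ lam μ : ℝ) (F : ℝ → ℝ) : mlConv γ lam μ F 0 = 0 := by
  rw [mlConv, intervalIntegral.integral_same]

lemma mlKernel_at_zero {γ μ : ℝ} (lam : ℝ) (hμ : 1 < μ) : mlKernel γ lam μ 0 = 0 := by
  rw [mlKernel, Real.zero_rpow (by linarith), zero_mul]

lemma mlKernel_one_at_zero {γ : ℝ} (lam : ℝ) (hγ : 0 < γ) : mlKernel γ lam 1 0 = 1 := by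
  rw [mlKernel, Real.zero_rpow hγ.ne', mul_zero, neg_zero, mittagLeffler_zero]
  simp

lemma incl_solution_zero (hγ : 1 < γ) (hT : 0 < T) (hk : S.KernelBounds s γ T M)
    (hf : MemLp f ⊤ (timeMeasure T)) (hG : ∀ k, S.coeff G k = S.wcoeff s g k) :
    S.incl s (S.lift s (S.solution s γ f G h 0)) = g := S.ext_coeff fun k => by
  rw [coeff_incl_solution hγ hT hk hf hG (left_mem_Icc.2 hT.le), mlConv_at_zero,
    mlKernel_at_zero _ one_lt_two, mlKernel_one_at_zero _ (by linarith)]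
  ring

lemma solutionDeriv_zero (hγ : 1 < γ) (hT : 0 < T) (hk : S.KernelBounds s γ T M)
    (hf : MemLp f ⊤ (timeMeasure T)) (hG : ∀ k, S.coeff G k = S.wcoeff (2 * s) g k) :
    S.solutionDeriv s γ f G h 0 = h := S.ext_coeff fun k => by
  rw [coeff_solutionDeriv hγ hT hk hf hG (left_mem_Icc.2 hT.le), mlConv_at_zero,
    mlKernel_at_zero _ hγ, mlKernel_one_at_zero _ (by linarith)]
  ring

variable {G' : L.L2}

lemma hasWeakTimeDeriv_solution (hγ : 1 < γ) (hT : 0 < T) (hk : S.KernelBounds s γ T M)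
    (hf : MemLp f ⊤ (timeMeasure T)) (hG : ∀ k, S.coeff G k = S.wcoeff s g k)
    (hG' : ∀ k, S.coeff G' k = S.wcoeff (2 * s) g k) :
    HasWeakTimeDeriv T (fun t => S.incl s (S.lift s (S.solution s γ f G h t)))
      (S.solutionDeriv s γ f G' h) := by
  refine S.hasWeakTimeDeriv_of_coeff hT.le ?_ ?_ (S.coeff g) fun k t ht => ?_
  · exact integrable_of_memLp_top (((S.incl s).continuous.comp
      (S.lift s).continuous).comp_continuousOn (continuousOn_solution hγ hT hk hf)).memLp_top_time
  · exact integrable_of_memLp_top (continuousOn_solutionDeriv hγ hT hk hf).memLp_top_time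
  · rw [coeff_incl_solution hγ hT hk hf hG (Ioo_subset_Icc_self ht),
      solution_eq_integral hγ _ _ _ (memLp_coeff hf k)
        (continuousOn_mlConv_coeff hk.zero_sub_one hf k) (Ioo_subset_Ioc_self ht)]
    congr 1
    exact intervalIntegral_congr_Ioo ht.1.le fun r hr =>
      (coeff_solutionDeriv hγ hT hk hf hG' ⟨hr.1.le, (hr.2.trans ht.2).le⟩ k).symm

/-- The equation `∂ₜ^γ u = f - 𝓛^s u` holds only in `ℍ^{-s}`. After applying `𝓛^{-s/2}` both sides
take values in `L²(Ω)`, with right-hand side `𝓛^{-s/2} f - 𝓛^{s/2} u`, and can be compared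
coefficient by coefficient. -/
lemma hasWeakTimeDeriv_fracIntegral_solutionDeriv (hγ1 : 1 < γ) (hγ2 : γ < 2) (hT : 0 < T)
    (hk : S.KernelBounds s γ T M) (hf : MemLp f ⊤ (timeMeasure T))
    (hG : ∀ k, S.coeff G k = S.wcoeff s g k) (hG' : ∀ k, S.coeff G' k = S.wcoeff (2 * s) g k) :
    HasWeakTimeDeriv T (fun t => S.incl s (S.lift s
        (fracIntegral (2 - γ) (fun r => S.solutionDeriv s γ f G' h r - h) t)))
      (fun t => S.incl s (S.lift s (f t)) - S.solution s γ f G h t) := by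
  have hcont : Continuous fun w => S.incl s (S.lift s w) :=
    (S.incl s).continuous.comp (S.lift s).continuous
  have ha := isSingularKernel_const (γ := γ) (μ := 2 - γ) hγ1.le (by linarith) (by linarith) T
  have hdu : MemLp (fun r => S.solutionDeriv s γ f G' h r - h) ⊤ (timeMeasure T) :=
    ((continuousOn_solutionDeriv hγ1 hT hk hf).sub continuousOn_const).memLp_top_time
  refine S.hasWeakTimeDeriv_of_coeff hT.le ?_ ?_ (fun _ => 0) fun k t ht => ?_
  · refine integrable_of_memLp_top (hcont.comp_continuousOn ?_).memLp_top_time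
    exact (continuousOn_conv ha hdu).congr fun t _ => S.fracIntegral_eq_conv γ _ _ t
  · exact ((((S.incl s).comp (S.lift s).toContinuousLinearMap).integrable_comp
      (integrable_of_memLp_top hf))).sub
      (integrable_of_memLp_top (continuousOn_solution hγ1 hT hk hf).memLp_top_time)
  · have e := solution_caputo hγ1 hγ2 (S.lam k ^ (s : ℝ)) (S.coeff g k) (S.coeff h k)
      (memLp_coeff (S := S) hf k) (continuousOn_mlConv_coeff hk.zero_sub_one hf k)
      (continuousOn_mlConv_coeff hk.zero_gamma hf k) (Ioo_subset_Ioc_self ht)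
    rw [coeff_incl_lift, S.fracIntegral_eq_conv γ, coeff_conv ha hdu ht.1.le ht.2.le, zero_add]
    refine Eq.trans (congrArg (fun x => S.lam k ^ (-((s : ℝ) / 2)) * x)
      (Eq.trans (intervalIntegral_congr_Ioo ht.1.le fun r hr => ?_) e)) ?_
    · rw [coeff_sub, coeff_solutionDeriv hγ1 hT hk hf hG' ⟨hr.1.le, (hr.2.trans ht.2).le⟩]
    beta_reduce
    rw [← intervalIntegral.integral_const_mul]
    refine intervalIntegral_congr_Ioo ht.1.le fun r hr => ?_
    rw [coeff_sub, coeff_incl_lift, coeff_solution hγ1 hT hk hf hG ⟨hr.1.le, (hr.2.trans ht.2).le⟩]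
    have e2 : S.lam k ^ ((s : ℝ) / 2) = S.lam k ^ (-((s : ℝ) / 2)) * S.lam k ^ (s : ℝ) := by
      rw [← Real.rpow_add (S.lam_pos k)]
      ring_nf
    rw [e2]
    ring

lemma hasInitialValue_toDual_solutionDeriv (hγ1 : 1 < γ) (hT : 0 < T)
    (hk : S.KernelBounds s γ T M) (hf : MemLp f ⊤ (timeMeasure T))
    (hG' : ∀ k, S.coeff G' k = S.wcoeff (2 * s) g k) :
    HasInitialValue T (fun t => S.toDual s (S.solutionDeriv s γ f G' h t)) (S.toDual s h) :=
  ⟨_, (S.toDual s).continuous.comp_continuousOn (continuousOn_solutionDeriv hγ1 hT hk hf),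
    EventuallyEq.rfl, congrArg (S.toDual s) (solutionDeriv_zero hγ1 hT hk hf hG')⟩

lemma hasCaputoDeriv_solution (hγ1 : 1 < γ) (hγ2 : γ < 2) (hT : 0 < T)
    (hk : S.KernelBounds s γ T M) (hf : MemLp f ⊤ (timeMeasure T))
    (hG : ∀ k, S.coeff G k = S.wcoeff s g k) (hG' : ∀ k, S.coeff G' k = S.wcoeff (2 * s) g k) :
    HasCaputoDeriv γ T (fun t => S.toDual s (S.incl s (S.lift s (S.solution s γ f G h t))))
      (fun t => S.dualLift s (S.incl s (S.lift s (f t)) - S.solution s γ f G h t)) := by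
  have hD : MemLp (fun t => S.solutionDeriv s γ f G' h t - h) ⊤ (timeMeasure T) :=
    ((continuousOn_solutionDeriv hγ1 hT hk hf).sub continuousOn_const).memLp_top_time
  refine ⟨fun t => S.toDual s (S.solutionDeriv s γ f G' h t), S.toDual s h,
    (hasWeakTimeDeriv_solution hγ1 hT hk hf hG hG').clm (S.toDual s),
    hasInitialValue_toDual_solutionDeriv hγ1 hT hk hf hG', ?_⟩
  refine ((hasWeakTimeDeriv_fracIntegral_solutionDeriv (h := h) hγ1 hγ2 hT hk hf hG hG').clm
    (S.dualLift s)).congr ?_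
  filter_upwards [ae_restrict_mem measurableSet_Ioo] with t ht
  have e := (S.toDual s).map_fracIntegral (σ := 2 - γ) (by linarith) hD (Ioo_subset_Icc_self ht)
  rw [dualLift_incl_lift, e]
  simp only [map_sub]

lemma isWeakSolution_solution (hγ1 : 1 < γ) (hγ2 : γ < 2) (hT : 0 < T)
    (hk : S.KernelBounds s γ T M) (hf : MemLp f ⊤ (timeMeasure T))
    (hG : ∀ k, S.coeff G k = S.wcoeff s g k) (hG' : ∀ k, S.coeff G' k = S.wcoeff (2 * s) g k) :
    S.IsWeakSolution s γ T f g h fun t => S.lift s (S.solution s γ f G h t) := by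
  have hU := continuousOn_solution (G := G) (h := h) hγ1 hT hk hf
  have hu : ContinuousOn (fun t => S.lift s (S.solution s γ f G h t)) (Icc 0 T) :=
    (S.lift s).continuous.comp_continuousOn hU
  have hw : MemLp (fun t => S.incl s (S.lift s (f t)) - S.solution s γ f G h t) ⊤
      (timeMeasure T) :=
    (hf.continuousLinearMap_comp ((S.incl s).comp (S.lift s).toContinuousLinearMap)).sub
      hU.memLp_top_time
  have hw2 : MemLp (fun t => S.incl s (S.lift s (f t)) - S.solution s γ f G h t) 2
      (timeMeasure T) := hw.mono_exponent le_top
  refine ⟨hu.memLp_top_time, S.solutionDeriv s γ f G' h,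
    fun t => S.dualLift s (S.incl s (S.lift s (f t)) - S.solution s γ f G h t),
    (continuousOn_solutionDeriv hγ1 hT hk hf).memLp_top_time,
    hasWeakTimeDeriv_solution hγ1 hT hk hf hG hG', hw2.continuousLinearMap_comp (S.dualLift s),
    hasCaputoDeriv_solution hγ1 hγ2 hT hk hf hG hG',
    ⟨_, (S.incl s).continuous.comp_continuousOn hu, EventuallyEq.rfl,
      incl_solution_zero hγ1 hT hk hf hG⟩,
    hasInitialValue_toDual_solutionDeriv hγ1 hT hk hf hG', Eventually.of_forall fun t v => ?_⟩
  beta_reduce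
  rw [fracPow_lift, map_sub, dualLift_incl_lift, _root_.sub_apply, sub_add_cancel]

end EllipticOperator.EigenSystem

end

/-! ### Uniqueness, the representation formula and the energy estimates -/

noncomputable section

namespace EllipticOperator.EigenSystem

variable {n : ℕ} {L : EllipticOperator n} {S : L.EigenSystem} {s : ℝ≥0} {γ T M : ℝ}
  {f : ℝ → L.L2} {g h : L.L2}

/-- The convolution is continuous and vanishes at `0`, which fixes the constant when the Caputo
equation is integrated in time. -/
lemma hasInitialValue_mlConv (hγ1 : 1 < γ) (hγ2 : γ < 2) {d : ℝ → L.L2}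
    (hd : MemLp d ⊤ (timeMeasure T)) (k : ℕ) :
    HasInitialValue T (mlConv γ 0 (2 - γ) fun r => S.coeff (d r) k) 0 := by
  have ha := isSingularKernel_const (γ := γ) (μ := 2 - γ) hγ1.le (by linarith) (by linarith) T
  have hc : ContinuousOn (S.conv (fun t _ => mlKernel γ 0 (2 - γ) t) d) (Icc 0 T) :=
    continuousOn_conv ha hd
  have he : ∀ t ∈ Icc 0 T, mlConv γ 0 (2 - γ) (fun r => S.coeff (d r) k) t =
      S.coeffL k (S.conv (fun t _ => mlKernel γ 0 (2 - γ) t) d t) := fun t ht =>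
    (coeff_conv ha hd ht.1 ht.2 k).symm
  exact ⟨_, ((S.coeffL k).continuous.comp_continuousOn hc).congr he, EventuallyEq.rfl,
    mlConv_at_zero _ _ _ _⟩

/-- The coefficients of a weak solution satisfy a Volterra equation. -/
lemma IsWeakSolution.ae_coeff_eq (hγ1 : 1 < γ) (hγ2 : γ < 2) (hT : 0 < T)
    (hf : MemLp f ⊤ (timeMeasure T)) {u : ℝ → S.HSpace s} (hu : S.IsWeakSolution s γ T f g h u)
    (k : ℕ) : ∀ᵐ t ∂timeMeasure T, S.coeff (S.incl s (u t)) k = S.coeff g k + t * S.coeff h k +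
      mlConv γ 0 γ (fun r => S.coeff (f r) k - S.lam k ^ (s : ℝ) * S.coeff (S.incl s (u r)) k) t := by
  obtain ⟨hum, du, w, hdum, hwd, -, ⟨dv, x, hdv, hx, hcap⟩, hg, hh, heq⟩ := hu
  obtain ⟨v, hv⟩ := S.exists_incl_eq_φ s k
  let ev : S.HDual s →L[ℝ] ℝ := ContinuousLinearMap.apply ℝ ℝ v
  have hev : ∀ ℓ : S.HDual s, ev ℓ = ℓ v := fun _ => rfl
  have h1 : HasWeakTimeDeriv T (fun t => S.coeff (S.incl s (u t)) k) fun t => S.coeff (du t) k :=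
    hwd.clm (S.coeffL k)
  have hcd := h1.ae_eq hT (hg.clm (S.coeffL k))
  -- The Caputo derivative comes with its own first derivative `dv` and initial value `x` in
  -- `ℍ^{-s}`. Tested with `φ_k`, they must agree with `du` and `h` by uniqueness of weak
  -- derivatives and of initial values.
  have h2 := hdv.clm ev
  simp only [hev, S.toDual_apply_eq_coeff hv] at h2
  have hdd := h1.unique h2
  have hhe := hh.clm ev
  simp only [hev, S.toDual_apply_eq_coeff hv] at hhe
  have hxh : x v = S.coeff h k := (hx.clm ev).unique hT hhe hdd.symm
  have hdvm : MemLp (fun t => dv t - x) ⊤ (timeMeasure T) := by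
    obtain ⟨v', hv', hvv', -⟩ := hx
    exact (hv'.memLp_top_time.ae_eq hvv'.symm).sub (memLp_const x)
  have hduh : MemLp (fun t => du t - h) ⊤ (timeMeasure T) := hdum.sub (memLp_const h)
  have hp : HasWeakTimeDeriv T (mlConv γ 0 (2 - γ) fun r => S.coeff (du r - h) k)
      fun t => w t v := by
    refine (hcap.clm ev).congr ?_
    filter_upwards [ae_restrict_mem measurableSet_Ioo] with t ht
    rw [ev.map_fracIntegral (by linarith) hdvm (Ioo_subset_Icc_self ht),
      fracIntegral_eq_mlKernel γ, mlConv]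
    refine intervalIntegral_congr_ae_time ht.1.le ht.2.le ?_
    filter_upwards [hdd] with r hr
    rw [hev, _root_.sub_apply, hxh, ← hr, coeff_sub]
  have hpe := hp.ae_eq hT (hasInitialValue_mlConv hγ1 hγ2 hduh k)
  refine ae_eq_volterra hγ1 hγ2 (memLp_coeff hf k)
    (memLp_coeff (hum.continuousLinearMap_comp (S.incl s)) k) (memLp_coeff hdum k) hcd ?_
  filter_upwards [hpe, ae_restrict_mem measurableSet_Ioo] with t ht htm
  simp only [coeff_sub, zero_add] at ht
  rw [ht]
  refine intervalIntegral_congr_ae_time htm.1.le htm.2.le ?_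
  filter_upwards [heq] with r hr
  have := hr v
  rw [S.fracPow_apply_eq_coeff hv, S.toDual_apply_eq_coeff hv] at this
  linarith

lemma IsWeakSolution.unique (hγ1 : 1 < γ) (hγ2 : γ < 2) (hT : 0 < T)
    (hf : MemLp f ⊤ (timeMeasure T)) {u u' : ℝ → S.HSpace s}
    (hu : S.IsWeakSolution s γ T f g h u) (hu' : S.IsWeakSolution s γ T f g h u') :
    u =ᵐ[timeMeasure T] u' := by
  have hk : ∀ k, (fun t => S.coeff (S.incl s (u t)) k) =ᵐ[timeMeasure T]
      fun t => S.coeff (S.incl s (u' t)) k := fun k =>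
    ae_eq_of_volterra hγ1.le (memLp_coeff hf k)
      (memLp_coeff (hu.1.continuousLinearMap_comp (S.incl s)) k)
      (memLp_coeff (hu'.1.continuousLinearMap_comp (S.incl s)) k)
      (hu.ae_coeff_eq hγ1 hγ2 hT hf k) (hu'.ae_coeff_eq hγ1 hγ2 hT hf k)
  filter_upwards [ae_all_iff.2 hk] with t ht
  exact S.incl_injective s (S.ext_coeff ht)

lemma opG_eq_diag (t : ℝ) (w : L.L2) : S.opG s γ t w = S.diag (S.kern s γ 0 1 t) w := by
  rw [opG, diag]
  simp only [kern_zero, mlKernel, sub_self, Real.rpow_zero, one_mul]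

lemma opH_eq_diag (t : ℝ) (w : L.L2) : S.opH s γ t w = S.diag (S.kern s γ 0 2 t) w := by
  rw [opH, diag]
  simp only [kern_zero, mlKernel, show (2 : ℝ) - 1 = 1 by norm_num, Real.rpow_one]

lemma opF_eq_diag (t : ℝ) (w : L.L2) : S.opF s γ t w = S.diag (S.kern s γ 0 γ t) w := by
  rw [opF, diag]
  simp only [kern_zero, mlKernel]

variable {G G' : L.L2}

lemma incl_solution_eq (hγ1 : 1 < γ) (hγ2 : γ < 2) (hT : 0 < T) (hk : S.KernelBounds s γ T M)
    (hf : MemLp f ⊤ (timeMeasure T)) (hG : ∀ k, S.coeff G k = S.wcoeff s g k) {t : ℝ}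
    (ht : t ∈ Icc 0 T) : S.incl s (S.lift s (S.solution s γ f G h t)) =
      S.opG s γ t g + S.opH s γ t h + ∫ r in (0 : ℝ)..t, S.opF s γ (t - r) (f r) := by
  -- The available bound for index `2` carries the power `θ = 1/2`; the operator `H_γ` itself has `θ
  -- = 0`.
  obtain ⟨N, hN⟩ := exists_isSingularKernel_kern L s (γ := γ) (θ := 0) (μ := 2) (β := 1) hγ1 hγ2
    two_pos (by linarith) le_rfl zero_le_one one_pos le_rfl (by linarith) hT
  simp only [opG_eq_diag, opH_eq_diag, opF_eq_diag]
  refine S.ext_coeff fun k => ?_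
  change _ = S.coeff (_ + S.conv (S.kern s γ 0 γ) f t) k
  rw [coeff_incl_solution hγ1 hT hk hf hG ht, coeff_add, coeff_add,
    coeff_diag_kern hγ1.le le_rfl hT hk.zero_one g ht,
    coeff_diag_kern hγ1.le one_le_two hT (hN S) h ht, coeff_conv_kern_zero hk.zero_gamma hf ht,
    kern_zero, kern_zero]

/-! ### Energy estimates. -/

lemma add_le_mul_add {a b c K x y z : ℝ≥0∞} (ha : a ≤ K) (hb : b ≤ K) (hc : c ≤ K) :
    a * x + b * y + c * z ≤ K * (z + x + y) := by
  calc a * x + b * y + c * z ≤ K * x + K * y + K * z := by gcongr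
    _ = K * (z + x + y) := by ring

/-- The constant of the energy estimates, in terms of a bound for the kernels. -/
def energyConst (γ T M : ℝ) : ℝ :=
  M + M * √(T ^ (2 * (γ / 2) - 1) / (2 * (γ / 2) - 1)) + M * (T ^ (γ - 1) / (γ - 1))

lemma le_energyConst (hγ : 1 < γ) (hT : 0 < T) (hM : 0 ≤ M) :
    M ≤ energyConst γ T M ∧
    M * √(T ^ (2 * (γ / 2) - 1) / (2 * (γ / 2) - 1)) ≤ energyConst γ T M ∧
    M * (T ^ (γ - 1) / (γ - 1)) ≤ energyConst γ T M := by
  have h1 : 0 ≤ M * √(T ^ (2 * (γ / 2) - 1) / (2 * (γ / 2) - 1)) :=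
    mul_nonneg hM (Real.sqrt_nonneg _)
  have h2 : 0 ≤ M * (T ^ (γ - 1) / (γ - 1)) :=
    mul_nonneg hM (div_nonneg (Real.rpow_nonneg hT.le _) (by linarith))
  unfold energyConst
  refine ⟨?_, ?_, ?_⟩ <;> linarith

lemma enorm_diag_kern_le {θ μ : ℝ} (hγ : 1 ≤ γ) (hμ : 1 ≤ μ) (hT : 0 < T)
    (ha : IsSingularKernel T M 1 (S.kern s γ θ μ)) (w : L.L2) {t : ℝ} (ht : t ∈ Icc 0 T) :
    ‖S.diag (S.kern s γ θ μ t) w‖ₑ ≤ ENNReal.ofReal M * ‖w‖ₑ :=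
  enorm_diag_le (ha.bound_one hT (S.continuous_kern hγ hμ) ht) w

/-- `lift` is an isometry, so the `ℍ^s` norm of `u` is the `L²` norm of `𝓛^{s/2} u`. The source term
needs only `f ∈ L²` in time because `t^(γ/2-1)` is square integrable near `0`. -/
lemma eLpNorm_solution_le (hγ1 : 1 < γ) (hT : 0 < T) (hk : S.KernelBounds s γ T M)
    (hf : MemLp f ⊤ (timeMeasure T)) :
    eLpNorm (fun t => S.lift s (S.solution s γ f G h t)) ⊤ (timeMeasure T) ≤
      ENNReal.ofReal (energyConst γ T M) * (eLpNorm f 2 (timeMeasure T) + ‖G‖ₑ + ‖h‖ₑ) := by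
  obtain ⟨c1, c2, -⟩ := le_energyConst hγ1 hT hk.zero_one.nonneg
  rw [eLpNorm_exponent_top]
  refine eLpNormEssSup_le_of_ae_enorm_bound ?_
  filter_upwards [ae_restrict_mem measurableSet_Ioo] with t ht
  have ht' := Ioo_subset_Icc_self ht
  rw [(S.lift s).enorm_map]
  refine ((enorm_add_le _ _).trans (add_le_add_left (enorm_add_le _ _) _)).trans
    (le_trans (add_le_add (add_le_add (enorm_diag_kern_le hγ1.le le_rfl hT hk.zero_one G ht')
      (enorm_diag_kern_le hγ1.le one_le_two hT hk.half_two h ht'))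
      (enorm_conv_le_two hk.half_gamma (by linarith) hf.1 ht'.1 ht'.2)) ?_)
  exact add_le_mul_add (ENNReal.ofReal_le_ofReal c1) (ENNReal.ofReal_le_ofReal c1)
    (ENNReal.ofReal_le_ofReal c2)

lemma eLpNorm_solutionDeriv_le_top (hγ1 : 1 < γ) (hT : 0 < T) (hk : S.KernelBounds s γ T M) :
    eLpNorm (S.solutionDeriv s γ f G h) ⊤ (timeMeasure T) ≤
      ENNReal.ofReal (energyConst γ T M) * (eLpNorm f ⊤ (timeMeasure T) + ‖G‖ₑ + ‖h‖ₑ) := by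
  obtain ⟨c1, -, c3⟩ := le_energyConst hγ1 hT hk.zero_one.nonneg
  rw [eLpNorm_exponent_top]
  refine eLpNormEssSup_le_of_ae_enorm_bound ?_
  filter_upwards [ae_restrict_mem measurableSet_Ioo] with t ht
  have ht' := Ioo_subset_Icc_self ht
  refine ((enorm_add_le _ _).trans (add_le_add_left (enorm_add_le _ _) _)).trans ?_
  rw [enorm_neg]
  refine le_trans (add_le_add (add_le_add (enorm_diag_kern_le hγ1.le hγ1.le hT hk.zero_gamma G ht')
      (enorm_diag_kern_le hγ1.le le_rfl hT hk.zero_one h ht'))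
      (enorm_conv_le_top hk.zero_sub_one ht'.1 ht'.2)) ?_
  exact add_le_mul_add (ENNReal.ofReal_le_ofReal c1) (ENNReal.ofReal_le_ofReal c1)
    (ENNReal.ofReal_le_ofReal c3)

/-- Half of the power `𝓛^s` is moved from `g` to the kernel. The kernel becomes singular at `t = 0`
but stays square integrable, and only the `ℍ^s` norm of `g` is spent. -/
lemma diag_kern_gamma_eq (hγ1 : 1 < γ) (hT : 0 < T) (hk : S.KernelBounds s γ T M)
    (hG : ∀ k, S.coeff G k = S.wcoeff s g k) (hG' : ∀ k, S.coeff G' k = S.wcoeff (2 * s) g k)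
    {t : ℝ} (ht : t ∈ Ioo 0 T) :
    S.diag (S.kern s γ 0 γ t) G' = S.diag (S.kern s γ (1 / 2) γ t) G := S.ext_coeff fun k => by
  rw [coeff_diag_kern hγ1.le hγ1.le hT hk.zero_gamma G' (Ioo_subset_Icc_self ht),
    coeff_diag (hk.half_gamma.bound t (Ioo_subset_Ioc_self ht)), hG, hG', kern_zero, kern_half,
    wcoeff, wcoeff, NNReal.coe_mul, NNReal.coe_ofNat, mul_div_cancel_left₀ _ (two_ne_zero' ℝ)]
  have e : S.lam k ^ (s : ℝ) = S.lam k ^ ((s : ℝ) / 2) * S.lam k ^ ((s : ℝ) / 2) := by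
    rw [← Real.rpow_add (S.lam_pos k), add_halves]
  nth_rw 2 [e]
  ring

/-- The terms in `g` and `h` use square integrability of `t^(γ/2-1)`. The kernel `t^(γ-2)` of the
source term is only known to be integrable, so Young's inequality takes the place of Cauchy–Schwarz.
-/
lemma eLpNorm_solutionDeriv_le_two (hγ1 : 1 < γ) (hT : 0 < T) (hk : S.KernelBounds s γ T M)
    (hf : MemLp f ⊤ (timeMeasure T)) (hG : ∀ k, S.coeff G k = S.wcoeff s g k)
    (hG' : ∀ k, S.coeff G' k = S.wcoeff (2 * s) g k) :
    eLpNorm (S.solutionDeriv s γ f G' h) 2 (timeMeasure T) ≤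
      ENNReal.ofReal (energyConst γ T M) * (eLpNorm f 2 (timeMeasure T) + ‖G‖ₑ + ‖h‖ₑ) := by
  obtain ⟨-, c2, c3⟩ := le_energyConst hγ1 hT hk.zero_one.nonneg
  have m1 := (continuousOn_diag_kern hγ1.le hγ1.le hT hk.zero_gamma G').neg.memLp_top_time.1
  have m2 := (continuousOn_diag_kern hγ1.le le_rfl hT hk.zero_one h).memLp_top_time.1
  have m3 := (continuousOn_conv (S := S) hk.zero_sub_one hf).memLp_top_time.1
  have e1 : eLpNorm (-fun t => S.diag (S.kern s γ 0 γ t) G') 2 (timeMeasure T) =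
      eLpNorm (fun t => S.diag (S.kern s γ (1 / 2) γ t) G) 2 (timeMeasure T) := by
    rw [eLpNorm_neg]
    refine eLpNorm_congr_ae ?_
    filter_upwards [ae_restrict_mem measurableSet_Ioo] with t ht
    exact diag_kern_gamma_eq hγ1 hT hk hG hG' ht
  refine ((eLpNorm_add_le (m1.add m2) m3 one_le_two).trans
    (add_le_add_left (eLpNorm_add_le m1 m2 one_le_two) _)).trans ?_
  refine le_trans (add_le_add (add_le_add (e1.trans_le
      (eLpNorm_diag_le_two hk.half_gamma (by linarith) hT.le G))
      (eLpNorm_diag_le_two hk.zero_one' (by linarith) hT.le h))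
      (eLpNorm_conv_le_two hk.zero_sub_one hT.le hf.1)) ?_
  exact add_le_mul_add (ENNReal.ofReal_le_ofReal c2) (ENNReal.ofReal_le_ofReal c2)
    (ENNReal.ofReal_le_ofReal c3)

end EllipticOperator.EigenSystem

end

/-! ### The main theorem. -/

theorem mainTheorem1 (n : ℕ) (L : EllipticOperator n)
    (s : ℝ≥0) (hs0 : 0 < s) (hs1 : s < 1) (γ : ℝ) (hγ1 : 1 < γ) (hγ2 : γ < 2)
    (T : ℝ) (hT : 0 < T) :
    Nonempty L.EigenSystem ∧
    ∃ C : ℝ≥0, ∀ (S : L.EigenSystem) (f : ℝ → L.L2) (g h : L.L2),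
      MemLp f ∞ (timeMeasure T) → g ∈ S.hSub (2 * s) →
      ∃ (u : ℝ → S.HSpace s) (du : ℝ → L.L2),
        -- existence and uniqueness
        S.IsWeakSolution s γ T f g h u ∧
        (∀ u' : ℝ → S.HSpace s, S.IsWeakSolution s γ T f g h u' → u' =ᵐ[timeMeasure T] u) ∧
        -- the representation formula
        (∀ t ∈ Icc 0 T, S.incl s (u t) =
          S.opG s γ t g + S.opH s γ t h + ∫ r in (0 : ℝ)..t, S.opF s γ (t - r) (f r)) ∧
        -- `du` is the time derivative of `u`; the initial values are attained continuously
        HasWeakTimeDeriv T (fun t => S.incl s (u t)) du ∧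
        ContinuousOn u (Icc 0 T) ∧ S.incl s (u 0) = g ∧
        ContinuousOn du (Icc 0 T) ∧ du 0 = h ∧
        -- the energy estimates
        eLpNorm u ∞ (timeMeasure T) + eLpNorm du 2 (timeMeasure T) ≤
          C * (eLpNorm f 2 (timeMeasure T) + ENNReal.ofReal (S.hNorm s g) + ‖h‖ₑ) ∧
        eLpNorm du ∞ (timeMeasure T) ≤
          C * (eLpNorm f ∞ (timeMeasure T) + ENNReal.ofReal (S.hNorm (2 * s) g) + ‖h‖ₑ) := by
  refine ⟨L.nonempty_eigenSystem, ?_⟩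
  obtain ⟨M, hM⟩ := EllipticOperator.EigenSystem.exists_kernelBounds L s hγ1 hγ2 hT
  -- The factor `2` arises because the first estimate adds two bounds, each with the constant
  -- `energyConst`.
  refine ⟨2 * (EllipticOperator.EigenSystem.energyConst γ T M).toNNReal,
    fun S f g h hf hg => ?_⟩
  have hk := hM S
  have hle : s ≤ 2 * s := le_mul_of_one_le_left' one_le_two
  -- `G = 𝓛^{s/2} g` enters the solution and the `ℍ^s` norm of the data; `G' = 𝓛^s g` enters the
  -- time derivative and the `ℍ^{2s}` norm.
  obtain ⟨G, hG, hGn⟩ := S.exists_coeff_eq_wcoeff (S.mem_hSub_of_le hle hg)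
  obtain ⟨G', hG', hGn'⟩ := S.exists_coeff_eq_wcoeff hg
  have hsol := EllipticOperator.EigenSystem.isWeakSolution_solution (h := h) hγ1 hγ2 hT hk hf hG hG'
  refine ⟨fun t => S.lift s (S.solution s γ f G h t), S.solutionDeriv s γ f G' h, hsol,
    fun u' hu' => hu'.unique hγ1 hγ2 hT hf hsol,
    fun t ht => EllipticOperator.EigenSystem.incl_solution_eq hγ1 hγ2 hT hk hf hG ht,
    EllipticOperator.EigenSystem.hasWeakTimeDeriv_solution hγ1 hT hk hf hG hG',
    (S.lift s).continuous.comp_continuousOn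
      (EllipticOperator.EigenSystem.continuousOn_solution hγ1 hT hk hf),
    EllipticOperator.EigenSystem.incl_solution_zero hγ1 hT hk hf hG,
    EllipticOperator.EigenSystem.continuousOn_solutionDeriv hγ1 hT hk hf,
    EllipticOperator.EigenSystem.solutionDeriv_zero hγ1 hT hk hf hG', ?_, ?_⟩
  · have h1 := EllipticOperator.EigenSystem.eLpNorm_solution_le (G := G) (h := h) hγ1 hT hk hf
    have h2 := EllipticOperator.EigenSystem.eLpNorm_solutionDeriv_le_two (h := h) hγ1 hT hk hf hG hG'
    refine (add_le_add h1 h2).trans_eq ?_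
    rw [← hGn, ofReal_norm, ← two_mul, ← mul_assoc]
    rfl
  · refine (EllipticOperator.EigenSystem.eLpNorm_solutionDeriv_le_top hγ1 hT hk).trans ?_
    rw [← hGn', ofReal_norm]
    gcongr
    change (((EllipticOperator.EigenSystem.energyConst γ T M).toNNReal : ℝ≥0) : ℝ≥0∞) ≤ _
    exact_mod_cast le_mul_of_one_le_left' one_le_two
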